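/- Theorem 1.9. Let $P\subset\mathbb{R}^n$ be a convex polytope (the convex hull of a finite set of points) of dimension $m\le n$, and let $j$ be an integer with $2\le j\le m-2$. Here the dimension of a nonempty set is that of its affine hull; a face of $P$ is a nonempty set of the form $\{x\in P : \ell(x)=\max_{P}\ell\}$ for a linear functional $\ell$ on $\mathbb{R}^n$ (so that $P$ itself is a face, by $\ell=0$); and a set $X\subset\mathbb{R}^n$ is centrally symmetric if $X=2c-X$ for some $c\in\mathbb{R}^n$. Suppose that all $j$-dimensional faces of $P$ are centrally symmetric. Then the faces of $P$ of every dimension, including $P$ itself, are centrally symmetric, and $P$ is a zonotope, i.e. there are finitely many vectors $a_1,\dots,a_k\in\mathbb{R}^n$ and a vector $v\in\mathbb{R}^n$ with $$P=v+\Bigl\{\sum_{i=1}^k t_i a_i : 0\le t_i\le 1 \text{ for all } i\Bigr\}.$$ -/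

import Mathlib

/-- A convex polytope in `ℝⁿ`: the convex hull of a finite set of points. -/
def IsConvexPolytope {n : ℕ} (P : Set (EuclideanSpace ℝ (Fin n))) : Prop :=
  ∃ S : Set (EuclideanSpace ℝ (Fin n)), S.Finite ∧ P = convexHull ℝ S

/-- The dimension of a set: the dimension of its affine hull. It is used only for nonempty sets
(for the empty set it takes the value `0`). -/
noncomputable def setDim {n : ℕ} (X : Set (EuclideanSpace ℝ (Fin n))) : ℕ :=
  Module.finrank ℝ (affineSpan ℝ X).direction

/-- The (nonempty) faces of `P`: the nonempty sets on which some linear functional attains its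
maximum over `P`. The zero functional exhibits a nonempty `P` as a face of itself. -/
def IsFaceOfPolytope {n : ℕ} (P F : Set (EuclideanSpace ℝ (Fin n))) : Prop :=
  F.Nonempty ∧ IsExposed ℝ P F

/-- The symmetric image `X_c = 2c - X` of `X` with respect to the point `c`. -/
def symmetricImage {n : ℕ} (c : EuclideanSpace ℝ (Fin n)) (X : Set (EuclideanSpace ℝ (Fin n))) :
    Set (EuclideanSpace ℝ (Fin n)) :=
  (fun x => (2 : ℝ) • c - x) '' X

/-- `X` is centrally symmetric: it equals its symmetric image with respect to some center `c`. -/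
def IsCentrallySymmetric {n : ℕ} (X : Set (EuclideanSpace ℝ (Fin n))) : Prop :=
  ∃ c : EuclideanSpace ℝ (Fin n), X = symmetricImage c X

/-- The zonotope `{∑ tᵢ aᵢ | 0 ≤ tᵢ ≤ 1}` generated by the vectors `a₁, …, aₖ`. -/
def zonotope {n k : ℕ} (a : Fin k → EuclideanSpace ℝ (Fin n)) :
    Set (EuclideanSpace ℝ (Fin n)) :=
  {x | ∃ t : Fin k → ℝ, (∀ i, 0 ≤ t i ∧ t i ≤ 1) ∧ x = ∑ i, t i • a i}

/-- `P` is a zonotope, as a property of a polytope positioned anywhere in `ℝⁿ`: it is a translate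
of the zonotope generated by finitely many vectors (equivalently, a Minkowski sum of finitely many
line segments, positioned anywhere). -/
def IsZonotope {n : ℕ} (P : Set (EuclideanSpace ℝ (Fin n))) : Prop :=
  ∃ (k : ℕ) (a : Fin k → EuclideanSpace ℝ (Fin n)) (v : EuclideanSpace ℝ (Fin n)),
    P = (fun x => v + x) '' zonotope a

/-!
# Polytopes with centrally symmetric faces

A polytope is represented by its set `S` of vertices, and its face in direction `u` by the set
`face S u` of vertices maximizing `⟪·, u⟫`. For a finite set `D` of vectors containing all
differences of vertices, `face S u` depends only on the cell of the hyperplane arrangement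
`{dᗮ | d ∈ D}` that contains `u`. The flats of the arrangement correspond to the subspaces
`N = nullSpan D u`, and the faces parallel to `N` are the `face S u` for `u` in the chambers of the
flat. Nearly all arguments follow a property of these faces on a walk through the chambers
(`chamber_induction`), where the faces on the two sides of a wall are opposite faces of the face at
the wall.

*Going up.* If the facets of a polytope `K` of dimension at least `3` are centrally symmetric, so is
`K` (`isSymm_of_facets`). Its ridges parallel to a given flat agree up to reflection, so opposite
facets of `K` are two centrally symmetric polytopes whose facets agree up to translation and
reflection. Such polytopes are translates of each other (`exists_vadd_eq_of_facets_pm`), and hence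
`K` is a translate of `-K`, as both have the same facets (`exists_vadd_eq_of_shape_face_eq`). The
uniqueness result is reduced to dimension two lower, and finally to polygons, where it is clear, and
to dimension three. There it follows from the symmetry of mixed volumes and Minkowski's inequality
for the mixed area of a polygon and its reflection (`areaForm_sub_nonpos_of_reflection`). For both
the mixed volume is written as a sum over the flags of the arrangement, and its symmetry comes from
the involution that passes from a flag to the adjacent one (`sum_next`).

*Going down.* If all faces of dimensions `k + 1` and `k + 2` are centrally symmetric, and the
polytope has dimension at least `k + 3`, so are the faces of dimension `k` (`isSymm_of_faces_succ`).
If a face parallel to `N` is not, all faces parallel to `N` are copies of it or of its reflection,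
and the two kinds alternate exactly at the walls at which there is a face of dimension `k + 1`.
Given two such walls, the face of dimension `k + 2` parallel to their span is centrally symmetric,
and this parity forces a third such wall in their span (`exists_third_wall`). By the
Sylvester–Gallai theorem the walls span at most two dimensions modulo `N`, so that some nonconstant linear
functional on the polytope never changes on a walk through the chambers, a contradiction.

*Zonotopes.* When the two-dimensional faces are centrally symmetric, parallel edges have the same
length, so on a walk through all chambers the vertex in direction `u` is a constant plus half the
sum of the edge vectors oriented along `u` (`exists_vertex_formula`). These are the vertices of a
zonotope.
-/

open Module Submodule Filter Topology
open scoped RealInnerProductSpace Pointwise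

set_option linter.unusedSectionVars false

namespace SymmetricFaces

variable {E : Type*} [NormedAddCommGroup E] [InnerProductSpace ℝ E]

/-! ### Faces of finite sets and lexicographic perturbation -/

/-- The face of `S` in direction `u`: the points of `S` maximizing `⟪·, u⟫`. It is used for the
vertex set `S` of a polytope, so that a face is represented by its set of vertices. -/
def face (S : Set E) (u : E) : Set E := {x | x ∈ S ∧ ∀ y ∈ S, ⟪y, u⟫ ≤ ⟪x, u⟫}

lemma face_subset (S : Set E) (u : E) : face S u ⊆ S := fun _ hx => hx.1

lemma inner_eq_of_mem_face {S : Set E} {u x y : E} (hx : x ∈ face S u) (hy : y ∈ face S u) :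
    ⟪x, u⟫ = ⟪y, u⟫ := le_antisymm (hy.2 _ hx.1) (hx.2 _ hy.1)

/-- The span of the vectors of `D` orthogonal to `u`. Its orthogonal complement is the smallest
flat of the hyperplane arrangement `{dᗮ | d ∈ D}` containing `u`. -/
def nullSpan (D : Set E) (u : E) : Submodule ℝ E := span ℝ {d | d ∈ D ∧ ⟪d, u⟫ = 0}

/-- `u` and `v` lie in the same cell of the hyperplane arrangement `{dᗮ | d ∈ D}`. -/
def SameSign (D : Set E) (u v : E) : Prop :=
  ∀ d ∈ D, SignType.sign ⟪d, u⟫ = SignType.sign ⟪d, v⟫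

/-- `D` contains all differences of points of `S`. -/
def Adapted (D S : Set E) : Prop := ∀ x ∈ S, ∀ y ∈ S, x - y ∈ D

lemma SameSign.inner_eq_zero_iff {D : Set E} {u v d : E} (h : SameSign D u v) (hd : d ∈ D) :
    ⟪d, u⟫ = 0 ↔ ⟪d, v⟫ = 0 := by
  rw [← sign_eq_zero_iff, h d hd, sign_eq_zero_iff]

lemma SameSign.nullSpan_eq {D : Set E} {u v : E} (h : SameSign D u v) :
    nullSpan D u = nullSpan D v := by
  unfold nullSpan
  congr 1
  ext d
  exact and_congr_right fun hd => h.inner_eq_zero_iff hd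

lemma mem_face_iff_sign {S : Set E} {u x : E} :
    x ∈ face S u ↔ x ∈ S ∧ ∀ y ∈ S, 0 ≤ SignType.sign ⟪x - y, u⟫ := by
  simp only [face, Set.mem_ofPred_eq, sign_nonneg_iff, inner_sub_left, sub_nonneg]

lemma SameSign.face_eq {D S : Set E} {u v : E} (h : SameSign D u v) (hS : Adapted D S) :
    face S u = face S v := by
  ext x
  rw [mem_face_iff_sign, mem_face_iff_sign]
  refine and_congr_right fun hx => forall₂_congr fun y hy => ?_
  rw [h _ (hS x hx y hy)]

lemma eventually_sign_add_smul {D : Set E} (hD : D.Finite) (a b : E) :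
    ∀ᶠ ε : ℝ in 𝓝[>] 0, ∀ d ∈ D, SignType.sign ⟪d, a + ε • b⟫ =
      if ⟪d, a⟫ = 0 then SignType.sign ⟪d, b⟫ else SignType.sign ⟪d, a⟫ := by
  rw [eventually_all_finite hD]
  intro d _
  have hc : Tendsto (fun ε : ℝ => ⟪d, a + ε • b⟫) (𝓝[>] 0) (𝓝 ⟪d, a⟫) := by
    have : Continuous fun ε : ℝ => ⟪d, a + ε • b⟫ := by fun_prop
    have h := this.tendsto 0
    simp only [zero_smul, add_zero] at h
    exact h.mono_left nhdsWithin_le_nhds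
  rcases lt_trichotomy ⟪d, a⟫ 0 with h | h | h
  · filter_upwards [hc.eventually_lt_const h] with ε hε
    rw [if_neg h.ne, sign_neg hε, sign_neg h]
  · filter_upwards [self_mem_nhdsWithin] with ε hε
    rw [if_pos h, inner_add_right, h, zero_add, inner_smul_right, sign_mul, sign_pos hε, one_mul]
  · filter_upwards [hc.eventually_const_lt h] with ε hε
    rw [if_neg h.ne', sign_pos hε, sign_pos h]

open Classical in
/-- The vector `a + ε • b` for an `ε > 0` so small that the signs of `⟪d, a + ε • b⟫`, `d ∈ D`, are
determined lexicographically by those of `⟪d, a⟫` and `⟪d, b⟫`. (The value `a` for an infinite `D`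
is junk.) -/
noncomputable def nudge (D : Set E) (a b : E) : E :=
  if h : ∃ ε : ℝ, 0 < ε ∧ ∀ d ∈ D, SignType.sign ⟪d, a + ε • b⟫ =
      if ⟪d, a⟫ = 0 then SignType.sign ⟪d, b⟫ else SignType.sign ⟪d, a⟫ then a + h.choose • b else a

lemma sign_nudge {D : Set E} (hD : D.Finite) (a b : E) {d : E} (hd : d ∈ D) :
    SignType.sign ⟪d, nudge D a b⟫ =
      if ⟪d, a⟫ = 0 then SignType.sign ⟪d, b⟫ else SignType.sign ⟪d, a⟫ := by
  have h : ∃ ε : ℝ, 0 < ε ∧ ∀ d ∈ D, SignType.sign ⟪d, a + ε • b⟫ =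
      if ⟪d, a⟫ = 0 then SignType.sign ⟪d, b⟫ else SignType.sign ⟪d, a⟫ :=
    ((eventually_mem_nhdsWithin).and (eventually_sign_add_smul hD a b)).exists
  rw [nudge, dif_pos h]
  exact h.choose_spec.2 d hd

lemma sign_nudge_of_eq {D : Set E} (hD : D.Finite) {a b : E} {d : E} (hd : d ∈ D)
    (h : ⟪d, a⟫ = 0) : SignType.sign ⟪d, nudge D a b⟫ = SignType.sign ⟪d, b⟫ := by
  rw [sign_nudge hD a b hd, if_pos h]

lemma sign_nudge_of_ne {D : Set E} (hD : D.Finite) {a b : E} {d : E} (hd : d ∈ D)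
    (h : ⟪d, a⟫ ≠ 0) : SignType.sign ⟪d, nudge D a b⟫ = SignType.sign ⟪d, a⟫ := by
  rw [sign_nudge hD a b hd, if_neg h]

lemma inner_nudge_eq_zero_iff {D : Set E} (hD : D.Finite) {a b : E} {d : E} (hd : d ∈ D) :
    ⟪d, nudge D a b⟫ = 0 ↔ ⟪d, a⟫ = 0 ∧ ⟪d, b⟫ = 0 := by
  rw [← sign_eq_zero_iff, sign_nudge hD a b hd]
  split_ifs with h <;> simp [h]

lemma nudge_neg_sameSign {D : Set E} (hD : D.Finite) (a b : E) :
    SameSign D (nudge D (-a) (-b)) (-nudge D a b) := by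
  intro d hd
  rw [inner_neg_right, Left.sign_neg, sign_nudge hD _ _ hd, sign_nudge hD _ _ hd]
  simp only [inner_neg_right, Left.sign_neg, neg_eq_zero]
  split_ifs <;> rfl

lemma nullSpan_nudge {D : Set E} (hD : D.Finite) (a b : E) :
    nullSpan D (nudge D a b) = nullSpan {d | d ∈ D ∧ ⟪d, a⟫ = 0} b := by
  unfold nullSpan
  congr 1
  ext d
  simp only [Set.mem_ofPred_eq, and_assoc]
  exact and_congr_right fun hd => inner_nudge_eq_zero_iff hD hd

lemma nullSpan_neg (D : Set E) (u : E) : nullSpan D (-u) = nullSpan D u := by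
  simp [nullSpan]

lemma nullSpan_nudge_neg {D : Set E} (hD : D.Finite) (a b : E) :
    nullSpan D (nudge D a (-b)) = nullSpan D (nudge D a b) := by
  rw [nullSpan_nudge hD, nullSpan_nudge hD, nullSpan_neg]

lemma nullSpan_nudge_le {D : Set E} (hD : D.Finite) (a b : E) :
    nullSpan D (nudge D a b) ≤ nullSpan D a := by
  rw [nullSpan_nudge hD]
  exact span_mono fun d hd => hd.1

lemma inner_eq_zero_of_mem_nullSpan {D : Set E} {u x : E} (hx : x ∈ nullSpan D u) : ⟪x, u⟫ = 0 := by
  induction hx using span_induction with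
  | mem x hx => exact hx.2
  | zero => simp
  | add x y _ _ hx hy => rw [inner_add_left, hx, hy, add_zero]
  | smul c x _ hx => rw [inner_smul_left, hx, mul_zero]

lemma mem_nullSpan_iff {D : Set E} {u d : E} (hd : d ∈ D) : d ∈ nullSpan D u ↔ ⟪d, u⟫ = 0 :=
  ⟨inner_eq_zero_of_mem_nullSpan, fun h => subset_span ⟨hd, h⟩⟩

/-- A face of a face is a face. -/
lemma face_nudge {D S : Set E} (hD : D.Finite) (hS : Adapted D S) (a b : E) :
    face S (nudge D a b) = face (face S a) b := by
  ext x
  constructor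
  · intro hx
    rw [mem_face_iff_sign] at hx
    have hxa : x ∈ face S a := by
      refine mem_face_iff_sign.2 ⟨hx.1, fun y hy => ?_⟩
      by_cases h : ⟪x - y, a⟫ = 0
      · simp [h]
      · rw [← sign_nudge_of_ne hD (hS x hx.1 y hy) h]
        exact hx.2 y hy
    refine mem_face_iff_sign.2 ⟨hxa, fun y hy => ?_⟩
    have h : ⟪x - y, a⟫ = 0 := by rw [inner_sub_left, inner_eq_of_mem_face hxa hy, sub_self]
    rw [← sign_nudge_of_eq hD (hS x hx.1 y hy.1) h]
    exact hx.2 y hy.1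
  · intro hx
    have hxa : x ∈ face S a := hx.1
    refine mem_face_iff_sign.2 ⟨hxa.1, fun y hy => ?_⟩
    by_cases h : ⟪x - y, a⟫ = 0
    · rw [sign_nudge_of_eq hD (hS x hxa.1 y hy) h]
      have hya : y ∈ face S a := by
        refine ⟨hy, fun z hz => ?_⟩
        rw [inner_sub_left, sub_eq_zero] at h
        rw [← h]
        exact hxa.2 z hz
      exact (mem_face_iff_sign.1 hx).2 y hya
    · rw [sign_nudge_of_ne hD (hS x hxa.1 y hy) h]
      exact (mem_face_iff_sign.1 hxa).2 y hy

/-! ### Walking through the chambers of a flat -/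

/-- A vector orthogonal to `N` that is orthogonal to no vector of `T` outside `N`. -/
lemma exists_generic [FiniteDimensional ℝ E] {T : Set E} (hT : T.Finite) (N : Submodule ℝ E) :
    ∃ x ∈ Nᗮ, ∀ d ∈ T, d ∉ N → ⟪d, x⟫ ≠ 0 := by
  induction T, hT using Set.Finite.induction_on with
  | empty => exact ⟨0, zero_mem _, by simp⟩
  | @insert y T _ hT ih =>
    obtain ⟨x, hx, hxT⟩ := ih
    by_cases hy : y ∈ N ∨ ⟪y, x⟫ ≠ 0
    · refine ⟨x, hx, fun d hd hdN => ?_⟩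
      rcases hd with rfl | hd
      · exact hy.resolve_left hdN
      · exact hxT d hd hdN
    · push Not at hy
      -- the component of `y` orthogonal to `N`
      obtain ⟨z, hz, hyz⟩ : ∃ z ∈ Nᗮ, ⟪y, z⟫ ≠ 0 := by
        by_contra! h
        apply hy.1
        rw [← N.orthogonal_orthogonal]
        exact (mem_orthogonal' _ _).2 h
      have hfin : (insert y T).Finite := hT.insert y
      obtain ⟨ε, -, hε⟩ :=
        ((eventually_mem_nhdsWithin).and (eventually_sign_add_smul hfin x z)).exists
      refine ⟨x + ε • z, add_mem hx (smul_mem _ _ hz), fun d hd hdN => ?_⟩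
      have h1 := hε d hd
      intro h0
      rw [h0, sign_zero] at h1
      split_ifs at h1 with h2
      · rcases hd with rfl | hd
        · exact hyz (sign_eq_zero_iff.1 h1.symm)
        · exact hxT d hd hdN h2
      · exact h2 (sign_eq_zero_iff.1 h1.symm)

/-- Walking along the segment from `u₀` to `u₁`, when it crosses one wall at a time. -/
lemma walk_segment [FiniteDimensional ℝ E] {D : Set E} (hD : D.Finite) {N : Submodule ℝ E}
    {Q : E → Prop} (hsign : ∀ u u', SameSign D u u' → Q u → Q u')
    (hcross : ∀ a b, nullSpan D (nudge D a b) = N → finrank ℝ (nullSpan D a) = finrank ℝ N + 1 →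
      Q (nudge D a (-b)) → Q (nudge D a b)) {u₁ : E} (h₁ : nullSpan D u₁ = N) (n : ℕ) :
    ∀ u₀ : E, nullSpan D u₀ = N →
      (∀ d ∈ D, ∀ d' ∈ D, d ∉ N → ⟪d, u₀⟫ * ⟪d', u₁⟫ = ⟪d', u₀⟫ * ⟪d, u₁⟫ → d' ∈ N ⊔ span ℝ {d}) →
      {d | d ∈ D ∧ ⟪d, u₀⟫ * ⟪d, u₁⟫ < 0}.ncard ≤ n → Q u₀ → Q u₁ := by
  induction n with
  | zero =>
    intro u₀ h₀ _ hn hQ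
    refine hsign u₀ u₁ (fun d hd => ?_) hQ
    have hfin : {d | d ∈ D ∧ ⟪d, u₀⟫ * ⟪d, u₁⟫ < 0}.Finite := hD.subset fun d hd => hd.1
    have hem := (Set.ncard_eq_zero hfin).1 (Nat.le_zero.1 hn)
    have hnn : 0 ≤ ⟪d, u₀⟫ * ⟪d, u₁⟫ := by
      by_contra! h
      exact (Set.eq_empty_iff_forall_notMem.1 hem d) ⟨hd, h⟩
    have hz : ⟪d, u₀⟫ = 0 ↔ ⟪d, u₁⟫ = 0 := by
      rw [← mem_nullSpan_iff hd, ← mem_nullSpan_iff hd, h₀, h₁]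
    rcases lt_trichotomy ⟪d, u₀⟫ 0 with h | h | h
    · have : ⟪d, u₁⟫ < 0 := by
        refine lt_of_le_of_ne ?_ fun h' => h.ne (hz.2 h')
        by_contra! h'; nlinarith
      rw [sign_neg h, sign_neg this]
    · rw [h, hz.1 h]
    · have : 0 < ⟪d, u₁⟫ := by
        refine lt_of_le_of_ne ?_ fun h' => h.ne' (hz.2 h'.symm)
        by_contra! h'; nlinarith
      rw [sign_pos h, sign_pos this]
  | succ n ih =>
    intro u₀ h₀ hG hn hQ
    set Sep := {d | d ∈ D ∧ ⟪d, u₀⟫ * ⟪d, u₁⟫ < 0} with hSep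
    have hfin : Sep.Finite := hD.subset fun d hd => hd.1
    rcases Sep.eq_empty_or_nonempty with hem | hne
    · exact ih u₀ h₀ hG (by rw [← hSep, hem]; simp) hQ
    obtain ⟨d₀, hd₀, hmin⟩ :=
      Set.exists_min_image Sep (fun d => ⟪d, u₀⟫ / (⟪d, u₀⟫ - ⟪d, u₁⟫)) hfin hne
    set t := ⟪d₀, u₀⟫ / (⟪d₀, u₀⟫ - ⟪d₀, u₁⟫) with ht
    have hden : ⟪d₀, u₀⟫ - ⟪d₀, u₁⟫ ≠ 0 := by
      intro h
      have := hd₀.2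
      rw [sub_eq_zero.1 h] at this
      nlinarith [mul_self_nonneg ⟪d₀, u₁⟫]
    have hteq : t * (⟪d₀, u₀⟫ - ⟪d₀, u₁⟫) = ⟪d₀, u₀⟫ := div_mul_cancel₀ _ hden
    -- the crossing time lies strictly between `0` and `1`
    have htpos : 0 < t ∧ t < 1 := by
      have h := hd₀.2
      rcases mul_neg_iff.1 h with ⟨hx, hy⟩ | ⟨hx, hy⟩
      · exact ⟨div_pos hx (by linarith), (div_lt_one (by linarith)).2 (by linarith)⟩
      · exact ⟨div_pos_of_neg_of_neg hx (by linarith),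
          (div_lt_one_of_neg (by linarith)).2 (by linarith)⟩
    set a := u₀ + t • (u₁ - u₀) with ha
    set b := u₁ - u₀ with hb
    have hia : ∀ d, ⟪d, a⟫ = (1 - t) * ⟪d, u₀⟫ + t * ⟪d, u₁⟫ := fun d => by
      rw [ha, inner_add_right, inner_smul_right, inner_sub_right]; ring
    have hib : ∀ d, ⟪d, b⟫ = ⟪d, u₁⟫ - ⟪d, u₀⟫ := fun d => by rw [hb, inner_sub_right]
    have hzero : ∀ d ∈ D, (⟪d, u₀⟫ = 0 ↔ ⟪d, u₁⟫ = 0) := fun d hd => by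
      rw [← mem_nullSpan_iff hd, ← mem_nullSpan_iff hd, h₀, h₁]
    have hd₀N : d₀ ∉ N := fun h => by
      rw [← h₀, mem_nullSpan_iff hd₀.1] at h
      have := hd₀.2
      rw [h, zero_mul] at this
      exact lt_irrefl _ this
    have hd₀a : ⟪d₀, a⟫ = 0 := by rw [hia]; linarith
    have hNa : ∀ d ∈ D, ⟪d, u₀⟫ = 0 → ⟪d, a⟫ = 0 := fun d hd h => by
      rw [hia, h, (hzero d hd).1 h]; ring
    have hZa : nullSpan D a = N ⊔ span ℝ {d₀} := by
      apply le_antisymm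
      · refine span_le.2 fun d hd => hG d₀ hd₀.1 d hd.1 hd₀N ?_
        have e1 := hd.2
        rw [hia] at e1
        have e2 := hd₀a
        rw [hia] at e2
        have h1 : t * (⟪d₀, u₀⟫ * ⟪d, u₁⟫ - ⟪d, u₀⟫ * ⟪d₀, u₁⟫) = 0 := by
          linear_combination ⟪d₀, u₀⟫ * e1 - ⟪d, u₀⟫ * e2
        linarith [(mul_eq_zero.1 h1).resolve_left htpos.1.ne']
      · refine sup_le ?_ ((span_singleton_le_iff_mem _ _).2 (subset_span ⟨hd₀.1, hd₀a⟩))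
        rw [← h₀]
        exact span_mono fun d hd => ⟨hd.1, hNa d hd.1 hd.2⟩
    -- if `⟪d, a⟫ = 0`, then the signs at `u₀` and `u₁` are opposite
    have hopp : ∀ d, ⟪d, a⟫ = 0 → ⟪d, u₀⟫ = t * (- ⟪d, b⟫) ∧ ⟪d, u₁⟫ = (1 - t) * ⟪d, b⟫ :=
      fun d h => by rw [hia] at h; rw [hib]; constructor <;> linarith
    -- otherwise the sign at `a` is the one at `u₀`, since `t` is the first crossing time
    have hsame : ∀ d ∈ D, ⟪d, a⟫ ≠ 0 → SignType.sign ⟪d, a⟫ = SignType.sign ⟪d, u₀⟫ := by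
      intro d hd h
      have ht' := htpos
      have key : ⟪d, u₀⟫ * ⟪d, u₁⟫ < 0 →
          t * |⟪d, u₀⟫ - ⟪d, u₁⟫| ≤ |⟪d, u₀⟫| := by
        intro hs
        have hm : t ≤ _ := hmin d ⟨hd, hs⟩
        rcases mul_neg_iff.1 hs with ⟨hx, hy⟩ | ⟨hx, hy⟩
        · rw [abs_of_pos hx, abs_of_pos (by linarith)]
          rwa [le_div_iff₀ (by linarith)] at hm
        · rw [abs_of_neg hx, abs_of_neg (by linarith)]
          rw [le_div_iff_of_neg (by linarith)] at hm
          linarith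
      rw [hia] at h ⊢
      rcases lt_trichotomy ⟪d, u₀⟫ 0 with hx | hx | hx
      · rw [sign_neg hx, sign_neg]
        refine lt_of_le_of_ne ?_ h
        rcases lt_or_ge 0 ⟪d, u₁⟫ with hy | hy
        · have := key (mul_neg_of_neg_of_pos hx hy)
          rw [abs_of_neg hx, abs_of_neg (by linarith)] at this
          linarith
        · nlinarith
      · exact absurd (by rw [hx, (hzero d hd).1 hx]; ring) h
      · rw [sign_pos hx, sign_pos]
        refine lt_of_le_of_ne ?_ (Ne.symm h)
        rcases lt_or_ge ⟪d, u₁⟫ 0 with hy | hy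
        · have := key (mul_neg_of_pos_of_neg hx hy)
          rw [abs_of_pos hx, abs_of_pos (by linarith)] at this
          linarith
        · nlinarith
    have hQ1 : Q (nudge D a (-b)) := by
      refine hsign u₀ _ (fun d hd => ?_) hQ
      by_cases h : ⟪d, a⟫ = 0
      · rw [sign_nudge_of_eq hD hd h, (hopp d h).1, sign_mul, sign_pos htpos.1, one_mul,
          inner_neg_right]
      · rw [sign_nudge_of_ne hD hd h, hsame d hd h]
    have hZab : nullSpan D (nudge D a b) = N := by
      rw [nullSpan_nudge hD, ← h₀]
      unfold nullSpan
      congr 1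
      ext d
      simp only [Set.mem_ofPred_eq, and_assoc]
      refine and_congr_right fun hd => ⟨fun h => ?_, fun h => ⟨hNa d hd h, ?_⟩⟩
      · rw [(hopp d h.1).1, h.2]; ring
      · rw [hib, h, (hzero d hd).1 h, sub_zero]
    have hQ2 : Q (nudge D a b) :=
      hcross a b hZab (by rw [hZa, finrank_sup_span_singleton hd₀N]) hQ1
    obtain ⟨ε, ⟨hε0, hε1⟩, hε⟩ := ((eventually_mem_set.2 (Ioo_mem_nhdsGT (sub_pos.2 htpos.2))).and
      (eventually_sign_add_smul hD a b)).exists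
    have hss : SameSign D (nudge D a b) (a + ε • b) := fun d hd => by
      rw [hε d hd, sign_nudge hD _ _ hd]
    have hi' : ∀ d, ⟪d, a + ε • b⟫ = (1 - t - ε) * ⟪d, u₀⟫ + (t + ε) * ⟪d, u₁⟫ := fun d => by
      rw [inner_add_right, inner_smul_right, hia, hib]; ring
    refine ih (a + ε • b) (by rw [← hss.nullSpan_eq, hZab]) ?_ ?_ (hsign _ _ hss hQ2)
    · intro d hd d' hd' hdN h
      rw [hi', hi'] at h
      refine hG d hd d' hd' hdN ?_
      have h2 : (1 - t - ε) * (⟪d, u₀⟫ * ⟪d', u₁⟫ - ⟪d', u₀⟫ * ⟪d, u₁⟫) = 0 := by linarith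
      linarith [(mul_eq_zero.1 h2).resolve_left (by linarith)]
    · have hsub : {d | d ∈ D ∧ ⟪d, a + ε • b⟫ * ⟪d, u₁⟫ < 0} ⊂ Sep := by
        refine ⟨fun d hd => ⟨hd.1, ?_⟩, fun hss' => ?_⟩
        · have h1 := hε d hd.1
          by_cases h : ⟪d, a⟫ = 0
          · exfalso
            have h2 := hd.2
            rw [inner_add_right, h, zero_add, inner_smul_right, (hopp d h).2] at h2
            have := mul_nonneg (mul_nonneg hε0.le (sub_nonneg.2 htpos.2.le))
              (mul_self_nonneg ⟪d, b⟫)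
            nlinarith
          · rw [if_neg h, hsame d hd.1 h] at h1
            have h2 := hd.2
            rw [← sign_eq_neg_one_iff, sign_mul] at h2 ⊢
            rwa [← h1]
        · have h2 := (hss' hd₀).2
          rw [inner_add_right, hd₀a, zero_add, inner_smul_right, (hopp d₀ hd₀a).2] at h2
          have := mul_nonneg (mul_nonneg hε0.le (sub_nonneg.2 htpos.2.le))
              (mul_self_nonneg ⟪d₀, b⟫)
          nlinarith
      have := Set.ncard_lt_ncard hsub hfin
      omega

/-- **Chamber induction.** A property of vectors that depends only on the signs on `D` and is
preserved by crossing a single wall of a flat holds in all chambers of the flat or in none. -/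
theorem chamber_induction [FiniteDimensional ℝ E] {D : Set E} (hD : D.Finite) {N : Submodule ℝ E}
    {Q : E → Prop} (hsign : ∀ u u', SameSign D u u' → Q u → Q u')
    (hcross : ∀ a b, nullSpan D (nudge D a b) = N → finrank ℝ (nullSpan D a) = finrank ℝ N + 1 →
      Q (nudge D a (-b)) → Q (nudge D a b))
    {u₀ u₁ : E} (h₀ : nullSpan D u₀ = N) (h₁ : nullSpan D u₁ = N) (hQ : Q u₀) : Q u₁ := by
  -- perturb `u₁` so that the segment from `u₀` meets no intersection of two distinct walls
  set Y : Set E := Set.image2 (fun d d' => ⟪d, u₀⟫ • d' - ⟪d', u₀⟫ • d) D D with hY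
  have hYfin : (D ∪ Y).Finite := hD.union (hD.image2 _ hD)
  obtain ⟨x, hxN, hx⟩ := exists_generic hYfin N
  have hss : SameSign D (nudge (D ∪ Y) u₁ x) u₁ := by
    intro d hd
    by_cases h : ⟪d, u₁⟫ = 0
    · rw [sign_nudge_of_eq hYfin (Or.inl hd) h, h]
      rw [← mem_nullSpan_iff hd, h₁] at h
      rw [hxN d h]
    · rw [sign_nudge_of_ne hYfin (Or.inl hd) h]
  refine hsign _ _ hss
    (walk_segment hD hsign hcross (hss.nullSpan_eq.trans h₁) _ u₀ h₀ ?_ le_rfl hQ)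
  intro d hd d' hd' hdN h
  have hmem : ⟪d, u₀⟫ • d' - ⟪d', u₀⟫ • d ∈ Y := ⟨d, hd, d', hd', rfl⟩
  have h1 : ⟪⟪d, u₀⟫ • d' - ⟪d', u₀⟫ • d, nudge (D ∪ Y) u₁ x⟫ = 0 := by
    rw [inner_sub_left, real_inner_smul_left, real_inner_smul_left, h, sub_self]
  have h2 := ((inner_nudge_eq_zero_iff hYfin (Or.inr hmem)).1 h1).2
  have h3 : ⟪d, u₀⟫ • d' - ⟪d', u₀⟫ • d ∈ N := by
    by_contra hc
    exact hx _ (Or.inr hmem) hc h2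
  have h4 : ⟪d, u₀⟫ ≠ 0 := fun h => hdN (by rw [← h₀]; exact (mem_nullSpan_iff hd).2 h)
  have h5 : d' = ⟪d, u₀⟫⁻¹ • (⟪d, u₀⟫ • d' - ⟪d', u₀⟫ • d) + (⟪d, u₀⟫⁻¹ * ⟪d', u₀⟫) • d := by
    rw [smul_sub, smul_smul, smul_smul, inv_mul_cancel₀ h4, one_smul, sub_add_cancel]
  rw [h5]
  exact add_mem (mem_sup_left (smul_mem _ _ h3))
    (mem_sup_right (smul_mem _ _ (mem_span_singleton_self d)))

/-- Every flat of the arrangement contains a vector in its relative interior, and a vector of the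
flat can be perturbed into its relative interior. -/
lemma exists_nullSpan_nudge_eq [FiniteDimensional ℝ E] {D : Set E} (hD : D.Finite)
    {N : Submodule ℝ E} (hN : N ≤ span ℝ {d | d ∈ D ∧ d ∈ N}) :
    ∃ x ∈ Nᗮ, ∀ u ∈ Nᗮ, nullSpan D (nudge D u x) = N := by
  obtain ⟨x, hx, hxT⟩ := exists_generic hD N
  refine ⟨x, hx, fun u hu => le_antisymm ?_ (hN.trans (span_mono fun d hd => ⟨hd.1, ?_⟩))⟩
  · rw [nullSpan_nudge hD]
    refine span_le.2 fun d hd => ?_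
    by_contra hc
    exact hxT d hd.1.1 hc hd.2
  · exact (inner_nudge_eq_zero_iff hD hd.1).2 ⟨hu d hd.2, hx d hd.2⟩

/-! ### Vertex sets and their translation classes -/

/-- The dimension of the affine hull of `S` (`0` for the empty set). -/
noncomputable def polyDim (S : Set E) : ℕ := finrank ℝ (vectorSpan ℝ S)

/-- `S` is the vertex set of a nonempty polytope whose vertices have all their differences in `D`.
That every point of `S` is a vertex is expressed by each of them being a face. -/
structure IsVertexSet (D S : Set E) : Prop where
  finite : S.Finite
  nonempty : S.Nonempty
  adapted : Adapted D S
  exposed : ∀ x ∈ S, ∃ u, face S u = {x}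

/-- Central symmetry of a finite set, the centre being `t / 2`. -/
def IsSymm (X : Set E) : Prop := ∃ t : E, X = t +ᵥ -X

open Classical in
/-- The class of `X` up to translations if `X` has dimension `k`, and `∅` otherwise. -/
noncomputable def shape (k : ℕ) (X : Set E) : Set (Set E) :=
  if polyDim X = k then {Y | ∃ t : E, Y = t +ᵥ X} else ∅

lemma face_nonempty {S : Set E} (hS : S.Finite) (hne : S.Nonempty) (u : E) :
    (face S u).Nonempty := by
  obtain ⟨x, hx, h⟩ := Set.exists_max_image S (fun y => ⟪y, u⟫) hS hne
  exact ⟨x, hx, h⟩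

lemma mem_vadd_iff {V : Type*} [AddCommGroup V] {t x : V} {X : Set V} : x ∈ t +ᵥ X ↔ x - t ∈ X := by
  rw [Set.mem_vadd_set_iff_neg_vadd_mem, vadd_eq_add, neg_add_eq_sub]

lemma face_vadd (t : E) (X : Set E) (u : E) : face (t +ᵥ X) u = t +ᵥ face X u := by
  ext x
  simp only [face, Set.mem_ofPred_eq, mem_vadd_iff, inner_sub_left]
  refine and_congr_right fun _ => ⟨fun h y hy => ?_, fun h y hy => ?_⟩
  · have := h (y + t) (by rwa [add_sub_cancel_right])
    rw [inner_add_left] at this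
    linarith
  · have := h _ hy
    rw [inner_sub_left] at this
    linarith

lemma face_neg (X : Set E) (u : E) : face (-X) u = -face X (-u) := by
  ext x
  simp only [face, Set.mem_ofPred_eq, Set.mem_neg, inner_neg_left, inner_neg_right, neg_neg]
  refine and_congr_right fun _ => ⟨fun h y hy => ?_, fun h y hy => ?_⟩
  · have := h (-y) (by rwa [neg_neg])
    rw [inner_neg_left] at this
    linarith
  · have := h _ hy
    rw [inner_neg_left] at this
    linarith

lemma vadd_neg_set {V : Type*} [AddCommGroup V] (t : V) (X : Set V) : -(t +ᵥ X) = -t +ᵥ -X := by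
  ext x
  rw [Set.mem_neg, mem_vadd_iff, mem_vadd_iff, Set.mem_neg]
  congr! 1
  abel

lemma IsVertexSet.mono {D D' S : Set E} (h : IsVertexSet D S) (hD : D ⊆ D') : IsVertexSet D' S :=
  ⟨h.finite, h.nonempty, fun x hx y hy => hD (h.adapted x hx y hy), h.exposed⟩

lemma IsVertexSet.face_null {D S : Set E} (h : IsVertexSet D S) (u : E) :
    IsVertexSet {d | d ∈ D ∧ ⟪d, u⟫ = 0} (face S u) := by
  refine ⟨h.finite.subset (face_subset S u), face_nonempty h.finite h.nonempty u,
    fun x hx y hy => ⟨h.adapted x hx.1 y hy.1, ?_⟩, fun x hx => ?_⟩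
  · rw [inner_sub_left, inner_eq_of_mem_face hx hy, sub_self]
  · obtain ⟨v, hv⟩ := h.exposed x hx.1
    have hxv : x ∈ face S v := by rw [hv]; rfl
    refine ⟨v, Set.Subset.antisymm (fun y hy => ?_) ?_⟩
    · rw [← hv]
      exact ⟨hy.1.1, fun z hz => (hxv.2 z hz).trans (hy.2 x hx)⟩
    · rintro y rfl
      exact ⟨hx, fun z hz => hxv.2 z hz.1⟩

protected lemma IsVertexSet.face {D S : Set E} (h : IsVertexSet D S) (u : E) :
    IsVertexSet D (face S u) :=
  (h.face_null u).mono fun _ hd => hd.1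

lemma IsVertexSet.vadd {D S : Set E} (h : IsVertexSet D S) (t : E) : IsVertexSet D (t +ᵥ S) := by
  refine ⟨h.finite.vadd_set, h.nonempty.vadd_set, fun x hx y hy => ?_, fun x hx => ?_⟩
  · rw [mem_vadd_iff] at hx hy
    simpa using h.adapted _ hx _ hy
  · rw [mem_vadd_iff] at hx
    obtain ⟨u, hu⟩ := h.exposed _ hx
    exact ⟨u, by rw [face_vadd, hu, Set.vadd_set_singleton, vadd_eq_add, add_sub_cancel]⟩

lemma IsVertexSet.neg {D S : Set E} (h : IsVertexSet D S) : IsVertexSet D (-S) := by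
  refine ⟨h.finite.neg, h.nonempty.neg, fun x hx y hy => ?_, fun x hx => ?_⟩
  · have := h.adapted _ hy _ hx
    rwa [neg_sub_neg] at this
  · obtain ⟨u, hu⟩ := h.exposed _ hx
    exact ⟨-u, by rw [face_neg, neg_neg, hu, Set.neg_singleton, neg_neg]⟩

lemma vectorSpan_neg_set (X : Set E) : vectorSpan ℝ (-X) = vectorSpan ℝ X := by
  simp only [vectorSpan_def]
  congr 1
  ext x
  simp only [Set.mem_vsub, vsub_eq_sub]
  constructor
  · rintro ⟨a, ha, b, hb, rfl⟩
    exact ⟨-b, hb, -a, ha, by abel⟩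
  · rintro ⟨a, ha, b, hb, rfl⟩
    exact ⟨-b, by simpa, -a, by simpa, by abel⟩

lemma polyDim_vadd (t : E) (X : Set E) : polyDim (t +ᵥ X) = polyDim X := by
  rw [polyDim, vectorSpan_vadd, polyDim]

lemma polyDim_neg (X : Set E) : polyDim (-X) = polyDim X := by
  rw [polyDim, vectorSpan_neg_set, polyDim]

lemma shape_of_ne {k : ℕ} {X : Set E} (h : polyDim X ≠ k) : shape k X = ∅ := if_neg h

lemma shape_nonempty_iff {k : ℕ} {X : Set E} : (shape k X).Nonempty ↔ polyDim X = k := by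
  unfold shape
  split_ifs with h
  · exact ⟨fun _ => h, fun _ => ⟨X, 0, by simp⟩⟩
  · simp [h]

lemma shape_eq_empty_iff {k : ℕ} {X : Set E} : shape k X = ∅ ↔ polyDim X ≠ k := by
  rw [← Set.not_nonempty_iff_eq_empty, shape_nonempty_iff]

lemma shape_vadd (k : ℕ) (t : E) (X : Set E) : shape k (t +ᵥ X) = shape k X := by
  unfold shape
  rw [polyDim_vadd]
  split_ifs with h
  · ext Y
    constructor
    · rintro ⟨s, rfl⟩
      exact ⟨s + t, by rw [vadd_vadd]⟩
    · rintro ⟨s, rfl⟩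
      exact ⟨s - t, by rw [vadd_vadd, sub_add_cancel]⟩
  · rfl

lemma shape_eq_iff {k : ℕ} {X Y : Set E} (h : polyDim X = k) :
    shape k X = shape k Y ↔ ∃ t : E, Y = t +ᵥ X := by
  constructor
  · intro he
    have hY : polyDim Y = k := by
      rw [← shape_nonempty_iff, ← he, shape_nonempty_iff, h]
    have : Y ∈ shape k X := by
      rw [he, shape, if_pos hY]
      exact ⟨0, by simp⟩
    rwa [shape, if_pos h] at this
  · rintro ⟨t, rfl⟩
    rw [shape_vadd]

lemma shape_neg (k : ℕ) (X : Set E) : shape k (-X) = -shape k X := by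
  unfold shape
  rw [polyDim_neg]
  split_ifs with h
  · ext Y
    constructor
    · rintro ⟨s, rfl⟩
      exact ⟨-s, by rw [vadd_neg_set, neg_neg]⟩
    · rintro ⟨s, hs⟩
      exact ⟨-s, by rw [← neg_neg Y, hs, vadd_neg_set]⟩
  · simp

lemma IsSymm.shape_eq {X : Set E} (h : IsSymm X) (k : ℕ) : shape k X = -shape k X := by
  obtain ⟨t, ht⟩ := h
  conv_lhs => rw [ht, shape_vadd, shape_neg]

lemma isSymm_of_shape_eq {k : ℕ} {X : Set E} (hX : polyDim X = k) (h : shape k X = -shape k X) :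
    IsSymm X := by
  rw [← shape_neg] at h
  obtain ⟨t, ht⟩ := (shape_eq_iff (by rw [polyDim_neg, hX])).1 h.symm
  exact ⟨t, ht⟩

/-- Opposite faces of a centrally symmetric set are reflections of each other. -/
lemma IsSymm.shape_face_neg {X : Set E} (h : IsSymm X) (k : ℕ) (b : E) :
    shape k (face X (-b)) = -shape k (face X b) := by
  obtain ⟨t, ht⟩ := h
  conv_lhs => rw [ht, face_vadd, shape_vadd, face_neg, neg_neg, shape_neg]

/-- If two sets are translates of each other, so are their faces. -/
lemma shape_face_eq_of_shape_eq {k : ℕ} {X Y : Set E} (hX : polyDim X = k)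
    (h : shape k X = shape k Y) (l : ℕ) (b : E) : shape l (face X b) = shape l (face Y b) := by
  obtain ⟨t, rfl⟩ := (shape_eq_iff hX).1 h
  rw [face_vadd, shape_vadd]

lemma shape_face_eq_of_shape_eq_neg {k : ℕ} {X Y : Set E} (hX : polyDim X = k)
    (h : shape k X = -shape k Y) (l : ℕ) (b : E) :
    shape l (face X b) = -shape l (face Y (-b)) := by
  rw [← shape_neg] at h
  rw [shape_face_eq_of_shape_eq hX h, face_neg, shape_neg]

lemma inner_eq_zero_of_mem_vectorSpan_face {X : Set E} {b x : E}
    (hx : x ∈ vectorSpan ℝ (face X b)) : ⟪x, b⟫ = 0 := by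
  rw [vectorSpan_def] at hx
  induction hx using span_induction with
  | mem x hx =>
    obtain ⟨y, hy, z, hz, rfl⟩ := hx
    simp only [vsub_eq_sub, inner_sub_left, inner_eq_of_mem_face hy hz, sub_self]
  | zero => simp
  | add x y _ _ hx hy => rw [inner_add_left, hx, hy, add_zero]
  | smul c x _ hx => rw [inner_smul_left, hx, mul_zero]

lemma vectorSpan_face_le {D S : Set E} (hS : Adapted D S) (u : E) :
    vectorSpan ℝ (face S u) ≤ nullSpan D u := by
  rw [vectorSpan_def]
  refine span_le.2 ?_
  rintro _ ⟨x, hx, y, hy, rfl⟩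
  refine subset_span ⟨hS x hx.1 y hy.1, ?_⟩
  simp only [vsub_eq_sub, inner_sub_left, inner_eq_of_mem_face hx hy, sub_self]

lemma subsingleton_face_of_nullSpan {D S : Set E} (hS : Adapted D S) {u : E}
    (hu : nullSpan D u = ⊥) : (face S u).Subsingleton := by
  rw [← vectorSpan_eq_bot_iff_subsingleton ℝ, eq_bot_iff, ← hu]
  exact vectorSpan_face_le hS u

lemma face_eq_self {X : Set E} {b : E} (h : ∀ x ∈ vectorSpan ℝ X, ⟪x, b⟫ = 0) : face X b = X := by
  refine Set.Subset.antisymm (face_subset X b) fun x hx => ⟨hx, fun y hy => ?_⟩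
  have := h _ (vsub_mem_vectorSpan ℝ hx hy)
  rw [vsub_eq_sub, inner_sub_left] at this
  linarith

lemma face_eq_self_of_neg {X : Set E} {b : E} (hne : (face X b).Nonempty)
    (h : face X (-b) = face X b) : face X b = X := by
  obtain ⟨x, hx⟩ := hne
  have hx' : x ∈ face X (-b) := by rwa [h]
  refine Set.Subset.antisymm (face_subset X b) fun y hy => ⟨hy, fun z hz => ?_⟩
  have h1 := hx'.2 y hy
  rw [inner_neg_right, inner_neg_right] at h1
  have h2 := hx.2 z hz
  linarith

lemma IsSymm.neg {V : Type*} [NormedAddCommGroup V] {X : Set V} (h : IsSymm X) : IsSymm (-X) := by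
  obtain ⟨t, ht⟩ := h
  refine ⟨-t, ?_⟩
  conv_lhs => rw [ht, vadd_neg_set]

/-- A vertex set on a line consists of its two ends (which may coincide). -/
lemma IsVertexSet.eq_pair {D X : Set E} (hX : IsVertexSet D X) {e p q : E}
    (hline : ∀ x ∈ X, ∀ y ∈ X, ∃ s : ℝ, x - y = s • e) (hp : p ∈ face X e)
    (hq : q ∈ face X (-e)) : X = {p, q} := by
  rcases eq_or_ne e 0 with rfl | he0
  · refine Set.Subset.antisymm (fun x hx => ?_) ?_
    · obtain ⟨s, hs⟩ := hline x hx p hp.1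
      rw [smul_zero, sub_eq_zero] at hs
      exact Or.inl hs
    · rintro x (rfl | rfl)
      exacts [hp.1, hq.1]
  have hee : 0 < ⟪e, e⟫ := real_inner_self_pos.2 he0
  refine Set.Subset.antisymm (fun x hx => ?_) ?_
  · obtain ⟨u, hu⟩ := hX.exposed x hx
    have hxu : x ∈ face X u := by rw [hu]; rfl
    obtain ⟨s, hs⟩ := hline p hp.1 x hx
    obtain ⟨r, hr⟩ := hline q hq.1 x hx
    have hs0 : 0 ≤ s := by
      have := hp.2 x hx
      rw [← sub_nonneg, ← inner_sub_left, hs, real_inner_smul_left] at this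
      exact nonneg_of_mul_nonneg_left this hee
    have hr0 : r ≤ 0 := by
      have := hq.2 x hx
      rw [← sub_nonneg, ← inner_sub_left, hr, real_inner_smul_left, inner_neg_right] at this
      nlinarith
    have hmem : ∀ y ∈ X, ⟪x, u⟫ ≤ ⟪y, u⟫ → x = y := fun y hy hle => by
      have : y ∈ face X u := ⟨hy, fun z hz => (hxu.2 z hz).trans hle⟩
      rw [hu] at this
      exact this.symm
    rcases le_total 0 ⟪e, u⟫ with h | h
    · left
      refine hmem p hp.1 ?_
      rw [← sub_nonneg, ← inner_sub_left, hs, real_inner_smul_left]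
      exact mul_nonneg hs0 h
    · right
      refine hmem q hq.1 ?_
      rw [← sub_nonneg, ← inner_sub_left, hr, real_inner_smul_left]
      exact mul_nonneg_of_nonpos_of_nonpos hr0 h
  · rintro x (rfl | rfl)
    exacts [hp.1, hq.1]

/-- A segment is centrally symmetric. -/
lemma IsVertexSet.isSymm_of_polyDim_one {D X : Set E} (hX : IsVertexSet D X)
    (h1 : polyDim X = 1) : IsSymm X := by
  obtain ⟨e, he0, he⟩ := finrank_eq_one_iff'.1 h1
  -- the two ends of the segment
  obtain ⟨p, hp⟩ := face_nonempty hX.finite hX.nonempty (e : E)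
  obtain ⟨q, hq⟩ := face_nonempty hX.finite hX.nonempty (-(e : E))
  have hXpq : X = {p, q} := hX.eq_pair (fun x hx y hy => by
    obtain ⟨s, hs⟩ := he ⟨x - y, vsub_mem_vectorSpan ℝ hx hy⟩
    exact ⟨s, by rw [← Submodule.coe_smul, hs]⟩) hp hq
  refine ⟨p + q, ?_⟩
  ext x
  rw [mem_vadd_iff, Set.mem_neg, hXpq]
  simp only [Set.mem_insert_iff, Set.mem_singleton_iff, neg_sub]
  rw [sub_eq_iff_eq_add, sub_eq_iff_eq_add, add_right_inj, add_comm p q, add_right_inj, or_comm,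
    eq_comm, @eq_comm _ p x]

variable [FiniteDimensional ℝ E]

lemma polyDim_le_of_adapted {D S : Set E} (hS : Adapted D S) (u : E) :
    polyDim (face S u) ≤ finrank ℝ (nullSpan D u) :=
  Submodule.finrank_mono (vectorSpan_face_le hS u)

lemma vectorSpan_face_eq {D S : Set E} (hS : Adapted D S) {u : E}
    (h : polyDim (face S u) = finrank ℝ (nullSpan D u)) :
    vectorSpan ℝ (face S u) = nullSpan D u :=
  Submodule.eq_of_le_of_finrank_eq (vectorSpan_face_le hS u) h

lemma polyDim_face_le (X : Set E) (b : E) : polyDim (face X b) ≤ polyDim X :=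
  Submodule.finrank_mono (vectorSpan_mono ℝ (face_subset X b))

/-- A proper face has smaller dimension. -/
lemma face_eq_of_polyDim_eq {X : Set E} {b : E} (h : polyDim (face X b) = polyDim X) :
    face X b = X ∧ face X (-b) = X := by
  have he : vectorSpan ℝ (face X b) = vectorSpan ℝ X :=
    Submodule.eq_of_le_of_finrank_eq (vectorSpan_mono ℝ (face_subset X b)) h
  have h0 : ∀ x ∈ vectorSpan ℝ X, ⟪x, b⟫ = 0 := fun x hx =>
    inner_eq_zero_of_mem_vectorSpan_face (he ▸ hx)
  exact ⟨face_eq_self h0, face_eq_self fun x hx => by rw [inner_neg_right, h0 x hx, neg_zero]⟩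

lemma face_neg_eq_of_polyDim {k : ℕ} {X : Set E} {b : E} (hX : polyDim X ≤ k + 1)
    (hX' : polyDim X ≠ k + 1) (h : polyDim (face X (-b)) = k) : face X b = face X (-b) := by
  have h1 := polyDim_face_le X (-b)
  have h2 := face_eq_of_polyDim_eq (X := X) (b := -b) (by omega)
  rw [h2.1]
  simpa using h2.2

/-- Crossing a wall does not change the `k`-dimensional faces unless the face at the wall has
dimension `k + 1`. -/
lemma shape_face_neg_eq {k : ℕ} {X : Set E} (b : E) (hX : polyDim X ≤ k + 1)
    (hX' : polyDim X ≠ k + 1) : shape k (face X (-b)) = shape k (face X b) := by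
  by_cases h : polyDim (face X (-b)) = k
  · rw [face_neg_eq_of_polyDim hX hX' h]
  · rw [shape_of_ne h]
    symm
    rw [shape_eq_empty_iff]
    intro h'
    have := face_neg_eq_of_polyDim (b := -b) hX hX' (by rwa [neg_neg])
    rw [neg_neg] at this
    exact h (this ▸ h')

lemma polyDim_eq_zero_iff {X : Set E} : polyDim X = 0 ↔ X.Subsingleton := by
  rw [polyDim, Submodule.finrank_eq_zero, vectorSpan_eq_bot_iff_subsingleton]

lemma polyDim_singleton (x : E) : polyDim ({x} : Set E) = 0 :=
  polyDim_eq_zero_iff.2 Set.subsingleton_singleton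

/-! ### Recognizing translates by their faces of a given dimension -/

/-- If two polytopes agree in their `(k+1)`-dimensional faces, they agree in their `k`-dimensional
ones: otherwise a `k`-dimensional face of one of them would never change during a walk through the
chambers of the flat it belongs to. -/
lemma shape_face_step {D A B : Set E} (hD : D.Finite) (hA : IsVertexSet D A)
    (hB : IsVertexSet D B) {k : ℕ} {N₁ : Submodule ℝ E} (hkA : polyDim A ≠ k)
    (hkB : polyDim B ≠ k)
    (h : ∀ a, finrank ℝ (nullSpan D a) = k + 1 → ¬ nullSpan D a ≤ N₁ →
      shape (k + 1) (face A a) = shape (k + 1) (face B a))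
    {u : E} (hu : finrank ℝ (nullSpan D u) = k) (huN : ¬ nullSpan D u ≤ N₁) :
    shape k (face A u) = shape k (face B u) := by
  by_contra hne
  have key : (shape k (face A (-u)) = shape k (face A u) ∧
      shape k (face B (-u)) = shape k (face B u)) ∧
      (polyDim (face A u) = k → face A (-u) = face A u) ∧
      (polyDim (face B u) = k → face B (-u) = face B u) := by
    refine chamber_induction hD (N := nullSpan D u)
      (Q := fun v => (shape k (face A v) = shape k (face A u) ∧
        shape k (face B v) = shape k (face B u)) ∧
        (polyDim (face A u) = k → face A v = face A u) ∧
        (polyDim (face B u) = k → face B v = face B u)) ?_ ?_ rfl (nullSpan_neg D u)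
      ⟨⟨rfl, rfl⟩, fun _ => rfl, fun _ => rfl⟩
    · intro v v' hv hQ
      rwa [← hv.face_eq hA.adapted, ← hv.face_eq hB.adapted]
    · intro a b hab ha hQ
      simp only [face_nudge hD hA.adapted, face_nudge hD hB.adapted] at hQ ⊢
      rw [hu] at ha
      have haN : ¬ nullSpan D a ≤ N₁ := fun hle =>
        huN ((hab ▸ nullSpan_nudge_le hD a b).trans hle)
      have hAle := (polyDim_le_of_adapted hA.adapted a).trans_eq ha
      have hBle := (polyDim_le_of_adapted hB.adapted a).trans_eq ha
      have hAB := h a ha haN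
      by_cases hdA : polyDim (face A a) = k + 1
      · have := shape_face_eq_of_shape_eq hdA hAB k (-b)
        rw [hQ.1.1, hQ.1.2] at this
        exact absurd this hne
      · have hdB : polyDim (face B a) ≠ k + 1 := by
          rw [← shape_eq_empty_iff, ← hAB, shape_eq_empty_iff]
          exact hdA
        refine ⟨⟨?_, ?_⟩, fun hd => ?_, fun hd => ?_⟩
        · rw [← shape_face_neg_eq b hAle hdA, hQ.1.1]
        · rw [← shape_face_neg_eq b hBle hdB, hQ.1.2]
        · rw [face_neg_eq_of_polyDim hAle hdA (by rw [hQ.2.1 hd, hd]), hQ.2.1 hd]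
        · rw [face_neg_eq_of_polyDim hBle hdB (by rw [hQ.2.2 hd, hd]), hQ.2.2 hd]
  by_cases hdA : polyDim (face A u) = k
  · exact hkA (face_eq_self_of_neg (face_nonempty hA.finite hA.nonempty u) (key.2.1 hdA) ▸ hdA)
  · by_cases hdB : polyDim (face B u) = k
    · exact hkB (face_eq_self_of_neg (face_nonempty hB.finite hB.nonempty u) (key.2.2 hdB) ▸ hdB)
    · exact hne (by rw [shape_of_ne hdA, shape_of_ne hdB])

lemma shape_face_descend {D A B : Set E} (hD : D.Finite) (hA : IsVertexSet D A)
    (hB : IsVertexSet D B) {N₁ : Submodule ℝ E} {s r : ℕ} (hs : 1 ≤ s) (hsr : s ≤ r)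
    (hrA : r ≤ polyDim A) (hrB : r ≤ polyDim B ∨ polyDim B = 0)
    (h : ∀ a, finrank ℝ (nullSpan D a) = r → ¬ nullSpan D a ≤ N₁ →
      shape r (face A a) = shape r (face B a)) :
    ∀ a, finrank ℝ (nullSpan D a) = s → ¬ nullSpan D a ≤ N₁ →
      shape s (face A a) = shape s (face B a) := by
  induction r, hsr using Nat.le_induction with
  | base => exact h
  | succ r hsr ih =>
    exact ih (by omega) (by omega) fun u hu huN =>
      shape_face_step hD hA hB (by omega) (by omega) h hu huN

lemma IsVertexSet.exists_face_eq_singleton {D S : Set E} (hD : D.Finite) (hS : IsVertexSet D S)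
    {x : E} (hx : x ∈ S) : ∃ u, nullSpan D u = ⊥ ∧ face S u = {x} := by
  obtain ⟨v, hv⟩ := hS.exposed x hx
  obtain ⟨w, -, hw⟩ := exists_nullSpan_nudge_eq hD (N := ⊥) bot_le
  refine ⟨nudge D v w, hw v (by simp), ?_⟩
  rw [face_nudge hD hS.adapted, hv]
  exact Set.Subset.antisymm (face_subset _ _) (by rintro _ rfl; exact ⟨rfl, by simp⟩)

/-- Two polytopes with the same edges are translates of each other. -/
lemma exists_vadd_eq_of_edges {D A B : Set E} (hD : D.Finite) (hA : IsVertexSet D A)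
    (hB : IsVertexSet D B)
    (h : ∀ a, finrank ℝ (nullSpan D a) = 1 → shape 1 (face A a) = shape 1 (face B a)) :
    ∃ t : E, B = t +ᵥ A := by
  obtain ⟨u₀, hu₀, -⟩ := hA.exists_face_eq_singleton hD hA.nonempty.some_mem
  obtain ⟨p, hp⟩ := face_nonempty hA.finite hA.nonempty u₀
  obtain ⟨q, hq⟩ := face_nonempty hB.finite hB.nonempty u₀
  have hpA := (subsingleton_face_of_nullSpan hA.adapted hu₀).eq_singleton_of_mem hp
  have hqB := (subsingleton_face_of_nullSpan hB.adapted hu₀).eq_singleton_of_mem hq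
  have key : ∀ u, nullSpan D u = ⊥ → face B u = (q - p) +ᵥ face A u := by
    intro u hu
    refine chamber_induction hD (N := ⊥) (Q := fun u => face B u = (q - p) +ᵥ face A u) ?_ ?_ hu₀ hu
      (by rw [hpA, hqB, Set.vadd_set_singleton, vadd_eq_add, sub_add_cancel])
    · intro v v' hv hQ
      rwa [← hv.face_eq hA.adapted, ← hv.face_eq hB.adapted]
    · intro a b hab ha hQ
      have hsub := subsingleton_face_of_nullSpan hA.adapted
        ((nullSpan_nudge_neg hD a b).trans hab)
      rw [face_nudge hD hA.adapted] at hsub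
      simp only [face_nudge hD hA.adapted, face_nudge hD hB.adapted] at hQ ⊢
      rw [finrank_bot] at ha
      have hAB := h a ha
      have hAle := (polyDim_le_of_adapted hA.adapted a).trans_eq ha
      have hBle := (polyDim_le_of_adapted hB.adapted a).trans_eq ha
      by_cases hdA : polyDim (face A a) = 1
      · obtain ⟨t, ht⟩ := (shape_eq_iff hdA).1 hAB
        obtain ⟨x, hx⟩ := face_nonempty (hA.face a).finite (hA.face a).nonempty (-b)
        rw [ht, face_vadd, hsub.eq_singleton_of_mem hx, Set.vadd_set_singleton,
          Set.vadd_set_singleton, Set.singleton_eq_singleton_iff, vadd_eq_add, vadd_eq_add,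
          add_left_inj] at hQ
        rw [ht, face_vadd, hQ]
      · have hdB : polyDim (face B a) ≠ 1 := by
          rw [← shape_eq_empty_iff, ← hAB, shape_eq_empty_iff]
          exact hdA
        have h0 : ∀ {X : Set E}, polyDim X = 0 → face X b = face X (-b) := by
          intro X hX
          have := polyDim_face_le X b
          have h1 := face_eq_of_polyDim_eq (X := X) (b := b) (by omega)
          rw [h1.1, h1.2]
        rw [h0 (by omega), h0 (by omega), hQ]
  refine ⟨q - p, Set.Subset.antisymm (fun y hy => ?_) fun y hy => ?_⟩
  · obtain ⟨u, hu, huy⟩ := hB.exists_face_eq_singleton hD hy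
    have h1 : y ∈ (q - p) +ᵥ face A u := by rw [← key u hu, huy]; rfl
    exact Set.vadd_set_mono (face_subset A u) h1
  · obtain ⟨u, hu, huy⟩ := hA.exists_face_eq_singleton hD (mem_vadd_iff.1 hy)
    have h1 : y ∈ face B u := by
      rw [key u hu, huy, mem_vadd_iff]
      rfl
    exact h1.1

/-- Two polytopes which agree in their `r`-dimensional faces are translates of each other. -/
theorem exists_vadd_eq_of_shape_face_eq {D A B : Set E} (hD : D.Finite) (hA : IsVertexSet D A)
    (hB : IsVertexSet D B) {r : ℕ} (hr : 1 ≤ r) (hrA : r ≤ polyDim A)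
    (hrB : r ≤ polyDim B ∨ polyDim B = 0)
    (h : ∀ a, finrank ℝ (nullSpan D a) = r → shape r (face A a) = shape r (face B a)) :
    ∃ t : E, B = t +ᵥ A := by
  refine exists_vadd_eq_of_edges hD hA hB fun a ha => ?_
  refine shape_face_descend hD hA hB (N₁ := ⊥) le_rfl hr hrA hrB (fun a ha _ => h a ha) a ha ?_
  intro hle
  rw [le_bot_iff.1 hle, finrank_bot] at ha
  exact zero_ne_one ha

lemma exists_regular {D : Set E} (hD : D.Finite) : ∃ u, nullSpan D u = ⊥ := by
  obtain ⟨w, -, hw⟩ := exists_nullSpan_nudge_eq hD (N := ⊥) bot_le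
  exact ⟨_, hw 0 (by simp)⟩

/-- A polytope whose `r`-dimensional faces are all parallel to `N₁` is itself parallel to `N₁`. -/
theorem vectorSpan_le_of_faces {D A : Set E} (hD : D.Finite) (hA : IsVertexSet D A) {r : ℕ}
    {N₁ : Submodule ℝ E} (hr : 1 ≤ r) (hrA : r ≤ polyDim A)
    (h : ∀ u, finrank ℝ (nullSpan D u) = r → ¬ nullSpan D u ≤ N₁ → polyDim (face A u) ≠ r) :
    vectorSpan ℝ A ≤ N₁ := by
  -- comparison with a point reduces this to edges
  have h0D : (0 : E) ∈ D := by
    have := hA.adapted _ hA.nonempty.some_mem _ hA.nonempty.some_mem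
    rwa [sub_self] at this
  have hpt : ∀ u : E, face ({0} : Set E) u = {0} := fun u =>
    Set.Subset.antisymm (face_subset _ _) (by rintro _ rfl; exact ⟨rfl, by simp⟩)
  have h0 : IsVertexSet D ({0} : Set E) := by
    refine ⟨Set.finite_singleton 0, Set.singleton_nonempty 0, ?_, ?_⟩
    · rintro x rfl y rfl
      rwa [sub_self]
    · rintro x rfl
      exact ⟨0, hpt 0⟩
  have hsh : ∀ {k : ℕ}, 1 ≤ k → ∀ u : E, shape k (face ({0} : Set E) u) = ∅ := by
    intro k hk u
    rw [hpt, shape_eq_empty_iff, polyDim_singleton]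
    omega
  have hedge : ∀ a, finrank ℝ (nullSpan D a) = 1 → ¬ nullSpan D a ≤ N₁ →
      polyDim (face A a) ≠ 1 := by
    intro a ha haN
    have := shape_face_descend hD hA h0 (N₁ := N₁) le_rfl hr hrA (Or.inr (polyDim_singleton 0))
      (fun a ha haN => by rw [hsh hr, shape_eq_empty_iff]; exact h a ha haN) a ha haN
    rw [hsh le_rfl, shape_eq_empty_iff] at this
    exact this
  rw [← N₁.orthogonal_orthogonal, vectorSpan_def]
  refine span_le.2 ?_
  rintro _ ⟨p, hp, q, hq, rfl⟩
  refine (mem_orthogonal' _ _).2 fun x hx => ?_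
  -- `⟪·, x⟫` does not change along edges
  obtain ⟨u₀, hu₀, hpu⟩ := hA.exists_face_eq_singleton hD hp
  obtain ⟨u₁, hu₁, hqu⟩ := hA.exists_face_eq_singleton hD hq
  have key : ∀ y ∈ face A u₁, ⟪y, x⟫ = ⟪p, x⟫ := by
    refine chamber_induction hD (N := ⊥) (Q := fun u => ∀ y ∈ face A u, ⟪y, x⟫ = ⟪p, x⟫)
      ?_ ?_ hu₀ hu₁ (by rw [hpu]; rintro y rfl; rfl)
    · intro v v' hv hQ
      rwa [← hv.face_eq hA.adapted]
    · intro a b hab ha hQ y hy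
      rw [face_nudge hD hA.adapted] at hQ hy
      rw [finrank_bot] at ha
      obtain ⟨z, hz⟩ := face_nonempty (hA.face a).finite (hA.face a).nonempty (-b)
      rw [← hQ z hz, ← sub_eq_zero, ← inner_sub_left]
      have hyz : y - z ∈ vectorSpan ℝ (face A a) := vsub_mem_vectorSpan ℝ hy.1 hz.1
      by_cases haN : nullSpan D a ≤ N₁
      · exact hx _ (haN (vectorSpan_face_le hA.adapted a hyz))
      · have h1 := hedge a ha haN
        have h2 := (polyDim_le_of_adapted hA.adapted a).trans_eq ha
        have h3 : polyDim (face A a) = 0 := by omega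
        rw [polyDim, Submodule.finrank_eq_zero] at h3
        rw [h3, Submodule.mem_bot] at hyz
        rw [hyz, inner_zero_left]
  simp only [vsub_eq_sub, inner_sub_left, key q (by rw [hqu]; rfl), sub_self]

/-! ### Rays and flags of a hyperplane arrangement -/

/-- The unit vectors spanning the rays of the arrangement `{dᗮ | d ∈ D}` in `span D`. -/
def raySet (D : Set E) : Set E :=
  {u | u ∈ span ℝ D ∧ ‖u‖ = 1 ∧ finrank ℝ (nullSpan D u) + 1 = finrank ℝ (span ℝ D)}

lemma nullSpan_le_span (D : Set E) (u : E) : nullSpan D u ≤ span ℝ D := span_mono fun _ hd => hd.1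

lemma notMem_nullSpan {D : Set E} {u : E} (hu : ‖u‖ = 1) : u ∉ nullSpan D u := fun h => by
  have := inner_eq_zero_of_mem_nullSpan h
  rw [real_inner_self_eq_norm_sq, hu] at this
  norm_num at this

lemma finrank_nullSpan_succ_le {D : Set E} {u : E} (hu : u ∈ span ℝ D) (h1 : ‖u‖ = 1) :
    finrank ℝ (nullSpan D u) + 1 ≤ finrank ℝ (span ℝ D) := by
  rw [← finrank_sup_span_singleton (notMem_nullSpan (D := D) h1)]
  exact Submodule.finrank_mono
    (sup_le (nullSpan_le_span D u) ((span_singleton_le_iff_mem _ _).2 hu))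

lemma nullSpan_sup_ray {D : Set E} {u : E} (hu : u ∈ raySet D) :
    nullSpan D u ⊔ span ℝ {u} = span ℝ D := by
  refine Submodule.eq_of_le_of_finrank_eq
    (sup_le (nullSpan_le_span D u) ((span_singleton_le_iff_mem _ _).2 hu.1)) ?_
  rw [finrank_sup_span_singleton (notMem_nullSpan hu.2.1), hu.2.2]

lemma mem_nullSpan_of_orthogonal {D : Set E} {u x : E} (hu : u ∈ raySet D) (hx : x ∈ span ℝ D)
    (h : ⟪x, u⟫ = 0) : x ∈ nullSpan D u := by
  rw [← nullSpan_sup_ray hu, Submodule.mem_sup] at hx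
  obtain ⟨z, hz, y, hy, rfl⟩ := hx
  obtain ⟨c, rfl⟩ := mem_span_singleton.1 hy
  rw [inner_add_left, inner_eq_zero_of_mem_nullSpan hz, zero_add, real_inner_smul_left,
    real_inner_self_eq_norm_sq, hu.2.1, one_pow, mul_one] at h
  simpa [h] using hz

lemma eq_or_eq_neg_of_orthogonal {Z W : Submodule ℝ E} (hZW : Z ≤ W)
    (hf : finrank ℝ Z + 1 = finrank ℝ W) {x y : E} (hx : x ∈ W) (hy : y ∈ W) (hx1 : ‖x‖ = 1)
    (hy1 : ‖y‖ = 1) (hxZ : x ∈ Zᗮ) (hyZ : y ∈ Zᗮ) : y = x ∨ y = -x := by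
  have hxn : x ∉ Z := fun h => by
    have := hxZ x h
    rw [real_inner_self_eq_norm_sq, hx1] at this
    norm_num at this
  have hsup : Z ⊔ span ℝ {x} = W := by
    refine Submodule.eq_of_le_of_finrank_eq
      (sup_le hZW ((span_singleton_le_iff_mem _ _).2 hx)) ?_
    rw [finrank_sup_span_singleton hxn, hf]
  rw [← hsup, Submodule.mem_sup] at hy
  obtain ⟨z, hz, v, hv, rfl⟩ := hy
  obtain ⟨c, rfl⟩ := mem_span_singleton.1 hv
  have h0 := hyZ z hz
  rw [inner_add_right, inner_smul_right, hxZ z hz, mul_zero, add_zero, inner_self_eq_zero] at h0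
  rw [h0, zero_add] at hy1 ⊢
  rw [norm_smul, hx1, mul_one, Real.norm_eq_abs] at hy1
  rcases (abs_eq zero_le_one).1 hy1 with rfl | rfl
  · exact Or.inl (one_smul _ _)
  · exact Or.inr (by rw [neg_smul, one_smul])

lemma nullSpan_mem_orthogonal (D : Set E) (u : E) : u ∈ (nullSpan D u)ᗮ :=
  fun _ hx => inner_eq_zero_of_mem_nullSpan hx

lemma finite_raySet {D : Set E} (hD : D.Finite) : (raySet D).Finite := by
  have := hD.to_subtype
  refine Set.Finite.of_finite_image (f := fun u => fun d : D => SignType.sign ⟪(d : E), u⟫)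
    (Set.toFinite _) ?_
  intro u hu v hv huv
  have hs : SameSign D u v := fun d hd => congr_fun huv ⟨d, hd⟩
  rcases eq_or_eq_neg_of_orthogonal (nullSpan_le_span D u) hu.2.2 hu.1 hv.1 hu.2.1 hv.2.1
    (nullSpan_mem_orthogonal D u) (hs.nullSpan_eq ▸ nullSpan_mem_orthogonal D v) with h | h
  · exact h.symm
  · exfalso
    have h0 : ∀ d ∈ D, ⟪d, u⟫ = 0 := fun d hd => by
      have := hs d hd
      rw [h, inner_neg_right, Left.sign_neg] at this
      rw [← sign_eq_zero_iff]
      revert this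
      generalize SignType.sign ⟪d, u⟫ = σ
      cases σ <;> decide
    have hle : span ℝ D ≤ nullSpan D u := span_le.2 fun d hd => subset_span ⟨hd, h0 d hd⟩
    have := Submodule.finrank_mono hle
    have := hu.2.2
    omega

open Classical in
/-- The finite set `raySet D`. -/
noncomputable def rays (D : Set E) : Finset E :=
  if h : (raySet D).Finite then h.toFinset else ∅

lemma mem_rays {D : Set E} (hD : D.Finite) {u : E} : u ∈ rays D ↔ u ∈ raySet D := by
  rw [rays, dif_pos (finite_raySet hD), Set.Finite.mem_toFinset]

lemma finite_unitVecs {L : Submodule ℝ E} (hL : finrank ℝ L = 1) :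
    {x | x ∈ L ∧ ‖x‖ = 1}.Finite := by
  rcases Set.eq_empty_or_nonempty {x | x ∈ L ∧ ‖x‖ = 1} with h | ⟨x, hx, hx1⟩
  · rw [h]
    exact Set.finite_empty
  · refine (Set.toFinite {x, -x}).subset fun y hy => ?_
    exact eq_or_eq_neg_of_orthogonal bot_le (by rw [finrank_bot, hL]) hx hy.1 hx1 hy.2
      (by simp) (by simp)

open Classical in
/-- The two unit vectors of a line (junk value `∅` for a subspace with infinitely many unit
vectors). -/
noncomputable def unitVecs (L : Submodule ℝ E) : Finset E :=
  if h : {x | x ∈ L ∧ ‖x‖ = 1}.Finite then h.toFinset else ∅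

lemma mem_unitVecs {L : Submodule ℝ E} (hL : finrank ℝ L = 1) {x : E} :
    x ∈ unitVecs L ↔ x ∈ L ∧ ‖x‖ = 1 := by
  rw [unitVecs, dif_pos (finite_unitVecs hL), Set.Finite.mem_toFinset]
  rfl

/-- `u` spans a ray of the arrangement, and `w` is a unit vector orthogonal to `u` pointing along a
two-dimensional flat through that ray. -/
structure IsFlag (D : Set E) (u w : E) : Prop where
  ray : u ∈ raySet D
  mem : w ∈ span ℝ D
  norm : ‖w‖ = 1
  inner : ⟪u, w⟫ = 0
  finrank_eq : finrank ℝ (nullSpan {d | d ∈ D ∧ ⟪d, u⟫ = 0} w) + 2 = finrank ℝ (span ℝ D)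

/-- The cotangent of the angle by which `u` has to be rotated towards `w` to reach the next ray in
the plane of `u` and `w`. -/
noncomputable def nextCot (D : Set E) (u w : E) : ℝ :=
  sSup ((fun d => -⟪d, w⟫ / ⟪d, u⟫) '' {d | d ∈ D ∧ ⟪d, u⟫ ≠ 0})

/-- The next ray after `u` in the direction `w`. -/
noncomputable def nextRay (D : Set E) (u w : E) : E :=
  (√(1 + nextCot D u w ^ 2))⁻¹ • (nextCot D u w • u + w)

/-- The direction at `nextRay D u w` that points back to `u`. -/
noncomputable def nextDir (D : Set E) (u w : E) : E :=
  (√(1 + nextCot D u w ^ 2))⁻¹ • (u - nextCot D u w • w)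

lemma inner_nextRay (D : Set E) (u w x : E) : ⟪x, nextRay D u w⟫ =
    (√(1 + nextCot D u w ^ 2))⁻¹ * (nextCot D u w * ⟪x, u⟫ + ⟪x, w⟫) := by
  rw [nextRay, inner_smul_right, inner_add_right, inner_smul_right]

lemma inner_nextDir (D : Set E) (u w x : E) : ⟪x, nextDir D u w⟫ =
    (√(1 + nextCot D u w ^ 2))⁻¹ * (⟪x, u⟫ - nextCot D u w * ⟪x, w⟫) := by
  rw [nextDir, inner_smul_right, inner_sub_right, inner_smul_right]

lemma sqrt_one_add_sq_pos (k : ℝ) : 0 < √(1 + k ^ 2) := Real.sqrt_pos.2 (by positivity)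

lemma inv_sqrt_sq (k : ℝ) : (√(1 + k ^ 2))⁻¹ * (√(1 + k ^ 2))⁻¹ * (1 + k ^ 2) = 1 := by
  have h := sqrt_one_add_sq_pos k
  have h2 : √(1 + k ^ 2) * √(1 + k ^ 2) = 1 + k ^ 2 := Real.mul_self_sqrt (by positivity)
  field_simp
  nlinarith

lemma IsFlag.norm_left {D : Set E} {u w : E} (h : IsFlag D u w) : ‖u‖ = 1 := h.ray.2.1

lemma nextCot_isGreatest {D : Set E} (hD : D.Finite) {u : E} (hu : u ∈ raySet D) (w : E) :
    IsGreatest ((fun d => -⟪d, w⟫ / ⟪d, u⟫) '' {d | d ∈ D ∧ ⟪d, u⟫ ≠ 0}) (nextCot D u w) := by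
  have hfin : {d | d ∈ D ∧ ⟪d, u⟫ ≠ 0}.Finite := hD.subset fun d hd => hd.1
  have hne : {d | d ∈ D ∧ ⟪d, u⟫ ≠ 0}.Nonempty := by
    by_contra hcon
    rw [Set.not_nonempty_iff_eq_empty, Set.eq_empty_iff_forall_notMem] at hcon
    have hle : span ℝ D ≤ nullSpan D u := span_le.2 fun d hd => by
      by_contra h
      exact hcon d ⟨hd, fun h0 => h ((mem_nullSpan_iff hd).2 h0)⟩
    exact notMem_nullSpan hu.2.1 (hle hu.1)
  exact (hne.image _).csSup_mem (hfin.image _) |> fun h =>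
    ⟨h, fun x hx => le_csSup (hfin.image _).bddAbove hx⟩

/-- The signs in direction `w` at `u` are those in the opposite direction at the next ray. -/
lemma sameSign_next {D : Set E} (hD : D.Finite) {u : E} (hu : u ∈ raySet D) (w : E) :
    SameSign D (nudge D u w) (nudge D (nextRay D u w) (nextDir D u w)) := by
  obtain ⟨-, hub⟩ := nextCot_isGreatest hD hu w
  have hρ := sqrt_one_add_sq_pos (nextCot D u w)
  have hρ' := inv_pos.2 hρ
  intro d hd
  rw [sign_nudge hD _ _ hd, sign_nudge hD _ _ hd]
  simp only [inner_nextRay, inner_nextDir, sign_mul, sign_pos hρ', one_mul, mul_eq_zero,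
    hρ'.ne', false_or]
  set k := nextCot D u w
  by_cases hx : ⟪d, u⟫ = 0
  · simp only [hx, if_true, mul_zero, zero_add, zero_sub]
    split_ifs with hy
    · simp [hy]
    · rfl
  · rw [if_neg hx]
    have hle : -⟪d, w⟫ / ⟪d, u⟫ ≤ k := hub ⟨d, ⟨hd, hx⟩, rfl⟩
    have hfac : k * ⟪d, u⟫ + ⟪d, w⟫ = ⟪d, u⟫ * (k - -⟪d, w⟫ / ⟪d, u⟫) := by
      field_simp
      ring
    split_ifs with h0
    · have hw : ⟪d, w⟫ = -k * ⟪d, u⟫ := by linarith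
      rw [hw, show ⟪d, u⟫ - k * (-k * ⟪d, u⟫) = (1 + k ^ 2) * ⟪d, u⟫ by ring, sign_mul,
        sign_pos (show (0 : ℝ) < 1 + k ^ 2 by positivity), one_mul]
    · rw [hfac] at h0 ⊢
      have hpos : 0 < k - -⟪d, w⟫ / ⟪d, u⟫ :=
        lt_of_le_of_ne (sub_nonneg.2 hle) fun h => h0 (by rw [← h, mul_zero])
      rw [sign_mul, sign_pos hpos, mul_one]

lemma nextCot_next {D : Set E} (hD : D.Finite) {u w : E} (h : IsFlag D u w) :
    nextCot D (nextRay D u w) (nextDir D u w) = nextCot D u w := by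
  obtain ⟨-, hub⟩ := nextCot_isGreatest hD h.ray w
  have hρ := sqrt_one_add_sq_pos (nextCot D u w)
  refine IsGreatest.csSup_eq ⟨?_, ?_⟩
  · -- attained at a vector of `D` orthogonal to `u`, but not to `w`
    obtain ⟨d, hd, hdu, hdw⟩ : ∃ d ∈ D, ⟪d, u⟫ = 0 ∧ ⟪d, w⟫ ≠ 0 := by
      by_contra! hcon
      have hw := mem_nullSpan_of_orthogonal h.ray h.mem (by rw [real_inner_comm]; exact h.inner)
      have hle : nullSpan D u ≤ (span ℝ {w})ᗮ := span_le.2 fun d hd => by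
        rw [SetLike.mem_coe, mem_orthogonal_singleton_iff_inner_left]
        exact hcon d hd.1 hd.2
      have := mem_orthogonal_singleton_iff_inner_left.1 (hle hw)
      rw [real_inner_self_eq_norm_sq, h.norm] at this
      norm_num at this
    refine ⟨d, ⟨hd, ?_⟩, ?_⟩
    · rw [inner_nextRay, hdu, mul_zero, zero_add]
      exact mul_ne_zero (inv_ne_zero hρ.ne') hdw
    · simp only [inner_nextRay, inner_nextDir, hdu]
      rw [mul_zero, zero_add, zero_sub, mul_neg, neg_neg,
        mul_div_mul_left _ _ (inv_ne_zero hρ.ne'), mul_div_assoc, div_self hdw, mul_one]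
  · rintro _ ⟨d, ⟨hd, hdn⟩, rfl⟩
    simp only [inner_nextRay, inner_nextDir] at hdn ⊢
    set k := nextCot D u w
    have hdn' := right_ne_zero_of_mul hdn
    rw [← mul_neg, mul_div_mul_left _ _ (inv_ne_zero hρ.ne')]
    by_cases hx : ⟪d, u⟫ = 0
    · rw [hx, mul_zero, zero_add] at hdn' ⊢
      apply le_of_eq
      field_simp
      ring
    · have hle : -⟪d, w⟫ / ⟪d, u⟫ ≤ k := hub ⟨d, ⟨hd, hx⟩, rfl⟩
      have hfac : k * ⟪d, u⟫ + ⟪d, w⟫ = ⟪d, u⟫ * (k - -⟪d, w⟫ / ⟪d, u⟫) := by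
        field_simp
        ring
      have hfac2 : -(⟪d, u⟫ - k * ⟪d, w⟫) = ⟪d, u⟫ * (-(1 + k * (-⟪d, w⟫ / ⟪d, u⟫))) := by
        field_simp
        ring
      have hpos : 0 < k - -⟪d, w⟫ / ⟪d, u⟫ := by
        refine lt_of_le_of_ne (sub_nonneg.2 hle) fun h => hdn' ?_
        rw [hfac, ← h, mul_zero]
      rw [hfac, hfac2, mul_div_mul_left _ _ hx, div_le_iff₀ hpos]
      nlinarith [sq_nonneg k]

lemma nextRay_next {D : Set E} (hD : D.Finite) {u w : E} (h : IsFlag D u w) :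
    nextRay D (nextRay D u w) (nextDir D u w) = u := by
  conv_lhs => rw [nextRay, nextCot_next hD h, nextRay, nextDir]
  have := inv_sqrt_sq (nextCot D u w)
  set k := nextCot D u w
  set r := (√(1 + k ^ 2))⁻¹
  rw [show r • (k • r • (k • u + w) + r • (u - k • w)) = (r * r * (1 + k ^ 2)) • u by module, this,
    one_smul]

lemma nextDir_next {D : Set E} (hD : D.Finite) {u w : E} (h : IsFlag D u w) :
    nextDir D (nextRay D u w) (nextDir D u w) = w := by
  conv_lhs => rw [nextDir, nextCot_next hD h, nextRay, nextDir]
  have := inv_sqrt_sq (nextCot D u w)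
  set k := nextCot D u w
  set r := (√(1 + k ^ 2))⁻¹
  rw [show r • (r • (k • u + w) - k • r • (u - k • w)) = (r * r * (1 + k ^ 2)) • w by module, this,
    one_smul]

lemma isFlag_next {D : Set E} (hD : D.Finite) {u w : E} (h : IsFlag D u w) :
    IsFlag D (nextRay D u w) (nextDir D u w) := by
  have hρ := sqrt_one_add_sq_pos (nextCot D u w)
  have hk := inv_sqrt_sq (nextCot D u w)
  have huu : ⟪u, u⟫ = 1 := by rw [real_inner_self_eq_norm_sq, h.norm_left, one_pow]
  have hww : ⟪w, w⟫ = 1 := by rw [real_inner_self_eq_norm_sq, h.norm, one_pow]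
  have huw := h.inner
  have hwu : ⟪w, u⟫ = 0 := by rw [real_inner_comm]; exact huw
  have hU : ∀ x, ⟪nextRay D u w, x⟫ =
      (√(1 + nextCot D u w ^ 2))⁻¹ * (nextCot D u w * ⟪u, x⟫ + ⟪w, x⟫) := fun x => by
    rw [real_inner_comm, inner_nextRay, real_inner_comm, real_inner_comm x w]
  have hW : ∀ x, ⟪nextDir D u w, x⟫ =
      (√(1 + nextCot D u w ^ 2))⁻¹ * (⟪u, x⟫ - nextCot D u w * ⟪w, x⟫) := fun x => by
    rw [real_inner_comm, inner_nextDir, real_inner_comm, real_inner_comm x w]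
  have hU1 : ‖nextRay D u w‖ = 1 := by
    have h1 : ‖nextRay D u w‖ ^ 2 = 1 := by
      rw [← real_inner_self_eq_norm_sq, hU, inner_nextRay, inner_nextRay, huu, huw, hwu, hww]
      linear_combination hk
    nlinarith [norm_nonneg (nextRay D u w)]
  have hW1 : ‖nextDir D u w‖ = 1 := by
    have h1 : ‖nextDir D u w‖ ^ 2 = 1 := by
      rw [← real_inner_self_eq_norm_sq, hW, inner_nextDir, inner_nextDir, huu, huw, hwu, hww]
      linear_combination hk
    nlinarith [norm_nonneg (nextDir D u w)]
  have hUm : nextRay D u w ∈ span ℝ D :=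
    smul_mem _ _ (add_mem (smul_mem _ _ h.ray.1) h.mem)
  have hWm : nextDir D u w ∈ span ℝ D :=
    smul_mem _ _ (sub_mem h.ray.1 (smul_mem _ _ h.mem))
  have hZ : nullSpan {d | d ∈ D ∧ ⟪d, nextRay D u w⟫ = 0} (nextDir D u w) =
      nullSpan {d | d ∈ D ∧ ⟪d, u⟫ = 0} w := by
    rw [← nullSpan_nudge hD, ← nullSpan_nudge hD]
    exact (sameSign_next hD h.ray w).nullSpan_eq.symm
  refine ⟨⟨hUm, hU1, le_antisymm (finrank_nullSpan_succ_le hUm hU1) ?_⟩, hWm, hW1, ?_, ?_⟩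
  · -- the vector of `D` attaining the maximum is a new vector orthogonal to the next ray
    obtain ⟨⟨d, ⟨hd, hdu⟩, hdk⟩, -⟩ := nextCot_isGreatest hD h.ray w
    have hd0 : ⟪d, nextRay D u w⟫ = 0 := by
      rw [inner_nextRay, ← hdk]
      field_simp
      ring
    have hdn : d ∉ nullSpan {d | d ∈ D ∧ ⟪d, u⟫ = 0} w := fun hmem =>
      hdu (inner_eq_zero_of_mem_nullSpan (span_mono (fun d hd => hd.1) hmem :
        d ∈ nullSpan D u))
    rw [← hZ] at hdn
    have h3 := finrank_sup_span_singleton hdn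
    have h4 := Submodule.finrank_mono (sup_le (span_mono fun d hd => hd.1)
      ((span_singleton_le_iff_mem _ _).2 ((mem_nullSpan_iff hd).2 hd0)) :
      nullSpan {d | d ∈ D ∧ ⟪d, nextRay D u w⟫ = 0} (nextDir D u w) ⊔ span ℝ {d} ≤
        nullSpan D (nextRay D u w))
    have h5 := h.finrank_eq
    rw [← hZ] at h5
    omega
  · rw [hU, inner_nextDir, inner_nextDir, huu, huw, hwu, hww]
    ring
  · rw [hZ, h.finrank_eq]

/-- Summation over all flags is invariant under passing to the next ray. -/
lemma sum_next {D : Set E} (hD : D.Finite) {t : E → Finset E}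
    (ht : ∀ u w, (u ∈ rays D ∧ w ∈ t u) ↔ IsFlag D u w) (g : E → E → ℝ) :
    ∑ u ∈ rays D, ∑ w ∈ t u, g u w =
      ∑ u ∈ rays D, ∑ w ∈ t u, g (nextRay D u w) (nextDir D u w) := by
  rw [Finset.sum_sigma', Finset.sum_sigma']
  refine Finset.sum_nbij' (fun x => ⟨nextRay D x.1 x.2, nextDir D x.1 x.2⟩)
    (fun x => ⟨nextRay D x.1 x.2, nextDir D x.1 x.2⟩) ?_ ?_ ?_ ?_ ?_
  · rintro ⟨u, w⟩ h
    rw [Finset.mem_sigma] at h ⊢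
    exact (ht _ _).2 (isFlag_next hD ((ht _ _).1 h))
  · rintro ⟨u, w⟩ h
    rw [Finset.mem_sigma] at h ⊢
    exact (ht _ _).2 (isFlag_next hD ((ht _ _).1 h))
  · rintro ⟨u, w⟩ h
    have hf := (ht _ _).1 (Finset.mem_sigma.1 h)
    simp only [nextRay_next hD hf, nextDir_next hD hf]
  · rintro ⟨u, w⟩ h
    have hf := (ht _ _).1 (Finset.mem_sigma.1 h)
    simp only [nextRay_next hD hf, nextDir_next hD hf]
  · rintro ⟨u, w⟩ h
    have hf := (ht _ _).1 (Finset.mem_sigma.1 h)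
    simp only [nextRay_next hD hf, nextDir_next hD hf]

/-- Rotating a pair of orthonormal vectors to the next ray turns `⟪p, u⟫ * ⟪q, w⟫` into minus its
antisymmetrization. -/
lemma inner_next_antisymm (D : Set E) (u w p q : E) :
    (⟪p, u⟫ * ⟪q, w⟫ - ⟪q, u⟫ * ⟪p, w⟫) +
      (⟪p, nextRay D u w⟫ * ⟪q, nextDir D u w⟫ - ⟪q, nextRay D u w⟫ * ⟪p, nextDir D u w⟫) = 0 := by
  simp only [inner_nextRay, inner_nextDir]
  have := inv_sqrt_sq (nextCot D u w)
  linear_combination (-(⟪p, u⟫ * ⟪q, w⟫ - ⟪q, u⟫ * ⟪p, w⟫)) * this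

/-! ### The mixed area form of a planar arrangement -/

open Classical in
/-- A point of `X` (junk value `0` if there is none). It is used for singletons. -/
noncomputable def somePoint (X : Set E) : E := if h : X.Nonempty then h.some else 0

lemma somePoint_mem {X : Set E} (h : X.Nonempty) : somePoint X ∈ X := by
  rw [somePoint, dif_pos h]
  exact h.some_mem

lemma somePoint_singleton (x : E) : somePoint ({x} : Set E) = x :=
  somePoint_mem (Set.singleton_nonempty x)

/-- The endpoint, in direction `τ`, of the edge of the polygon `X` with outer normal `w`. -/
noncomputable def corner (X : Set E) (w τ : E) : E := somePoint (face (face X w) τ)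

/-- The mixed area (up to a factor) of two polygons with corners `p` and `q`, as a sum over the
flags `(w, τ)`: the outer normals `w` and the two directions `τ` of the edges orthogonal to `w`. It
adds up the heights of `p` times the edge lengths of `q`. -/
noncomputable def areaForm (D : Set E) (p q : E → E → E) : ℝ :=
  ∑ w ∈ rays D, ∑ τ ∈ unitVecs (nullSpan D w), ⟪p w τ, w⟫ * ⟪q w τ, τ⟫

/-- The two properties of the corners of polygons, and of their linear combinations, on which the
symmetry of the mixed area rests: both ends of an edge have the same height, and consecutive edges
share a corner. -/
structure IsCornerMap (D : Set E) (p : E → E → E) : Prop where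
  height : ∀ w τ, IsFlag D w τ → ⟪p w (-τ), w⟫ = ⟪p w τ, w⟫
  next : ∀ w τ, IsFlag D w τ → p (nextRay D w τ) (nextDir D w τ) = p w τ

lemma neg_mem_unitVecs {L : Submodule ℝ E} (hL : finrank ℝ L = 1) {x : E} :
    -x ∈ unitVecs L ↔ x ∈ unitVecs L := by
  rw [mem_unitVecs hL, mem_unitVecs hL, neg_mem_iff, norm_neg]

lemma sum_unitVecs_neg {L : Submodule ℝ E} (hL : finrank ℝ L = 1) (g : E → ℝ) :
    ∑ x ∈ unitVecs L, g (-x) = ∑ x ∈ unitVecs L, g x :=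
  Finset.sum_nbij' (fun x => -x) (fun x => -x) (fun _ hx => (neg_mem_unitVecs hL).2 hx)
    (fun _ hx => (neg_mem_unitVecs hL).2 hx) (fun _ _ => neg_neg _) (fun _ _ => neg_neg _)
    (fun _ _ => rfl)

lemma neg_mem_raySet {D : Set E} {u : E} (hu : u ∈ raySet D) : -u ∈ raySet D :=
  ⟨neg_mem hu.1, by rw [norm_neg, hu.2.1], by rw [nullSpan_neg, hu.2.2]⟩

lemma sum_rays_neg {D : Set E} (hD : D.Finite) (g : E → ℝ) :
    ∑ x ∈ rays D, g (-x) = ∑ x ∈ rays D, g x := by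
  have h : ∀ x ∈ rays D, -x ∈ rays D := fun x hx =>
    (mem_rays hD).2 (neg_mem_raySet ((mem_rays hD).1 hx))
  exact Finset.sum_nbij' (fun x => -x) (fun x => -x) h h (fun _ _ => neg_neg _)
    (fun _ _ => neg_neg _) (fun _ _ => rfl)

section Planar

variable {D : Set E} (hD : D.Finite) (h2 : finrank ℝ (span ℝ D) = 2)

include hD h2

lemma finrank_nullSpan_ray {w : E} (hw : w ∈ raySet D) : finrank ℝ (nullSpan D w) = 1 := by
  have := hw.2.2
  omega

lemma mem_rays_unitVecs_iff (w τ : E) :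
    (w ∈ rays D ∧ τ ∈ unitVecs (nullSpan D w)) ↔ IsFlag D w τ := by
  rw [mem_rays hD]
  constructor
  · rintro ⟨hw, hτ⟩
    have h1 := finrank_nullSpan_ray hD h2 hw
    rw [mem_unitVecs h1] at hτ
    refine ⟨hw, nullSpan_le_span D w hτ.1, hτ.2, ?_, ?_⟩
    · rw [real_inner_comm]
      exact inner_eq_zero_of_mem_nullSpan hτ.1
    · have h3 := finrank_nullSpan_succ_le (D := {d | d ∈ D ∧ ⟪d, w⟫ = 0}) hτ.1 hτ.2
      change _ ≤ finrank ℝ (nullSpan D w) at h3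
      omega
  · intro h
    refine ⟨h.ray, (mem_unitVecs (finrank_nullSpan_ray hD h2 h.ray)).2 ⟨?_, h.norm⟩⟩
    exact mem_nullSpan_of_orthogonal h.ray h.mem (by rw [real_inner_comm]; exact h.inner)

lemma IsFlag.neg_right {w τ : E} (h : IsFlag D w τ) : IsFlag D w (-τ) := by
  rw [← mem_rays_unitVecs_iff hD h2] at h ⊢
  exact ⟨h.1, (neg_mem_unitVecs (finrank_nullSpan_ray hD h2 ((mem_rays hD).1 h.1))).2 h.2⟩

lemma sum_flags_next (g : E → E → ℝ) :
    ∑ w ∈ rays D, ∑ τ ∈ unitVecs (nullSpan D w), g w τ =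
      ∑ w ∈ rays D, ∑ τ ∈ unitVecs (nullSpan D w), g (nextRay D w τ) (nextDir D w τ) :=
  sum_next hD (mem_rays_unitVecs_iff hD h2) g

lemma sum_flags_congr {g g' : E → E → ℝ} (h : ∀ w τ, IsFlag D w τ → g w τ = g' w τ) :
    ∑ w ∈ rays D, ∑ τ ∈ unitVecs (nullSpan D w), g w τ =
      ∑ w ∈ rays D, ∑ τ ∈ unitVecs (nullSpan D w), g' w τ :=
  Finset.sum_congr rfl fun w hw => Finset.sum_congr rfl fun τ hτ =>
    h w τ ((mem_rays_unitVecs_iff hD h2 w τ).1 ⟨hw, hτ⟩)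

lemma sum_flags_neg (g : E → E → ℝ) :
    ∑ w ∈ rays D, ∑ τ ∈ unitVecs (nullSpan D w), g w τ =
      ∑ w ∈ rays D, ∑ τ ∈ unitVecs (nullSpan D w), g (-w) τ := by
  rw [← sum_rays_neg hD]
  simp only [nullSpan_neg]

lemma sum_flags_neg_dir (g : E → E → ℝ) :
    ∑ w ∈ rays D, ∑ τ ∈ unitVecs (nullSpan D w), g w τ =
      ∑ w ∈ rays D, ∑ τ ∈ unitVecs (nullSpan D w), g w (-τ) :=
  Finset.sum_congr rfl fun _ hw =>
    (sum_unitVecs_neg (finrank_nullSpan_ray hD h2 ((mem_rays hD).1 hw)) _).symm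

/-- A sum over flags whose terms change sign with the direction vanishes. -/
lemma sum_flags_eq_zero {g : E → E → ℝ} (h : ∀ w τ, IsFlag D w τ → g w (-τ) = -g w τ) :
    ∑ w ∈ rays D, ∑ τ ∈ unitVecs (nullSpan D w), g w τ = 0 := by
  have h1 := sum_flags_neg_dir hD h2 g
  rw [sum_flags_congr hD h2 h] at h1
  simp only [Finset.sum_neg_distrib] at h1
  linarith

omit h2 in
lemma isCornerMap_const (t : E) : IsCornerMap D (fun _ _ => t) :=
  ⟨fun _ _ _ => rfl, fun _ _ _ => rfl⟩

omit hD h2 in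
lemma IsCornerMap.sub {p q : E → E → E} (hp : IsCornerMap D p) (hq : IsCornerMap D q) :
    IsCornerMap D (fun w τ => p w τ - q w τ) :=
  ⟨fun w τ h => by rw [inner_sub_left, inner_sub_left, hp.height w τ h, hq.height w τ h],
    fun w τ h => by rw [hp.next w τ h, hq.next w τ h]⟩

omit hD h2 in
lemma areaForm_sub_left (p q r : E → E → E) :
    areaForm D (fun w τ => p w τ - q w τ) r = areaForm D p r - areaForm D q r := by
  simp only [areaForm, inner_sub_left, sub_mul, Finset.sum_sub_distrib]

omit hD h2 in
lemma areaForm_sub_right (p q r : E → E → E) :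
    areaForm D r (fun w τ => p w τ - q w τ) = areaForm D r p - areaForm D r q := by
  simp only [areaForm, inner_sub_left, mul_sub, Finset.sum_sub_distrib]

omit hD h2 in
lemma areaForm_add_right (p q r : E → E → E) :
    areaForm D r (fun w τ => p w τ + q w τ) = areaForm D r p + areaForm D r q := by
  simp only [areaForm, inner_add_left, mul_add, Finset.sum_add_distrib]

lemma areaForm_congr {p q p' q' : E → E → E} (hp : ∀ w τ, IsFlag D w τ → p w τ = p' w τ)
    (hq : ∀ w τ, IsFlag D w τ → q w τ = q' w τ) : areaForm D p q = areaForm D p' q' :=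
  sum_flags_congr hD h2 fun w τ h => by rw [hp w τ h, hq w τ h]

/-- The mixed area is symmetric. -/
lemma areaForm_comm {p q : E → E → E} (hp : IsCornerMap D p) (hq : IsCornerMap D q) :
    areaForm D p q = areaForm D q p := by
  have h1 := sum_flags_next hD h2 (fun w τ => ⟪p w τ, w⟫ * ⟪q w τ, τ⟫ - ⟪q w τ, w⟫ * ⟪p w τ, τ⟫)
  have h3 : ∀ w τ, IsFlag D w τ →
      ⟪p (nextRay D w τ) (nextDir D w τ), nextRay D w τ⟫ *
        ⟪q (nextRay D w τ) (nextDir D w τ), nextDir D w τ⟫ -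
      ⟪q (nextRay D w τ) (nextDir D w τ), nextRay D w τ⟫ *
        ⟪p (nextRay D w τ) (nextDir D w τ), nextDir D w τ⟫ =
      -(⟪p w τ, w⟫ * ⟪q w τ, τ⟫ - ⟪q w τ, w⟫ * ⟪p w τ, τ⟫) := by
    intro w τ h
    rw [hp.next w τ h, hq.next w τ h]
    linarith [inner_next_antisymm D w τ (p w τ) (q w τ)]
  rw [sum_flags_congr hD h2 h3] at h1
  simp only [Finset.sum_neg_distrib, Finset.sum_sub_distrib] at h1
  change areaForm D p q - areaForm D q p = -(areaForm D p q - areaForm D q p) at h1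
  linarith

lemma areaForm_const_right {p : E → E → E} (hp : IsCornerMap D p) (t : E) :
    areaForm D p (fun _ _ => t) = 0 :=
  sum_flags_eq_zero hD h2 fun w τ h => by rw [hp.height w τ h, inner_neg_right, mul_neg]

lemma areaForm_const_left {p : E → E → E} (hp : IsCornerMap D p) (t : E) :
    areaForm D (fun _ _ => t) p = 0 := by
  rw [areaForm_comm hD h2 (isCornerMap_const hD t) hp, areaForm_const_right hD h2 hp]

/-- The mixed area is translation invariant. -/
lemma areaForm_sub_const {p : E → E → E} (hp : IsCornerMap D p) (t : E) :
    areaForm D (fun w τ => p w τ - t) (fun w τ => p w τ - t) = areaForm D p p := by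
  rw [areaForm_sub_left p (fun _ _ => t), areaForm_sub_right p (fun _ _ => t),
    areaForm_sub_right p (fun _ _ => t), areaForm_const_left hD h2 hp,
    areaForm_const_right hD h2 hp, areaForm_const_left hD h2 (isCornerMap_const hD t)]
  ring

omit hD h2 in
lemma corner_mem {S X : Set E} (hX : IsVertexSet S X) (w τ : E) :
    corner X w τ ∈ face (face X w) τ :=
  somePoint_mem (face_nonempty (hX.face w).finite (hX.face w).nonempty τ)

lemma isCornerMap_corner {X : Set E} (hX : IsVertexSet D X) : IsCornerMap D (corner X) := by
  refine ⟨fun w τ _ => inner_eq_of_mem_face (corner_mem hX w _).1 (corner_mem hX w _).1,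
    fun w τ h => ?_⟩
  rw [corner, corner, ← face_nudge hD hX.adapted, ← face_nudge hD hX.adapted,
    (sameSign_next hD h.ray τ).face_eq hX.adapted]

lemma face_face_eq_singleton {X : Set E} (hX : IsVertexSet D X) {w τ : E} (h : IsFlag D w τ) :
    face (face X w) τ = {corner X w τ} := by
  refine Set.Subsingleton.eq_singleton_of_mem ?_ (corner_mem hX w τ)
  rw [← face_nudge hD hX.adapted]
  refine subsingleton_face_of_nullSpan hX.adapted ?_
  rw [nullSpan_nudge hD, ← Submodule.finrank_eq_zero (R := ℝ)]
  have := h.finrank_eq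
  omega

lemma corner_vadd {X : Set E} (hX : IsVertexSet D X) (t : E) {w τ : E} (h : IsFlag D w τ) :
    corner (t +ᵥ X) w τ = t + corner X w τ := by
  rw [corner, face_vadd, face_vadd, face_face_eq_singleton hD h2 hX h, Set.vadd_set_singleton,
    somePoint_singleton, vadd_eq_add]

lemma IsFlag.neg_left {w τ : E} (h : IsFlag D w τ) : IsFlag D (-w) τ := by
  rw [← mem_rays_unitVecs_iff hD h2, mem_rays hD] at h ⊢
  rw [nullSpan_neg]
  exact ⟨neg_mem_raySet h.1, h.2⟩

lemma IsFlag.neg {w τ : E} (h : IsFlag D w τ) : IsFlag D (-w) (-τ) :=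
  (h.neg_left hD h2).neg_right hD h2

lemma corner_neg {X : Set E} (hX : IsVertexSet D X) {w τ : E} (h : IsFlag D w τ) :
    corner (-X) w τ = -corner X (-w) (-τ) := by
  rw [corner, face_neg, face_neg, face_face_eq_singleton hD h2 hX (h.neg hD h2),
    Set.neg_singleton, somePoint_singleton]

/-- Reflection does not change the area. -/
lemma areaForm_neg_set {X : Set E} (hX : IsVertexSet D X) :
    areaForm D (corner (-X)) (corner (-X)) = areaForm D (corner X) (corner X) := by
  have h1 := sum_flags_neg hD h2 (fun w τ => ⟪corner X w τ, w⟫ * ⟪corner X w τ, τ⟫)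
  have h3 := sum_flags_neg_dir hD h2 (fun w τ => ⟪corner X (-w) τ, -w⟫ * ⟪corner X (-w) τ, τ⟫)
  unfold areaForm
  rw [h1, h3]
  refine sum_flags_congr hD h2 fun w τ h => ?_
  rw [corner_neg hD h2 hX h]
  simp only [inner_neg_left, inner_neg_right]

lemma areaForm_vadd {X : Set E} (hX : IsVertexSet D X) (t : E) :
    areaForm D (corner (t +ᵥ X)) (corner (t +ᵥ X)) = areaForm D (corner X) (corner X) := by
  rw [← areaForm_sub_const hD h2 (isCornerMap_corner hD h2 hX) (-t)]
  refine areaForm_congr hD h2 ?_ ?_ <;>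
  · intro w τ h
    rw [corner_vadd hD h2 hX t h, sub_neg_eq_add, add_comm]

lemma areaForm_nonneg {X Y : Set E} (hX : IsVertexSet D X) (hY : IsVertexSet D Y) :
    0 ≤ areaForm D (corner X) (corner Y) := by
  obtain ⟨x, hx⟩ := hX.nonempty
  -- move a point of `X` to the origin, so that all heights are nonnegative
  have h1 := areaForm_sub_left (D := D) (corner X) (fun _ _ => x) (corner Y)
  rw [areaForm_const_left hD h2 (isCornerMap_corner hD h2 hY), sub_zero] at h1
  rw [← h1]
  have h3 := sum_flags_neg_dir hD h2 (fun w τ => ⟪corner X w τ - x, w⟫ * ⟪corner Y w τ, τ⟫)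
  have h4 : 0 ≤ areaForm D (fun w τ => corner X w τ - x) (corner Y) +
      areaForm D (fun w τ => corner X w τ - x) (corner Y) := by
    conv_rhs => arg 2; rw [areaForm, h3]
    rw [areaForm, ← Finset.sum_add_distrib]
    refine Finset.sum_nonneg fun w hw => ?_
    rw [← Finset.sum_add_distrib]
    refine Finset.sum_nonneg fun τ hτ => ?_
    have hf := (mem_rays_unitVecs_iff hD h2 w τ).1 ⟨hw, hτ⟩
    have h5 := (isCornerMap_corner hD h2 hX).height w τ hf
    have h6 : 0 ≤ ⟪corner X w τ - x, w⟫ := by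
      rw [inner_sub_left, sub_nonneg]
      exact (corner_mem hX w τ).1.2 x hx
    have h7 := (corner_mem hY w τ).2 _ (corner_mem hY w (-τ)).1
    rw [inner_sub_left] at h6
    simp only [inner_sub_left, inner_neg_right, h5]
    nlinarith
  linarith

lemma areaForm_eq_zero_of_polyDim_le {X : Set E} (hX : IsVertexSet D X) (h1 : polyDim X ≤ 1) :
    areaForm D (corner X) (corner X) = 0 := by
  -- the contributions of opposite edges cancel
  have key : ∀ w ∈ rays D, (∑ τ ∈ unitVecs (nullSpan D (-w)),
      ⟪corner X (-w) τ, -w⟫ * ⟪corner X (-w) τ, τ⟫) =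
      -∑ τ ∈ unitVecs (nullSpan D w), ⟪corner X w τ, w⟫ * ⟪corner X w τ, τ⟫ := by
    intro w hw
    have hw' := (mem_rays hD).1 hw
    by_cases hf : face X (-w) = face X w
    · rw [nullSpan_neg, ← Finset.sum_neg_distrib]
      refine Finset.sum_congr rfl fun τ _ => ?_
      rw [corner, corner, hf, inner_neg_right, neg_mul]
    · have hz : ∀ v ∈ raySet D, polyDim (face X v) = 0 →
          ∑ τ ∈ unitVecs (nullSpan D v), ⟪corner X v τ, v⟫ * ⟪corner X v τ, τ⟫ = 0 := by
        intro v hv h0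
        have hfr := finrank_nullSpan_ray hD h2 hv
        have h3 := sum_unitVecs_neg hfr (fun τ => ⟪corner X v τ, v⟫ * ⟪corner X v τ, τ⟫)
        have h4 : ∀ τ, corner X v (-τ) = corner X v τ := fun τ =>
          polyDim_eq_zero_iff.1 h0 (corner_mem hX v _).1 (corner_mem hX v _).1
        simp only [h4, inner_neg_right, mul_neg, Finset.sum_neg_distrib] at h3
        linarith
      have hd : ∀ v, face X (-v) ≠ face X v → polyDim (face X v) = 0 := by
        intro v hv
        by_contra h0
        have := polyDim_face_le X v
        have := face_eq_of_polyDim_eq (X := X) (b := v) (by omega)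
        exact hv (by rw [this.1, this.2])
      rw [hz w hw' (hd w hf), hz (-w) (neg_mem_raySet hw')
        (hd (-w) (by rw [neg_neg]; exact Ne.symm hf)), neg_zero]
  have h3 := sum_rays_neg hD
    (fun w => ∑ τ ∈ unitVecs (nullSpan D w), ⟪corner X w τ, w⟫ * ⟪corner X w τ, τ⟫)
  rw [Finset.sum_congr rfl key, Finset.sum_neg_distrib] at h3
  change -areaForm D (corner X) (corner X) = areaForm D (corner X) (corner X) at h3
  linarith

end Planar

/-! ### The area form of an odd function -/

lemma nextCot_neg (D : Set E) (u w : E) : nextCot D (-u) (-w) = nextCot D u w := by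
  simp only [nextCot, inner_neg_right, neg_div_neg_eq, neg_eq_zero, ne_eq]

lemma nextRay_neg (D : Set E) (u w : E) : nextRay D (-u) (-w) = -nextRay D u w := by
  rw [nextRay, nextRay, nextCot_neg]
  module

lemma nextDir_neg (D : Set E) (u w : E) : nextDir D (-u) (-w) = -nextDir D u w := by
  rw [nextDir, nextDir, nextCot_neg]
  module

lemma exists_ray_sameSign {D : Set E} {a : E}
    (ha : finrank ℝ (nullSpan D a) + 1 = finrank ℝ (span ℝ D)) :
    ∃ w ∈ raySet D, SameSign D a w := by
  -- the unit vector of the component of `a` in `span D`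
  set a₀ : E := (span ℝ D).starProjection a with ha₀
  have hinner : ∀ d ∈ D, ⟪d, a₀⟫ = ⟪d, a⟫ := by
    intro d hd
    have := Submodule.starProjection_inner_eq_zero (K := span ℝ D) a d (subset_span hd)
    rw [inner_sub_left, sub_eq_zero] at this
    rw [real_inner_comm, ha₀, ← this, real_inner_comm]
  have hss : SameSign D a a₀ := fun d hd => by rw [hinner d hd]
  have ha₀D : a₀ ∈ span ℝ D := Submodule.starProjection_apply_mem _ _
  have ha0 : a₀ ≠ 0 := by
    intro h0
    have h3 : nullSpan D a = span ℝ D := by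
      rw [hss.nullSpan_eq, h0]
      simp [nullSpan]
    rw [h3] at ha
    omega
  have hn : 0 < ‖a₀‖⁻¹ := inv_pos.2 (norm_pos_iff.2 ha0)
  have hss' : SameSign D a (‖a₀‖⁻¹ • a₀) := fun d hd => by
    rw [hss d hd, inner_smul_right, sign_mul, sign_pos hn, one_mul]
  exact ⟨‖a₀‖⁻¹ • a₀,
    ⟨smul_mem _ _ ha₀D, norm_smul_inv_norm ha0, by rw [← hss'.nullSpan_eq, ha]⟩, hss'⟩

section Planar

variable {D : Set E} (hD : D.Finite) (h2 : finrank ℝ (span ℝ D) = 2)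

include hD h2

/-- If the heights of `ψ` vanish wherever those of the fixed vector `d` do, the area form of `ψ` is
a negative sum of squares: this is the summation by parts that writes the quadratic form with the
help of its null vector `d`. -/
lemma areaForm_nonpos_of_height {ψ : E → E → E} (hψ : IsCornerMap D ψ) {d : E} (hd : d ∈ D)
    (h0 : ∀ w τ, IsFlag D w τ → ⟪d, w⟫ = 0 → ⟪ψ w τ, w⟫ = 0) :
    areaForm D ψ ψ ≤ 0 ∧ (areaForm D ψ ψ = 0 → ∀ w τ, IsFlag D w τ →
      ⟪ψ w τ, τ⟫ * ⟪d, w⟫ - ⟪ψ w τ, w⟫ * ⟪d, τ⟫ = 0) := by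
  set m : E → E → ℝ := fun w τ => ⟪ψ w τ, τ⟫ * ⟪d, w⟫ - ⟪ψ w τ, w⟫ * ⟪d, τ⟫ with hm
  set e : E → E → ℝ := fun w τ => ⟪ψ w τ, w⟫ * m w τ / ⟪d, w⟫ with he
  have h1 : areaForm D ψ ψ = ∑ w ∈ rays D, ∑ τ ∈ unitVecs (nullSpan D w), e w τ := by
    have hz := sum_flags_eq_zero hD h2 (g := fun w τ => ⟪ψ w τ, w⟫ ^ 2 * ⟪d, τ⟫ / ⟪d, w⟫)
      fun w τ h => by
        rw [hψ.height w τ h, inner_neg_right]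
        ring
    rw [areaForm, ← sub_eq_zero, ← hz]
    simp only [← Finset.sum_sub_distrib]
    refine sum_flags_congr hD h2 fun w τ h => ?_
    simp only [he, hm]
    by_cases hs : ⟪d, w⟫ = 0
    · rw [h0 w τ h hs]
      simp
    · field_simp
      ring
  have hnext := sum_flags_next hD h2 e
  -- the contributions of two flags sharing a corner add up to minus a square
  have key : ∀ w τ, IsFlag D w τ → e w τ + e (nextRay D w τ) (nextDir D w τ) ≤ 0 ∧
      (e w τ + e (nextRay D w τ) (nextDir D w τ) = 0 → m w τ = 0) := by
    intro w τ h
    have hmn : m (nextRay D w τ) (nextDir D w τ) = -m w τ := by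
      simp only [hm]
      rw [hψ.next w τ h]
      linarith [inner_next_antisymm D w τ (ψ w τ) d]
    have hzero : m w τ = 0 → e w τ + e (nextRay D w τ) (nextDir D w τ) = 0 := by
      intro h3
      simp only [he]
      rw [hmn, h3]
      simp
    by_cases hs : ⟪d, w⟫ = 0
    · have h3 : m w τ = 0 := by
        simp only [hm]
        rw [hs, h0 w τ h hs]
        ring
      exact ⟨(hzero h3).le, fun _ => h3⟩
    by_cases hs' : ⟪d, nextRay D w τ⟫ = 0
    · have h3 : m w τ = 0 := by
        rw [← neg_eq_zero, ← hmn]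
        simp only [hm]
        rw [hs', h0 _ _ (isFlag_next hD h) hs']
        ring
      exact ⟨(hzero h3).le, fun _ => h3⟩
    have hpos : 0 < ⟪d, w⟫ * ⟪d, nextRay D w τ⟫ := by
      have h3 := sameSign_next hD h.ray τ d hd
      rw [sign_nudge_of_ne hD hd hs, sign_nudge_of_ne hD hd hs'] at h3
      rw [← sign_eq_one_iff, sign_mul, h3, ← sign_mul, sign_eq_one_iff]
      exact mul_self_pos.2 hs'
    have hρ := inv_pos.2 (sqrt_one_add_sq_pos (nextCot D w τ))
    have h4 : ⟪ψ w τ, w⟫ * ⟪d, nextRay D w τ⟫ - ⟪ψ w τ, nextRay D w τ⟫ * ⟪d, w⟫ =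
        -((√(1 + nextCot D w τ ^ 2))⁻¹ * m w τ) := by
      rw [inner_nextRay, inner_nextRay]
      simp only [hm]
      ring
    have h5 : e w τ + e (nextRay D w τ) (nextDir D w τ) =
        -((√(1 + nextCot D w τ ^ 2))⁻¹ * m w τ ^ 2 / (⟪d, w⟫ * ⟪d, nextRay D w τ⟫)) := by
      have h6 : e w τ + e (nextRay D w τ) (nextDir D w τ) =
          m w τ * (⟪ψ w τ, w⟫ * ⟪d, nextRay D w τ⟫ - ⟪ψ w τ, nextRay D w τ⟫ * ⟪d, w⟫) /
            (⟪d, w⟫ * ⟪d, nextRay D w τ⟫) := by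
        simp only [he]
        rw [hmn, hψ.next w τ h]
        field_simp
        ring
      rw [h6, h4]
      ring
    rw [h5, neg_nonpos, neg_eq_zero]
    refine ⟨by positivity, fun h7 => ?_⟩
    rw [div_eq_zero_iff, or_iff_left hpos.ne', mul_eq_zero, or_iff_right hρ.ne'] at h7
    exact pow_eq_zero_iff two_ne_zero |>.1 h7
  have hsum : areaForm D ψ ψ + areaForm D ψ ψ = ∑ w ∈ rays D, ∑ τ ∈ unitVecs (nullSpan D w),
      (e w τ + e (nextRay D w τ) (nextDir D w τ)) := by
    simp only [Finset.sum_add_distrib]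
    rw [← hnext, h1]
  have hle : ∀ w ∈ rays D, ∀ τ ∈ unitVecs (nullSpan D w),
      e w τ + e (nextRay D w τ) (nextDir D w τ) ≤ 0 := fun w hw τ hτ =>
    (key w τ ((mem_rays_unitVecs_iff hD h2 w τ).1 ⟨hw, hτ⟩)).1
  refine ⟨?_, fun heq w τ h => (key w τ h).2 ?_⟩
  · have := Finset.sum_nonpos fun w hw => Finset.sum_nonpos (hle w hw)
    linarith
  · rw [heq, add_zero] at hsum
    have hf := (mem_rays_unitVecs_iff hD h2 w τ).2 h
    exact (Finset.sum_eq_zero_iff_of_nonpos (hle w hf.1)).1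
      ((Finset.sum_eq_zero_iff_of_nonpos fun w hw => Finset.sum_nonpos (hle w hw)).1 hsum.symm w
        hf.1) τ hf.2

/-- The area form of an odd function is nonpositive, and zero only if the
edge lengths vanish for every normal `w` not orthogonal to a given nonzero direction `d`. -/
lemma areaForm_nonpos_of_odd {φ : E → E → E} (hφ : IsCornerMap D φ)
    (hodd : ∀ w τ, φ (-w) (-τ) = φ w τ) {d : E} (hd : d ∈ D) (hd0 : d ≠ 0) :
    areaForm D φ φ ≤ 0 ∧ (areaForm D φ φ = 0 → ∀ w τ, IsFlag D w τ → ⟪d, w⟫ ≠ 0 →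
      ⟪φ w τ, τ⟫ + ⟪φ w (-τ), -τ⟫ = 0) := by
  have hdD : d ∈ span ℝ D := subset_span hd
  have hrk : finrank ℝ (span ℝ {d}) + 1 = finrank ℝ (span ℝ D) := by
    rw [finrank_span_singleton hd0, h2]
  have hle : span ℝ {d} ≤ span ℝ D := (span_singleton_le_iff_mem _ _).2 hdD
  obtain ⟨y, hy, hyd⟩ : ∃ y ∈ span ℝ D, y ∉ span ℝ {d} := by
    refine SetLike.exists_of_lt (lt_of_le_of_ne hle fun h => ?_)
    rw [h] at hrk
    omega
  -- by translating, the height in the two directions orthogonal to `d` is made zero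
  obtain ⟨v, hv⟩ : ∃ v : E, ∀ w τ, IsFlag D w τ → ⟪d, w⟫ = 0 → ⟪φ w τ - v, w⟫ = 0 := by
    by_cases hex : ∃ w τ, IsFlag D w τ ∧ ⟪d, w⟫ = 0
    · obtain ⟨w₁, τ₁, hf₁, hd₁⟩ := hex
      have hτ : ∀ τ, IsFlag D w₁ τ → ⟪φ w₁ τ, w₁⟫ = ⟪φ w₁ τ₁, w₁⟫ := by
        intro τ hτ
        have h3 := ((mem_rays_unitVecs_iff hD h2 _ _).2 hτ).2
        have h4 := ((mem_rays_unitVecs_iff hD h2 _ _).2 hf₁).2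
        have hfr := finrank_nullSpan_ray hD h2 hf₁.ray
        rw [mem_unitVecs hfr] at h3 h4
        rcases eq_or_eq_neg_of_orthogonal bot_le (by rw [finrank_bot, hfr]) h4.1 h3.1 h4.2 h3.2
          (by simp) (by simp) with rfl | rfl
        · rfl
        · exact hφ.height _ _ hf₁
      have hw₁ : ⟪w₁, w₁⟫ = 1 := by rw [real_inner_self_eq_norm_sq, hf₁.norm_left, one_pow]
      refine ⟨⟪φ w₁ τ₁, w₁⟫ • w₁, fun w τ hf hdw => ?_⟩
      have hperp : ∀ x : E, ⟪d, x⟫ = 0 → x ∈ (span ℝ {d})ᗮ := fun x hx =>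
        mem_orthogonal_singleton_iff_inner_right.2 hx
      rcases eq_or_eq_neg_of_orthogonal hle hrk hf₁.ray.1 hf.ray.1 hf₁.norm_left hf.norm_left
        (hperp _ hd₁) (hperp _ hdw) with rfl | rfl
      · rw [inner_sub_left, real_inner_smul_left, hw₁, hτ τ hf]
        ring
      · have hf' := hf.neg hD h2
        rw [neg_neg] at hf'
        have := hodd (-w₁) τ
        rw [neg_neg] at this
        rw [inner_sub_left, real_inner_smul_left, inner_neg_right, inner_neg_right, hw₁, ← this,
          hτ _ hf']
        ring
    · push Not at hex
      exact ⟨0, fun w τ hf h => absurd h (hex w τ hf)⟩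
  have hψ := hφ.sub (isCornerMap_const (D := D) hD v)
  have h3 := areaForm_nonpos_of_height hD h2 hψ hd hv
  rw [areaForm_sub_const hD h2 hφ] at h3
  refine ⟨h3.1, fun heq w τ hf hdw => ?_⟩
  have h4 := h3.2 heq w τ hf
  have h5 := h3.2 heq w (-τ) (hf.neg_right hD h2)
  have h6 := hφ.height w τ hf
  simp only [inner_sub_left, inner_neg_right, h6] at h4 h5 ⊢
  have h7 : (⟪φ w τ, τ⟫ + -⟪φ w (-τ), τ⟫) * ⟪d, w⟫ = 0 := by linarith
  exact (mul_eq_zero.1 h7).resolve_right hdw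

omit h2 in
lemma isCornerMap_reflect {p : E → E → E} (hp : IsCornerMap D p)
    (hneg : ∀ w τ, IsFlag D w τ → IsFlag D (-w) (-τ)) :
    IsCornerMap D (fun w τ => p (-w) (-τ)) := by
  refine ⟨fun w τ h => ?_, fun w τ h => ?_⟩
  · have := hp.height _ _ (hneg w τ h)
    rw [inner_neg_right, inner_neg_right, neg_inj] at this
    exact this
  · have := hp.next _ _ (hneg w τ h)
    rwa [nextRay_neg, nextDir_neg] at this

omit hD h2 in
lemma IsCornerMap.add {p q : E → E → E} (hp : IsCornerMap D p) (hq : IsCornerMap D q) :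
    IsCornerMap D (fun w τ => p w τ + q w τ) :=
  ⟨fun w τ h => by rw [inner_add_left, inner_add_left, hp.height w τ h, hq.height w τ h],
    fun w τ h => by rw [hp.next w τ h, hq.next w τ h]⟩

/-- A polygon whose opposite edges have the same length is centrally symmetric. -/
lemma isSymm_of_edges {X : Set E} (hX : IsVertexSet D X)
    (h : ∀ w τ, IsFlag D w τ → ⟪corner X w τ, τ⟫ + ⟪corner X w (-τ), -τ⟫ =
      ⟪corner X (-w) τ, τ⟫ + ⟪corner X (-w) (-τ), -τ⟫) : IsSymm X := by
  suffices key : ∀ a, finrank ℝ (nullSpan D a) = 1 →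
      shape 1 (face (-X) a) = shape 1 (face X a) from exists_vadd_eq_of_edges hD hX.neg hX key
  intro a ha
  obtain ⟨w, hwr, hss⟩ := exists_ray_sameSign (D := D) (a := a) (by rw [ha, h2])
  rw [hss.nullSpan_eq] at ha
  rw [hss.face_eq hX.adapted, hss.face_eq hX.neg.adapted]
  -- both edges are parallel to `τ`
  obtain ⟨e, he0, he⟩ := finrank_eq_one_iff'.1 ha
  have he0' : (e : E) ≠ 0 := by simpa using he0
  set τ : E := ‖(e : E)‖⁻¹ • (e : E) with hτ
  have hτ1 : ‖τ‖ = 1 := norm_smul_inv_norm he0'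
  have hfl : IsFlag D w τ := (mem_rays_unitVecs_iff hD h2 _ _).1
    ⟨(mem_rays hD).2 hwr, (mem_unitVecs ha).2 ⟨smul_mem _ _ e.2, hτ1⟩⟩
  have hline : ∀ x ∈ nullSpan D w, x = ⟪x, τ⟫ • τ := by
    intro x hx
    obtain ⟨c, hc⟩ := he ⟨x, hx⟩
    have hx' : x = (c * ‖(e : E)‖) • τ := by
      rw [hτ, smul_smul, mul_assoc, mul_inv_cancel₀ (norm_ne_zero_iff.2 he0'), mul_one,
        ← Submodule.coe_smul, hc]
    rw [hx', real_inner_smul_left, real_inner_self_eq_norm_sq, hτ1, one_pow, mul_one]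
  have hpair : ∀ v, nullSpan D v = nullSpan D w →
      face X v = {corner X v τ, corner X v (-τ)} ∧
      corner X v τ - corner X v (-τ) =
        (⟪corner X v τ, τ⟫ + ⟪corner X v (-τ), -τ⟫) • τ := by
    intro v hv
    have hl : ∀ x ∈ face X v, ∀ y ∈ face X v, x - y = ⟪x - y, τ⟫ • τ := fun x hx y hy =>
      hline _ (hv ▸ vectorSpan_face_le hX.adapted v (vsub_mem_vectorSpan ℝ hx hy))
    refine ⟨(hX.face v).eq_pair (e := τ) (fun x hx y hy => ⟨_, hl x hx y hy⟩)
      (corner_mem hX v τ) (corner_mem hX v (-τ)), ?_⟩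
    rw [inner_neg_right, ← sub_eq_add_neg, ← inner_sub_left]
    exact hl _ (corner_mem hX v τ).1 _ (corner_mem hX v (-τ)).1
  obtain ⟨h3, h4⟩ := hpair w rfl
  obtain ⟨h5, h6⟩ := hpair (-w) (nullSpan_neg D w)
  rw [← h w τ hfl] at h6
  rw [face_neg, h3, h5]
  have h7 : ({corner X w τ, corner X w (-τ)} : Set E) =
      (corner X w τ + corner X (-w) (-τ)) +ᵥ
        -({corner X (-w) τ, corner X (-w) (-τ)} : Set E) := by
    ext x
    rw [mem_vadd_iff, Set.mem_neg]
    simp only [Set.mem_insert_iff, Set.mem_singleton_iff]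
    have h8 : corner X w (-τ) =
        corner X w τ + corner X (-w) (-τ) - corner X (-w) τ := by
      rw [add_sub_assoc, ← neg_sub (corner X (-w) τ), h6, ← h4]
      abel
    rw [h8, or_comm]
    refine or_congr ?_ ?_
    · constructor <;> intro hx
      · rw [hx]; abel
      · rw [neg_sub, sub_eq_iff_eq_add, ← sub_eq_iff_eq_add'] at hx
        exact hx.symm
    · constructor <;> intro hx
      · rw [hx]; abel
      · rw [neg_sub, sub_eq_iff_eq_add, add_comm (corner X w τ), add_right_inj] at hx
        exact hx.symm
  rw [h7, shape_vadd]

/-- Minkowski's inequality for the mixed area of a polygon and its reflection, with the case of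
equality. -/
lemma areaForm_sub_nonpos_of_reflection {X : Set E} (hX : IsVertexSet D X) (t : E) :
    areaForm D (fun w τ => corner X w τ - corner (t +ᵥ -X) w τ)
      (fun w τ => corner X w τ - corner (t +ᵥ -X) w τ) ≤ 0 ∧
    (areaForm D (fun w τ => corner X w τ - corner (t +ᵥ -X) w τ)
      (fun w τ => corner X w τ - corner (t +ᵥ -X) w τ) = 0 → IsSymm X) := by
  set φ : E → E → E := fun w τ => corner X w τ + corner X (-w) (-τ) with hφdef
  have hcX := isCornerMap_corner hD h2 hX
  have hφ : IsCornerMap D φ :=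
    hcX.add (isCornerMap_reflect hD hcX fun w τ h => h.neg hD h2)
  have hodd : ∀ w τ, φ (-w) (-τ) = φ w τ := fun w τ => by
    simp only [hφdef, neg_neg]
    rw [add_comm]
  have heq : ∀ w τ, IsFlag D w τ → corner X w τ - corner (t +ᵥ -X) w τ = φ w τ - t := by
    intro w τ h
    rw [corner_vadd hD h2 hX.neg t h, corner_neg hD h2 hX h]
    simp only [hφdef]
    abel
  rw [areaForm_congr hD h2 heq heq, areaForm_sub_const hD h2 hφ]
  constructor
  · obtain ⟨d, hd, hd0⟩ : ∃ d ∈ D, d ≠ 0 := by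
      by_contra! hcon
      have : span ℝ D = ⊥ := span_eq_bot.2 hcon
      rw [this, finrank_bot] at h2
      omega
    exact (areaForm_nonpos_of_odd hD h2 hφ hodd hd hd0).1
  · intro h0
    refine isSymm_of_edges hD h2 hX fun w τ hf => ?_
    obtain ⟨d, hd, hdw⟩ : ∃ d ∈ D, ⟪d, w⟫ ≠ 0 := by
      by_contra! hcon
      have hle : span ℝ D ≤ nullSpan D w := span_le.2 fun d hd => subset_span ⟨hd, hcon d hd⟩
      have h3 := Submodule.finrank_mono hle
      have h4 := finrank_nullSpan_ray hD h2 hf.ray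
      omega
    have hd0 : d ≠ 0 := by
      rintro rfl
      simp at hdw
    have h3 := (areaForm_nonpos_of_odd hD h2 hφ hodd hd hd0).2 h0 w τ hf hdw
    simp only [hφdef, inner_add_left, neg_neg, inner_neg_right] at h3 ⊢
    linarith

end Planar

/-! ### Three-dimensional polytopes whose facets agree up to reflection -/

lemma mem_rays_iff_isFlag {D : Set E} (hD : D.Finite) (u w : E) :
    (u ∈ rays D ∧ w ∈ rays {d | d ∈ D ∧ ⟪d, u⟫ = 0}) ↔ IsFlag D u w := by
  rw [mem_rays hD, mem_rays (hD.subset fun d hd => hd.1)]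
  constructor
  · rintro ⟨hu, hw, hw1, hwr⟩
    refine ⟨hu, nullSpan_le_span D u hw, hw1, ?_, ?_⟩
    · rw [real_inner_comm]
      exact inner_eq_zero_of_mem_nullSpan hw
    · rw [← hu.2.2, ← add_assoc _ 1 1, hwr]
      rfl
  · intro h
    refine ⟨h.ray, mem_nullSpan_of_orthogonal h.ray h.mem (by rw [real_inner_comm]; exact h.inner),
      h.norm, ?_⟩
    have h1 := h.finrank_eq
    have h2 := h.ray.2.2
    change _ = finrank ℝ (nullSpan D u)
    omega

/-- Two polygons that agree up to translation or reflection, or that are both degenerate, have the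
same area. -/
lemma areaForm_eq_of_pm {D X Y : Set E} (hD : D.Finite) (h2 : finrank ℝ (span ℝ D) = 2)
    (hX : IsVertexSet D X) (hY : IsVertexSet D Y) (hdX : polyDim X ≤ 2) (hdY : polyDim Y ≤ 2)
    (H : shape 2 X = shape 2 Y ∨ shape 2 X = -shape 2 Y) :
    areaForm D (corner X) (corner X) = areaForm D (corner Y) (corner Y) := by
  by_cases hd : polyDim X = 2
  · rcases H with H | H
    · obtain ⟨t, rfl⟩ := (shape_eq_iff hd).1 H
      rw [areaForm_vadd hD h2 hX]
    · rw [← shape_neg] at H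
      obtain ⟨t, ht⟩ := (shape_eq_iff hd).1 H
      rw [← areaForm_neg_set hD h2 hY, ht, areaForm_vadd hD h2 hX]
  · have hd' : polyDim Y ≠ 2 := by
      rw [← shape_eq_empty_iff]
      rcases H with h | h <;> rw [shape_of_ne hd] at h
      · exact h.symm
      · rw [← neg_neg (shape 2 Y), ← h, Set.neg_empty]
    rw [areaForm_eq_zero_of_polyDim_le hD h2 hX (by omega),
      areaForm_eq_zero_of_polyDim_le hD h2 hY (by omega)]

/-- The area form of the difference of two polygons that agree up to translation or reflection is
nonpositive, and zero only if they are translates of each other. -/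
lemma areaForm_sub_nonpos_of_pm {D X Y : Set E} (hD : D.Finite) (h2 : finrank ℝ (span ℝ D) = 2)
    (hX : IsVertexSet D X) (hY : IsVertexSet D Y) (hdX : polyDim X ≤ 2) (hdY : polyDim Y ≤ 2)
    (H : shape 2 X = shape 2 Y ∨ shape 2 X = -shape 2 Y) :
    areaForm D (fun w τ => corner X w τ - corner Y w τ) (fun w τ => corner X w τ - corner Y w τ) ≤ 0
    ∧ (areaForm D (fun w τ => corner X w τ - corner Y w τ)
      (fun w τ => corner X w τ - corner Y w τ) = 0 → shape 2 X = shape 2 Y) := by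
  have hcX := isCornerMap_corner hD h2 hX
  have hcY := isCornerMap_corner hD h2 hY
  by_cases hd : polyDim X = 2
  · rcases H with H | H
    · obtain ⟨t, rfl⟩ := (shape_eq_iff hd).1 H
      have : ∀ w τ, IsFlag D w τ → corner X w τ - corner (t +ᵥ X) w τ = -t := by
        intro w τ h
        rw [corner_vadd hD h2 hX t h]
        abel
      rw [areaForm_congr hD h2 this this,
        areaForm_const_right hD h2 (isCornerMap_const hD _)]
      exact ⟨le_rfl, fun _ => H⟩
    · have H' : shape 2 (-X) = shape 2 Y := by rw [shape_neg, H, neg_neg]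
      obtain ⟨t, rfl⟩ := (shape_eq_iff (by rw [polyDim_neg, hd])).1 H'
      have h3 := areaForm_sub_nonpos_of_reflection hD h2 hX t
      exact ⟨h3.1, fun h0 => by rw [shape_vadd, shape_neg, ← (h3.2 h0).shape_eq]⟩
  · have hd' : polyDim Y ≠ 2 := by
      rw [← shape_eq_empty_iff]
      rcases H with h | h <;> rw [shape_of_ne hd] at h
      · exact h.symm
      · rw [← neg_neg (shape 2 Y), ← h, Set.neg_empty]
    refine ⟨?_, fun _ => by rw [shape_of_ne hd, shape_of_ne hd']⟩
    rw [areaForm_sub_left, areaForm_sub_right, areaForm_sub_right,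
      areaForm_eq_zero_of_polyDim_le hD h2 hX (by omega),
      areaForm_eq_zero_of_polyDim_le hD h2 hY (by omega)]
    linarith [areaForm_nonneg hD h2 hX hY, areaForm_nonneg hD h2 hY hX]

lemma abs_inner_le_of_mem_face {A : Set E} (hA : A = -A) {u x y : E} (hx : x ∈ face A u)
    (hy : y ∈ A) : |⟪y, u⟫| ≤ ⟪x, u⟫ := by
  rw [hA] at hy
  have h1 := hx.2 _ (Set.mem_neg.1 hy)
  rw [← hA] at hy
  rw [inner_neg_left] at h1
  exact abs_le.2 ⟨by linarith, hx.2 y hy⟩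

/-- Two symmetric three-dimensional polytopes whose facets agree up to reflection have the same
facets. With `f` and `C` the difference and the sum of the two polytopes, the mixed volume of
`f, f, C` is zero when expanded along `f`, as the areas of the facets agree. Expanded along `C` it
is a sum of nonpositive terms, which therefore vanish. -/
lemma shape_face_eq_of_pm_of_eq_neg {D A B : Set E} (hD : D.Finite)
    (h3 : finrank ℝ (span ℝ D) = 3) (hA : IsVertexSet D A) (hB : IsVertexSet D B)
    (hspan : vectorSpan ℝ A = span ℝ D) (hsA : A = -A) (hsB : B = -B)
    (H : ∀ u, finrank ℝ (nullSpan D u) = 2 → shape 2 (face A u) = shape 2 (face B u) ∨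
      shape 2 (face A u) = -shape 2 (face B u)) {u : E} (hu : u ∈ raySet D) :
    shape 2 (face A u) = shape 2 (face B u) := by
  have hDu : ∀ u, {d | d ∈ D ∧ ⟪d, u⟫ = 0}.Finite := fun u => hD.subset fun d hd => hd.1
  have hr : ∀ u ∈ raySet D, finrank ℝ (span ℝ {d | d ∈ D ∧ ⟪d, u⟫ = 0}) = 2 := fun u hu => by
    have := hu.2.2
    change finrank ℝ (nullSpan D u) = 2
    omega
  have hdA : ∀ u ∈ raySet D, polyDim (face A u) ≤ 2 := fun u hu =>
    (polyDim_le_of_adapted hA.adapted u).trans_eq (hr u hu)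
  have hdB : ∀ u ∈ raySet D, polyDim (face B u) ≤ 2 := fun u hu =>
    (polyDim_le_of_adapted hB.adapted u).trans_eq (hr u hu)
  set f : E → E → E → E := fun u w τ => corner (face A u) w τ - corner (face B u) w τ with hf
  set C : E → E → E → E := fun u w τ => corner (face A u) w τ + corner (face B u) w τ with hC
  set α : E → ℝ := fun u => ⟪somePoint (face A u), u⟫ with hα
  set β : E → ℝ := fun u => ⟪somePoint (face B u), u⟫ with hβ
  have hαA : ∀ u x, x ∈ face A u → ⟪x, u⟫ = α u := fun u x hx =>
    inner_eq_of_mem_face hx (somePoint_mem (face_nonempty hA.finite hA.nonempty u))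
  have hβB : ∀ u x, x ∈ face B u → ⟪x, u⟫ = β u := fun u x hx =>
    inner_eq_of_mem_face hx (somePoint_mem (face_nonempty hB.finite hB.nonempty u))
  have hfu : ∀ u w τ, ⟪f u w τ, u⟫ = α u - β u := fun u w τ => by
    simp only [hf]
    rw [inner_sub_left, hαA u _ (corner_mem (hA.face u) w τ).1.1,
      hβB u _ (corner_mem (hB.face u) w τ).1.1]
  have hCu : ∀ u w τ, ⟪C u w τ, u⟫ = α u + β u := fun u w τ => by
    simp only [hC]
    rw [inner_add_left, hαA u _ (corner_mem (hA.face u) w τ).1.1,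
      hβB u _ (corner_mem (hB.face u) w τ).1.1]
  -- the expansion along `f` vanishes
  have hfC : ∀ u ∈ rays D, areaForm {d | d ∈ D ∧ ⟪d, u⟫ = 0} (C u) (f u) = 0 := by
    intro u hu
    rw [mem_rays hD] at hu
    have hcA := isCornerMap_corner (hDu u) (hr u hu) (hA.face_null u)
    have hcB := isCornerMap_corner (hDu u) (hr u hu) (hB.face_null u)
    rw [areaForm_comm (hDu u) (hr u hu) (hcA.add hcB) (hcA.sub hcB)]
    rw [areaForm_sub_left, areaForm_add_right, areaForm_add_right,
      areaForm_comm (hDu u) (hr u hu) hcA hcB,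
      areaForm_eq_of_pm (hDu u) (hr u hu) (hA.face_null u) (hB.face_null u) (hdA u hu) (hdB u hu)
        (H u (hr u hu))]
    ring
  -- the expansion along `f` is the expansion along `C`
  have hexp : ∑ u ∈ rays D, (α u + β u) * areaForm {d | d ∈ D ∧ ⟪d, u⟫ = 0} (f u) (f u) = 0 := by
    set g : E → E → ℝ := fun u w =>
      ∑ τ ∈ unitVecs (nullSpan {d | d ∈ D ∧ ⟪d, u⟫ = 0} w),
        (⟪C u w τ, u⟫ * ⟪f u w τ, w⟫ - ⟪f u w τ, u⟫ * ⟪C u w τ, w⟫) * ⟪f u w τ, τ⟫ with hg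
    have hsum := sum_next hD (mem_rays_iff_isFlag hD) g
    have hneg : ∀ u w, IsFlag D u w → g (nextRay D u w) (nextDir D u w) = -g u w := by
      intro u w h
      have hss := sameSign_next hD h.ray w
      have hface : ∀ S, IsVertexSet D S → face (face S (nextRay D u w)) (nextDir D u w) =
          face (face S u) w := fun S hS => by
        rw [← face_nudge hD hS.adapted, ← face_nudge hD hS.adapted, hss.face_eq hS.adapted]
      have hnull : nullSpan {d | d ∈ D ∧ ⟪d, nextRay D u w⟫ = 0} (nextDir D u w) =
          nullSpan {d | d ∈ D ∧ ⟪d, u⟫ = 0} w := by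
        rw [← nullSpan_nudge hD, ← nullSpan_nudge hD, hss.nullSpan_eq]
      simp only [hg]
      rw [hnull, ← Finset.sum_neg_distrib]
      refine Finset.sum_congr rfl fun τ _ => ?_
      have hf' : f (nextRay D u w) (nextDir D u w) τ = f u w τ := by
        simp only [hf, corner, hface A hA, hface B hB]
      have hC' : C (nextRay D u w) (nextDir D u w) τ = C u w τ := by
        simp only [hC, corner, hface A hA, hface B hB]
      rw [hf', hC']
      linear_combination ⟪f u w τ, τ⟫ * inner_next_antisymm D u w (C u w τ) (f u w τ)
    have hzero : ∑ u ∈ rays D, ∑ w ∈ rays {d | d ∈ D ∧ ⟪d, u⟫ = 0}, g u w = 0 := by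
      have h4 : ∑ u ∈ rays D, ∑ w ∈ rays {d | d ∈ D ∧ ⟪d, u⟫ = 0},
          g (nextRay D u w) (nextDir D u w) =
          ∑ u ∈ rays D, ∑ w ∈ rays {d | d ∈ D ∧ ⟪d, u⟫ = 0}, -g u w :=
        Finset.sum_congr rfl fun u hu => Finset.sum_congr rfl fun w hw =>
          hneg u w ((mem_rays_iff_isFlag hD u w).1 ⟨hu, hw⟩)
      rw [h4] at hsum
      simp only [Finset.sum_neg_distrib] at hsum
      linarith
    refine Eq.trans (Finset.sum_congr rfl fun u hu => ?_) hzero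
    have h5 : ∑ w ∈ rays {d | d ∈ D ∧ ⟪d, u⟫ = 0}, g u w =
        (α u + β u) * areaForm {d | d ∈ D ∧ ⟪d, u⟫ = 0} (f u) (f u) -
        (α u - β u) * areaForm {d | d ∈ D ∧ ⟪d, u⟫ = 0} (C u) (f u) := by
      simp only [hg, areaForm, hfu, hCu, Finset.mul_sum, ← Finset.sum_sub_distrib]
      refine Finset.sum_congr rfl fun w _ => Finset.sum_congr rfl fun τ _ => ?_
      ring
    rw [h5, hfC u hu, mul_zero, sub_zero]
  have hpos : ∀ u ∈ raySet D, 0 < α u + β u := by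
    intro u hu
    have hx := somePoint_mem (face_nonempty hA.finite hA.nonempty u)
    have hy := somePoint_mem (face_nonempty hB.finite hB.nonempty u)
    have hβ0 : 0 ≤ β u := (abs_nonneg _).trans (abs_inner_le_of_mem_face hsB hy hy.1)
    have hα0 : 0 ≤ α u := (abs_nonneg _).trans (abs_inner_le_of_mem_face hsA hx hx.1)
    refine add_pos_of_pos_of_nonneg (lt_of_le_of_ne hα0 fun h0 => ?_) hβ0
    -- otherwise `A` is orthogonal to `u`
    have h4 : ∀ y ∈ A, ⟪y, u⟫ = 0 := fun y hy' => by
      have := abs_inner_le_of_mem_face hsA hx hy'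
      rw [show ⟪somePoint (face A u), u⟫ = 0 from h0.symm] at this
      exact abs_nonpos_iff.1 this
    have h5 : face A u = A := Set.Subset.antisymm (face_subset A u) fun y hy' =>
      ⟨hy', fun z hz => by rw [h4 y hy', h4 z hz]⟩
    have h6 : u ∈ vectorSpan ℝ (face A u) := by
      rw [h5, hspan]
      exact hu.1
    have h7 := inner_eq_zero_of_mem_vectorSpan_face h6
    rw [real_inner_self_eq_norm_sq, hu.2.1] at h7
    norm_num at h7
  have hterm := fun u (hu : u ∈ raySet D) =>
    areaForm_sub_nonpos_of_pm (hDu u) (hr u hu) (hA.face_null u) (hB.face_null u) (hdA u hu)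
      (hdB u hu) (H u (hr u hu))
  have h8 := (Finset.sum_eq_zero_iff_of_nonpos fun u hu =>
    mul_nonpos_of_nonneg_of_nonpos (hpos u ((mem_rays hD).1 hu)).le
      (hterm u ((mem_rays hD).1 hu)).1).1 hexp u ((mem_rays hD).2 hu)
  exact (hterm u hu).2 ((mul_eq_zero.1 h8).resolve_left (hpos u hu).ne')

lemma IsSymm.exists_vadd_eq_neg {X : Set E} (h : IsSymm X) :
    ∃ t : E, t +ᵥ X = -(t +ᵥ X) := by
  obtain ⟨t, ht⟩ := h
  refine ⟨-((1 / 2 : ℝ) • t), ?_⟩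
  conv_lhs => rw [ht]
  rw [vadd_neg_set, vadd_vadd]
  congr 1
  module

/-- Two centrally symmetric three-dimensional polytopes whose facets agree up to reflection are
translates of each other. -/
theorem exists_vadd_eq_of_facets_dim_three {D A B : Set E} (hD : D.Finite)
    (hA : IsVertexSet D A) (hB : IsVertexSet D B) (hdA : polyDim A = 3)
    (hspan : vectorSpan ℝ A = vectorSpan ℝ B) (hsA : IsSymm A) (hsB : IsSymm B)
    (H : ∀ u, finrank ℝ (nullSpan D u) = 2 → shape 2 (face A u) = shape 2 (face B u) ∨
      shape 2 (face A u) = -shape 2 (face B u)) : ∃ t : E, B = t +ᵥ A := by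
  -- pass to the differences lying in the space spanned by the polytopes
  set D' := {d | d ∈ D ∧ d ∈ vectorSpan ℝ A} with hD'
  have hD'fin : D'.Finite := hD.subset fun d hd => hd.1
  have hA' : IsVertexSet D' A := ⟨hA.finite, hA.nonempty, fun x hx y hy =>
    ⟨hA.adapted x hx y hy, vsub_mem_vectorSpan ℝ hx hy⟩, hA.exposed⟩
  have hB' : IsVertexSet D' B := ⟨hB.finite, hB.nonempty, fun x hx y hy =>
    ⟨hB.adapted x hx y hy, hspan ▸ vsub_mem_vectorSpan ℝ hx hy⟩, hB.exposed⟩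
  have hsp : vectorSpan ℝ A = span ℝ D' := by
    refine le_antisymm ?_ (span_le.2 fun d hd => hd.2)
    rw [vectorSpan_def]
    refine span_mono ?_
    rintro _ ⟨x, hx, y, hy, rfl⟩
    exact hA'.adapted x hx y hy
  have h3 : finrank ℝ (span ℝ D') = 3 := by rw [← hsp, ← hdA]; rfl
  have H' : ∀ u, finrank ℝ (nullSpan D' u) = 2 → shape 2 (face A u) = shape 2 (face B u) ∨
      shape 2 (face A u) = -shape 2 (face B u) := by
    intro u hu
    obtain ⟨x, hx, hxu⟩ := exists_nullSpan_nudge_eq hD (N := nullSpan D' u)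
      (span_mono fun d hd => ⟨hd.1.1, subset_span hd⟩)
    have hface : ∀ S, IsVertexSet D S → IsVertexSet D' S → face S (nudge D u x) = face S u :=
      fun S hS hS' => by
        rw [face_nudge hD hS.adapted]
        exact face_eq_self fun y hy => hx y (vectorSpan_face_le hS'.adapted u hy)
    have := H (nudge D u x) (by rw [hxu u (nullSpan_mem_orthogonal D' u), hu])
    rwa [hface A hA hA', hface B hB hB'] at this
  obtain ⟨s, hs⟩ := hsA.exists_vadd_eq_neg
  obtain ⟨t, ht⟩ := hsB.exists_vadd_eq_neg
  refine exists_vadd_eq_of_shape_face_eq hD'fin hA' hB' (r := 2) (by omega) (by omega)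
    (Or.inl ?_) fun a ha => ?_
  · rw [polyDim, ← hspan]
    exact (show 2 ≤ 3 by omega).trans_eq hdA.symm
  · obtain ⟨u, hu, hss⟩ := exists_ray_sameSign (D := D') (a := a) (by rw [ha, h3])
    rw [hss.face_eq hA'.adapted, hss.face_eq hB'.adapted]
    have := shape_face_eq_of_pm_of_eq_neg hD'fin h3 (hA'.vadd s) (hB'.vadd t)
      (by rw [vectorSpan_vadd, hsp]) hs ht
      (fun u hu => by simpa only [face_vadd, shape_vadd] using H' u hu) hu
    simpa only [face_vadd, shape_vadd] using this

/-! ### Centrally symmetric polytopes whose facets agree up to reflection -/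

lemma shape_face_pm_of_self_neg {k : ℕ} {X : Set E} (hX : polyDim X ≤ k + 1)
    (h : shape (k + 1) X = -shape (k + 1) X) (b : E) :
    shape k (face X b) = shape k (face X (-b)) ∨
      shape k (face X b) = -shape k (face X (-b)) := by
  by_cases hd : polyDim X = k + 1
  · right
    rw [(isSymm_of_shape_eq hd h).shape_face_neg, neg_neg]
  · left
    exact (shape_face_neg_eq b hX hd).symm

/-- If all `(k+1)`-dimensional faces are centrally symmetric, then parallel `k`-dimensional faces
are equal up to translations and reflections. -/
lemma shape_face_pm_of_isSymm {D K : Set E} (hD : D.Finite) (hK : IsVertexSet D K) {k : ℕ}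
    (hs : ∀ a, polyDim (face K a) = k + 1 → IsSymm (face K a)) {u v : E}
    (hu : finrank ℝ (nullSpan D u) = k) (huv : nullSpan D v = nullSpan D u) :
    shape k (face K v) = shape k (face K u) ∨ shape k (face K v) = -shape k (face K u) := by
  refine chamber_induction hD (N := nullSpan D u)
    (Q := fun v => shape k (face K v) = shape k (face K u) ∨
      shape k (face K v) = -shape k (face K u)) ?_ ?_ rfl huv (Or.inl rfl)
  · intro v v' hv hQ
    rwa [← hv.face_eq hK.adapted]
  · intro a b _ ha hQ
    simp only [face_nudge hD hK.adapted] at hQ ⊢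
    rw [hu] at ha
    have hle := (polyDim_le_of_adapted hK.adapted a).trans_eq ha
    have hself : shape (k + 1) (face K a) = -shape (k + 1) (face K a) := by
      by_cases hd : polyDim (face K a) = k + 1
      · exact (hs a hd).shape_eq _
      · rw [shape_of_ne hd, Set.neg_empty]
    rcases shape_face_pm_of_self_neg hle hself b with h | h <;> rw [h]
    · exact hQ
    · rw [neg_inj, neg_eq_iff_eq_neg]
      exact hQ.symm

/-- Let the facets of two centrally symmetric polytopes agree up to reflection. Then ridges in which
the polytopes differ are centrally symmetric. -/
lemma shape_face_self_neg_of_ne {D A B : Set E} (hD : D.Finite) (hA : IsVertexSet D A)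
    (hB : IsVertexSet D B) (hsA : IsSymm A) (hsB : IsSymm B) {k : ℕ}
    (H : ∀ u, finrank ℝ (nullSpan D u) = k + 1 →
      shape (k + 1) (face A u) = shape (k + 1) (face B u) ∨
      shape (k + 1) (face A u) = -shape (k + 1) (face B u))
    {w : E} (hw : finrank ℝ (nullSpan D w) = k)
    (hne : shape k (face A w) ≠ shape k (face B w)) :
    shape k (face A w) = -shape k (face A w) ∧ shape k (face B w) = -shape k (face B w) := by
  set X := shape k (face A w) with hX
  set Y := shape k (face B w) with hY
  have key : (shape k (face A (-w)) = X ∧ shape k (face B (-w)) = Y) ∨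
      (shape k (face A (-w)) = -Y ∧ shape k (face B (-w)) = -X) := by
    refine chamber_induction hD (N := nullSpan D w)
      (Q := fun v => (shape k (face A v) = X ∧ shape k (face B v) = Y) ∨
        (shape k (face A v) = -Y ∧ shape k (face B v) = -X)) ?_ ?_ rfl (nullSpan_neg D w)
      (Or.inl ⟨rfl, rfl⟩)
    · intro v v' hv hQ
      rwa [← hv.face_eq hA.adapted, ← hv.face_eq hB.adapted]
    · intro a b _ ha hQ
      simp only [face_nudge hD hA.adapted, face_nudge hD hB.adapted] at hQ ⊢
      rw [hw] at ha
      have hAle := (polyDim_le_of_adapted hA.adapted a).trans_eq ha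
      have hBle := (polyDim_le_of_adapted hB.adapted a).trans_eq ha
      by_cases hdA : polyDim (face A a) = k + 1
      · rcases H a ha with h | h
        · exfalso
          have := shape_face_eq_of_shape_eq hdA h k (-b)
          rcases hQ with hQ | hQ <;> rw [hQ.1, hQ.2] at this
          · exact hne this
          · exact hne (neg_injective this).symm
        · have h1 := shape_face_eq_of_shape_eq_neg hdA h k b
          have h2 := shape_face_eq_of_shape_eq_neg hdA h k (-b)
          rw [neg_neg, ← neg_eq_iff_eq_neg] at h2
          rw [h1, ← h2]
          rcases hQ with hQ | hQ <;> rw [hQ.1, hQ.2]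
          · exact Or.inr ⟨rfl, rfl⟩
          · left
            simp only [neg_neg, and_self]
      · have hdB : polyDim (face B a) ≠ k + 1 := by
          rw [← shape_eq_empty_iff]
          rcases H a ha with h | h <;> rw [shape_of_ne hdA] at h
          · exact h.symm
          · rw [← neg_neg (shape (k + 1) (face B a)), ← h, Set.neg_empty]
        rwa [← shape_face_neg_eq b hAle hdA, ← shape_face_neg_eq b hBle hdB]
  rw [hsA.shape_face_neg, hsB.shape_face_neg, ← hX, ← hY] at key
  rcases key with h | h
  · exact ⟨h.1.symm, h.2.symm⟩
  · exact absurd (neg_injective h.1) hne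

/-- If each `(k+1)`-dimensional face is either a reflection of the opposite face, or both it and the
opposite face are centrally symmetric, then opposite `k`-dimensional faces agree up to
reflection. -/
lemma shape_face_neg_pm {D F : Set E} (hD : D.Finite) (hF : IsVertexSet D F) {k : ℕ}
    (hG : ∀ w, finrank ℝ (nullSpan D w) = k + 1 →
      shape (k + 1) (face F w) = -shape (k + 1) (face F (-w)) ∨
      (shape (k + 1) (face F w) = -shape (k + 1) (face F w) ∧
        shape (k + 1) (face F (-w)) = -shape (k + 1) (face F (-w))))
    {v : E} (hv : finrank ℝ (nullSpan D v) = k) :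
    shape k (face F v) = shape k (face F (-v)) ∨ shape k (face F v) = -shape k (face F (-v)) := by
  by_contra hcon
  set x := shape k (face F v) with hx
  set y := shape k (face F (-v)) with hy
  have key : (shape k (face F (-v)) = x ∨ shape k (face F (-v)) = -x) ∧
      (shape k (face F (- -v)) = y ∨ shape k (face F (- -v)) = -y) := by
    refine chamber_induction hD (N := nullSpan D v)
      (Q := fun v' => (shape k (face F v') = x ∨ shape k (face F v') = -x) ∧
        (shape k (face F (-v')) = y ∨ shape k (face F (-v')) = -y)) ?_ ?_ rfl (nullSpan_neg D v)
      ⟨Or.inl rfl, Or.inl rfl⟩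
    · intro v v' hv hQ
      have hv' : SameSign D (-v) (-v') := fun d hd => by
        rw [inner_neg_right, inner_neg_right, Left.sign_neg, Left.sign_neg, hv d hd]
      rwa [← hv.face_eq hF.adapted, ← hv'.face_eq hF.adapted]
    · intro a b _ ha hQ
      have hn1 := (nudge_neg_sameSign hD a b).face_eq hF.adapted
      have hn2 := (nudge_neg_sameSign hD a (-b)).face_eq hF.adapted
      rw [neg_neg] at hn2
      simp only [← hn1, ← hn2, face_nudge hD hF.adapted] at hQ ⊢
      rw [hv] at ha
      have hle := (polyDim_le_of_adapted hF.adapted a).trans_eq ha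
      have hle' := (polyDim_le_of_adapted hF.adapted (-a)).trans_eq ((nullSpan_neg D a).symm ▸ ha)
      -- otherwise the two current faces would agree up to sign, and so would the initial ones
      have hself : shape (k + 1) (face F a) = -shape (k + 1) (face F a) ∧
          shape (k + 1) (face F (-a)) = -shape (k + 1) (face F (-a)) := by
        rcases hG a ha with h | h
        · by_cases hd : polyDim (face F a) = k + 1
          · exfalso
            have h1 := shape_face_eq_of_shape_eq_neg hd h k (-b)
            rw [neg_neg] at h1
            apply hcon
            rcases hQ with ⟨h2 | h2, h3 | h3⟩ <;> rw [h2, h3] at h1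
            · exact Or.inr h1
            · exact Or.inl (by rw [h1, neg_neg])
            · exact Or.inl (neg_injective h1)
            · exact Or.inr (neg_injective h1)
          · rw [shape_of_ne hd] at h ⊢
            rw [← neg_neg (shape (k + 1) (face F (-a))), ← h]
            simp
        · exact h
      have h1 := shape_face_pm_of_self_neg hle hself.1 b
      have h2 := shape_face_pm_of_self_neg hle' hself.2 (-b)
      rw [neg_neg] at h2
      constructor
      · rcases h1 with h | h <;> rw [h]
        · exact hQ.1
        · rw [neg_inj, neg_eq_iff_eq_neg]
          exact hQ.1.symm
      · rcases h2 with h | h <;> rw [h]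
        · exact hQ.2
        · rw [neg_inj, neg_eq_iff_eq_neg]
          exact hQ.2.symm
  apply hcon
  rcases key.1 with h | h
  · exact Or.inl (by rw [← h])
  · exact Or.inr (by rw [hy, h, neg_neg])

lemma vectorSpan_le_of_facets_pm {D A B : Set E} (hD : D.Finite) (hA : IsVertexSet D A)
    (hB : IsVertexSet D B) {k : ℕ} (hk : 1 ≤ k) (hdA : polyDim A = k + 1)
    (H : ∀ u, finrank ℝ (nullSpan D u) = k → shape k (face A u) = shape k (face B u) ∨
      shape k (face A u) = -shape k (face B u)) : vectorSpan ℝ A ≤ vectorSpan ℝ B := by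
  refine vectorSpan_le_of_faces hD hA hk (by omega) fun u hu huN hd => huN ?_
  have hdB : polyDim (face B u) = k := by
    rw [← shape_nonempty_iff] at hd ⊢
    rcases H u hu with h | h <;> rw [h] at hd
    · exact hd
    · exact Set.nonempty_neg.1 hd
  rw [← vectorSpan_face_eq hB.adapted (hdB.trans hu.symm)]
  exact vectorSpan_mono ℝ (face_subset B u)

/-- Two centrally symmetric polytopes whose facets agree up to translations and reflections are
translates of each other. The induction goes down by two dimensions: a ridge in which the polytopes
differ is centrally symmetric in both of them, and its facets again agree up to reflection. -/
theorem exists_vadd_eq_of_facets_pm (d : ℕ) (hd : 2 ≤ d) : ∀ {D A B : Set E}, D.Finite →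
    IsVertexSet D A → IsVertexSet D B → polyDim A = d → polyDim B ≤ d → IsSymm A →
    (polyDim B = d → IsSymm B) →
    (∀ u, finrank ℝ (nullSpan D u) = d - 1 →
      shape (d - 1) (face A u) = shape (d - 1) (face B u) ∨
      shape (d - 1) (face A u) = -shape (d - 1) (face B u)) → ∃ t : E, B = t +ᵥ A := by
  induction d using Nat.strong_induction_on with
  | _ d ih =>
  intro D A B hD hA hB hdA hdB hsA hsB H
  have hle := vectorSpan_le_of_facets_pm hD hA hB (k := d - 1) (by omega) (by omega) H
  have hspan : vectorSpan ℝ A = vectorSpan ℝ B :=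
    Submodule.eq_of_le_of_finrank_le hle (hdB.trans hdA.ge)
  replace hdB : polyDim B = d := by rw [polyDim, ← hspan]; exact hdA
  replace hsB := hsB hdB
  by_cases hd3 : d = 3
  · subst hd3
    exact exists_vadd_eq_of_facets_dim_three hD hA hB hdA hspan hsA hsB H
  by_contra hne
  -- a facet in which the two polytopes differ
  obtain ⟨u, hu, hune⟩ : ∃ u, finrank ℝ (nullSpan D u) = d - 1 ∧
      shape (d - 1) (face A u) ≠ shape (d - 1) (face B u) := by
    by_contra! h
    exact hne (exists_vadd_eq_of_shape_face_eq hD hA hB (r := d - 1) (by omega) (by omega)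
      (Or.inl (by omega)) h)
  have hneg := (H u hu).resolve_left hune
  have hdF : polyDim (face A u) = d - 1 := by
    by_contra h
    rw [shape_of_ne h] at hneg hune
    rw [← neg_neg (shape (d - 1) (face B u)), ← hneg] at hune
    simp at hune
  rcases (show d = 2 ∨ 4 ≤ d by omega) with rfl | hd4
  · have := ((hA.face u).isSymm_of_polyDim_one hdF).shape_eq 1
    rw [show 2 - 1 = 1 from rfl] at hneg hune
    rw [hneg, neg_inj, ← hneg] at this
    exact hune this.symm
  obtain ⟨k, rfl⟩ : ∃ k, d = k + 3 := ⟨d - 3, by omega⟩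
  simp only [show k + 3 - 1 = k + 2 from rfl] at *
  set F := face A u with hFdef
  have hDu : {d | d ∈ D ∧ ⟪d, u⟫ = 0}.Finite := hD.subset fun d hd => hd.1
  set Du := {d | d ∈ D ∧ ⟪d, u⟫ = 0} with hDudef
  have hF : IsVertexSet Du F := hA.face_null u
  have hG : ∀ w, finrank ℝ (nullSpan Du w) = k + 1 →
      shape (k + 1) (face F w) = -shape (k + 1) (face F (-w)) ∨
      (shape (k + 1) (face F w) = -shape (k + 1) (face F w) ∧
        shape (k + 1) (face F (-w)) = -shape (k + 1) (face F (-w))) := by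
    intro w hw
    have hBw : shape (k + 1) (face (face B u) w) = -shape (k + 1) (face F (-w)) := by
      rw [shape_face_eq_of_shape_eq_neg hdF hneg, neg_neg, neg_neg]
    by_cases h : shape (k + 1) (face F w) = -shape (k + 1) (face F (-w))
    · exact Or.inl h
    · right
      have h1 := shape_face_self_neg_of_ne hD hA hB hsA hsB (k := k + 1) H
        (w := nudge D u w) (by rw [nullSpan_nudge hD]; exact hw)
        (by rw [face_nudge hD hA.adapted, face_nudge hD hB.adapted, hBw]; exact h)
      rw [face_nudge hD hA.adapted, face_nudge hD hB.adapted, hBw, neg_inj] at h1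
      exact h1
  have hpm := fun v hv => shape_face_neg_pm hDu hF (k := k) hG (v := v) hv
  -- a ridge in that facet which is not the reflection of the opposite one
  obtain ⟨w, hw, hwd, hwne⟩ : ∃ w, finrank ℝ (nullSpan Du w) = k + 1 ∧
      polyDim (face F w) = k + 1 ∧
      shape (k + 1) (face F w) ≠ -shape (k + 1) (face F (-w)) := by
    have h1 : ∃ w, finrank ℝ (nullSpan Du w) = k + 1 ∧
        shape (k + 1) (face F w) ≠ -shape (k + 1) (face F (-w)) := by
      by_contra! h
      obtain ⟨t, ht⟩ := exists_vadd_eq_of_shape_face_eq hDu hF hF.neg (r := k + 1) (by omega)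
        (by omega) (Or.inl (by rw [polyDim_neg]; omega))
        (fun w hw => by rw [face_neg, shape_neg]; exact h w hw)
      apply hune
      rw [← neg_neg (shape (k + 2) (face B u)), ← hneg, ← shape_neg, ht, shape_vadd]
    obtain ⟨w, hw, hwne⟩ := h1
    by_cases hd : polyDim (face F w) = k + 1
    · exact ⟨w, hw, hd, hwne⟩
    · refine ⟨-w, by rwa [nullSpan_neg], ?_, ?_⟩
      · by_contra hd'
        rw [shape_of_ne hd, shape_of_ne hd', Set.neg_empty] at hwne
        exact hwne rfl
      · rw [neg_neg]
        intro h
        exact hwne (by rw [h, neg_neg])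
  have hself := (hG w hw).resolve_left hwne
  have hnull : {d | d ∈ Du ∧ ⟪d, -w⟫ = 0} = {d | d ∈ Du ∧ ⟪d, w⟫ = 0} := by
    simp only [inner_neg_right, neg_eq_zero]
  have hJ' : IsVertexSet {d | d ∈ Du ∧ ⟪d, w⟫ = 0} (-face F (-w)) :=
    hnull ▸ (hF.face_null (-w)).neg
  have hdJ' : polyDim (-face F (-w)) ≤ k + 1 := by
    rw [polyDim_neg, ← hw, ← nullSpan_neg]
    exact polyDim_le_of_adapted hF.adapted (-w)
  obtain ⟨t, ht⟩ := ih (k + 1) (by omega) (by omega) (hDu.subset fun d hd => hd.1)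
    (hF.face_null w) hJ' hwd hdJ' (isSymm_of_shape_eq hwd hself.1)
    (fun h => (isSymm_of_shape_eq (by rwa [polyDim_neg] at h) hself.2).neg) (by
      intro v hv
      rw [Nat.add_sub_cancel] at hv ⊢
      have h1 := hpm (nudge Du w v) (by rw [nullSpan_nudge hDu]; exact hv)
      rw [← (nudge_neg_sameSign hDu w v).face_eq hF.adapted, face_nudge hDu hF.adapted,
        face_nudge hDu hF.adapted] at h1
      rw [face_neg, shape_neg, neg_neg]
      exact h1.symm)
  apply hwne
  rw [← shape_neg, ht, shape_vadd]

/-- A polytope of dimension at least three with centrally symmetric facets is centrally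
symmetric. -/
theorem isSymm_of_facets {D K : Set E} (hD : D.Finite) (hK : IsVertexSet D K) {d : ℕ} (hd : 2 ≤ d)
    (hdK : polyDim K = d + 1) (hs : ∀ u, polyDim (face K u) = d → IsSymm (face K u)) :
    IsSymm K := by
  -- opposite facets are translates of each other
  have key : ∀ u, finrank ℝ (nullSpan D u) = d → polyDim (face K u) = d →
      ∃ t : E, face K (-u) = t +ᵥ face K u := by
    intro u hu hdu
    have hnull : {d | d ∈ D ∧ ⟪d, -u⟫ = 0} = {d | d ∈ D ∧ ⟪d, u⟫ = 0} := by
      simp only [inner_neg_right, neg_eq_zero]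
    refine exists_vadd_eq_of_facets_pm d hd (hD.subset fun d hd => hd.1) (hK.face_null u)
      (hnull ▸ hK.face_null (-u)) hdu ?_ (hs u hdu) (hs (-u)) ?_
    · rw [← hu, ← nullSpan_neg]
      exact polyDim_le_of_adapted hK.adapted (-u)
    · intro w hw
      rw [← face_nudge hD hK.adapted, ← face_nudge hD hK.adapted]
      refine shape_face_pm_of_isSymm hD hK (k := d - 1) (fun a ha => hs a (by omega)) ?_ ?_
      · rw [nullSpan_nudge hD, hnull, hw]
      · rw [nullSpan_nudge hD, nullSpan_nudge hD, hnull]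
  obtain ⟨t, ht⟩ := exists_vadd_eq_of_shape_face_eq hD hK hK.neg (r := d) (by omega) (by omega)
    (Or.inl (by rw [polyDim_neg]; omega)) (by
      intro u hu
      rw [face_neg, shape_neg]
      by_cases hdu : polyDim (face K u) = d
      · obtain ⟨t, ht⟩ := key u hu hdu
        rw [ht, shape_vadd]
        exact (hs u hdu).shape_eq d
      · have hdu' : polyDim (face K (-u)) ≠ d := by
          intro h
          obtain ⟨t, ht⟩ := key (-u) (by rwa [nullSpan_neg]) h
          rw [neg_neg] at ht
          exact hdu (by rw [ht, polyDim_vadd, h])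
        rw [shape_of_ne hdu, shape_of_ne hdu', Set.neg_empty])
  exact ⟨-t, by rw [ht, vadd_vadd, neg_add_cancel, zero_vadd]⟩

/-! ### The Sylvester–Gallai theorem -/

/-- Among three distinct points of a line, two lie on the same side of a given point `t₀`. -/
lemma exists_same_side {t t₀ : ℝ} (h0 : t ≠ 0) (h1 : t ≠ 1) :
    ∃ x ∈ ({0, 1, t} : Set ℝ), ∃ y ∈ ({0, 1, t} : Set ℝ), x ≠ y ∧ (x - y) ^ 2 ≤ (t₀ - y) ^ 2 := by
  have key : ∀ x y : ℝ, 0 ≤ (x - t₀) * (y - t₀) → (x - y) ^ 2 ≤ (t₀ - y) ^ 2 ∨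
      (y - x) ^ 2 ≤ (t₀ - x) ^ 2 := by
    intro x y h
    rcases le_total ((x - t₀) ^ 2) ((y - t₀) ^ 2) with h' | h'
    · left; nlinarith
    · right; nlinarith
  have hpair : ∀ x ∈ ({0, 1, t} : Set ℝ), ∀ y ∈ ({0, 1, t} : Set ℝ), x ≠ y →
      0 ≤ (x - t₀) * (y - t₀) → ∃ x ∈ ({0, 1, t} : Set ℝ), ∃ y ∈ ({0, 1, t} : Set ℝ),
        x ≠ y ∧ (x - y) ^ 2 ≤ (t₀ - y) ^ 2 := by
    intro x hx y hy hxy h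
    rcases key x y h with h | h
    · exact ⟨x, hx, y, hy, hxy, h⟩
    · exact ⟨y, hy, x, hx, hxy.symm, h⟩
  by_cases ha : 0 ≤ (0 - t₀) * (1 - t₀)
  · exact hpair 0 (by simp) 1 (by simp) zero_ne_one ha
  by_cases hb : 0 ≤ (0 - t₀) * (t - t₀)
  · exact hpair 0 (by simp) t (by simp) h0.symm hb
  · refine hpair 1 (by simp) t (by simp) h1.symm ?_
    push Not at ha hb
    have h2 := mul_pos_of_neg_of_neg ha hb
    by_contra! hc
    nlinarith [sq_nonneg (0 - t₀)]

omit [FiniteDimensional ℝ E] in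
/-- **Sylvester–Gallai theorem**: if the line through any two points of a finite set contains a
third point of the set, then all points lie on a line. (Kelly's proof: otherwise consider a point
and a line through two points at the smallest positive distance.) -/
theorem sylvester_gallai {T : Set E} (hT : T.Finite)
    (h : ∀ p ∈ T, ∀ q ∈ T, p ≠ q → ∃ t : ℝ, t ≠ 0 ∧ t ≠ 1 ∧ p + t • (q - p) ∈ T) :
    ∀ p ∈ T, ∀ q ∈ T, ∀ r ∈ T, p ≠ q → ∃ t : ℝ, r = p + t • (q - p) := by
  by_contra! hcon
  obtain ⟨p₀, hp₀, q₀, hq₀, r₀, hr₀, hpq₀, hbad₀⟩ := hcon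
  set Bad : Set (E × E × E) := {x | (x.1 ∈ T ∧ x.2.1 ∈ T ∧ x.2.2 ∈ T) ∧ x.1 ≠ x.2.1 ∧
    ∀ t : ℝ, x.2.2 ≠ x.1 + t • (x.2.1 - x.1)} with hBad
  have hfin : Bad.Finite := (hT.prod (hT.prod hT)).subset fun x hx => ⟨hx.1.1, hx.1.2.1, hx.1.2.2⟩
  -- the squared distance of `x.2.2` from the line through `x.1` and `x.2.1`
  set F : E × E × E → ℝ := fun x => ⟪x.2.2 - x.1, x.2.2 - x.1⟫ -
    ⟪x.2.2 - x.1, x.2.1 - x.1⟫ ^ 2 / ⟪x.2.1 - x.1, x.2.1 - x.1⟫ with hF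
  obtain ⟨⟨p, q, r⟩, ⟨⟨hp, hq, hr⟩, hpq, hbad⟩, hmin⟩ :=
    Set.exists_min_image Bad F hfin ⟨(p₀, q₀, r₀), ⟨hp₀, hq₀, hr₀⟩, hpq₀, hbad₀⟩
  simp only at hp hq hr hpq hbad
  obtain ⟨t, ht0, ht1, ht⟩ := h p hp q hq hpq
  set e := q - p with he
  have he0 : e ≠ 0 := sub_ne_zero.2 hpq.symm
  have hee : 0 < ⟪e, e⟫ := real_inner_self_pos.2 he0
  -- `p + t₀ • e` is the foot of the perpendicular from `r`
  set t₀ := ⟪r - p, e⟫ / ⟪e, e⟫ with ht₀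
  set n := r - p - t₀ • e with hn
  have hne : ⟪n, e⟫ = 0 := by
    rw [hn, inner_sub_left, real_inner_smul_left, ht₀, div_mul_cancel₀ _ hee.ne', sub_self]
  have hen : ⟪e, n⟫ = 0 := by rw [real_inner_comm, hne]
  have hn0 : 0 < ⟪n, n⟫ := by
    refine real_inner_self_pos.2 fun h0 => hbad t₀ ?_
    rw [hn, sub_eq_zero, sub_eq_iff_eq_add'] at h0
    exact h0
  have hFn : F (p, q, r) = ⟪n, n⟫ := by
    have h1 : r - p = n + t₀ • e := by rw [hn]; abel
    simp only [hF, ← he]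
    rw [h1]
    simp only [inner_add_left, inner_add_right, real_inner_smul_left, real_inner_smul_right, hne,
      hen]
    field_simp
    ring
  obtain ⟨x, hx, y, hy, hxy, hle⟩ := exists_same_side (t₀ := t₀) ht0 ht1
  have hmem : ∀ z ∈ ({0, 1, t} : Set ℝ), p + z • e ∈ T := by
    rintro z (rfl | rfl | rfl)
    · simpa using hp
    · simpa [he] using hq
    · exact ht
  have hre : r - (p + y • e) = n + (t₀ - y) • e := by rw [hn]; module
  have hxe : p + x • e - (p + y • e) = (x - y) • e := by module
  have hB : (p + y • e, r, p + x • e) ∈ Bad := by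
    refine ⟨⟨hmem y hy, hr, hmem x hx⟩, fun h0 => hbad y h0.symm, fun s hs => ?_⟩
    simp only at hs
    have hs' : s • (r - (p + y • e)) = (x - y) • e := by
      rw [← hxe, hs]
      abel
    have hs0 : s ≠ 0 := by
      rintro rfl
      rw [zero_smul, eq_comm, smul_eq_zero, sub_eq_zero] at hs'
      exact hs'.elim hxy he0
    have h2 : r - (p + y • e) = (s⁻¹ * (x - y)) • e := by
      rw [mul_smul, ← hs', smul_smul, inv_mul_cancel₀ hs0, one_smul]
    refine hbad (y + s⁻¹ * (x - y)) ?_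
    rw [add_smul, ← add_assoc, ← h2]
    abel
  have hlt : F (p + y • e, r, p + x • e) < ⟪n, n⟫ := by
    simp only [hF]
    rw [hre, hxe]
    simp only [inner_add_left, inner_add_right, real_inner_smul_left, real_inner_smul_right, hne,
      hen]
    have hden : 0 < ⟪n, n⟫ + (t₀ - y) * ((t₀ - y) * ⟪e, e⟫) := by
      nlinarith [mul_nonneg (sq_nonneg (t₀ - y)) hee.le]
    have h3 : (x - y) * ((x - y) * ⟪e, e⟫) -
        ((x - y) * (0 + (t₀ - y) * ⟪e, e⟫)) ^ 2 / (⟪n, n⟫ + (t₀ - y) * ((t₀ - y) * ⟪e, e⟫)) =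
        (x - y) ^ 2 * ⟪e, e⟫ * ⟪n, n⟫ / (⟪n, n⟫ + (t₀ - y) * ((t₀ - y) * ⟪e, e⟫)) := by
      field_simp
      ring
    have h4 : (x - y) ^ 2 * ⟪e, e⟫ * ⟪n, n⟫ / (⟪n, n⟫ + (t₀ - y) * ((t₀ - y) * ⟪e, e⟫)) <
        ⟪n, n⟫ := by
      rw [div_lt_iff₀ hden]
      nlinarith [mul_le_mul_of_nonneg_right hle (mul_pos hee hn0).le, mul_pos hn0 hn0]
    convert h4 using 1
    rw [← h3]
    ring
  exact absurd (hmin _ hB) (not_le.2 (by rw [hFn]; exact hlt))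

/-! ### Descending to faces of smaller dimension -/

/-- The flat `Y` through `N` is a proper wall: the polytope has a face parallel to `Y`, of dimension
one larger than that of `N`. -/
structure IsWall (D S : Set E) (N Y : Submodule ℝ E) : Prop where
  le : N ≤ Y
  finrank_eq : finrank ℝ Y = finrank ℝ N + 1
  exists_face : ∃ a, nullSpan D a = Y ∧ polyDim (face S a) = finrank ℝ Y

lemma mem_sup_span_singleton_iff {M : Submodule ℝ E} {x y : E} :
    x ∈ M ⊔ span ℝ {y} ↔ ∃ c : ℝ, x - c • y ∈ M := by
  rw [Submodule.mem_sup]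
  constructor
  · rintro ⟨m, hm, z, hz, rfl⟩
    obtain ⟨c, rfl⟩ := mem_span_singleton.1 hz
    exact ⟨c, by rwa [add_sub_cancel_right]⟩
  · rintro ⟨c, hc⟩
    exact ⟨_, hc, _, smul_mem _ c (mem_span_singleton_self y), by abel⟩

lemma IsWall.exists_mem {D S : Set E} {N Y : Submodule ℝ E} (h : IsWall D S N Y) :
    ∃ y ∈ D, y ∉ N ∧ Y = N ⊔ span ℝ {y} := by
  obtain ⟨a, ha, -⟩ := h.exists_face
  have hf := h.finrank_eq
  obtain ⟨y, hyD, hya, hyN⟩ : ∃ y ∈ D, ⟪y, a⟫ = 0 ∧ y ∉ N := by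
    by_contra! hcon
    have hle : Y ≤ N := by
      rw [← ha]
      exact span_le.2 fun d hd => hcon d hd.1 hd.2
    have := Submodule.finrank_mono hle
    omega
  refine ⟨y, hyD, hyN, (Submodule.eq_of_le_of_finrank_eq (sup_le h.le ?_) ?_).symm⟩
  · rw [span_singleton_le_iff_mem, ← ha]
    exact subset_span ⟨hyD, hya⟩
  · rw [finrank_sup_span_singleton hyN, hf]

lemma IsWall.eq_sup_of_mem {D S : Set E} {N Y : Submodule ℝ E} (h : IsWall D S N Y) {y : E}
    (hy : y ∈ Y) (hyN : y ∉ N) : Y = N ⊔ span ℝ {y} := by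
  refine (Submodule.eq_of_le_of_finrank_eq
    (sup_le h.le ((span_singleton_le_iff_mem _ _).2 hy)) ?_).symm
  rw [finrank_sup_span_singleton hyN, h.finrank_eq]

lemma IsWall.le_span {D S : Set E} {N Y : Submodule ℝ E} (h : IsWall D S N Y) :
    Y ≤ span ℝ {d | d ∈ D ∧ d ∈ Y} := by
  obtain ⟨a, ha, -⟩ := h.exists_face
  conv_lhs => rw [← ha]
  exact span_mono fun d hd => ⟨hd.1, by rw [← ha]; exact subset_span hd⟩

section Descent

variable {D S : Set E} (hD : D.Finite) (hS : IsVertexSet D S) {k : ℕ}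
  (hs₁ : ∀ a, polyDim (face S a) = k + 1 → IsSymm (face S a))
  (hs₂ : ∀ a, polyDim (face S a) = k + 2 → IsSymm (face S a))
  {N : Submodule ℝ E} (hNk : finrank ℝ N = k)

include hD hS hs₂ hNk

lemma IsWall.polyDim_face {Y : Submodule ℝ E} (h : IsWall D S N Y) {a : E}
    (ha : nullSpan D a = Y) : polyDim (face S a) = k + 1 := by
  obtain ⟨b, hb, hbd⟩ := h.exists_face
  have hf := h.finrank_eq
  have h1 := shape_face_pm_of_isSymm hD hS (k := k + 1) hs₂ (u := b) (v := a)
    (by rw [hb, hf, hNk]) (by rw [ha, hb])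
  have h2 : polyDim (face S b) = k + 1 := by omega
  rw [← shape_nonempty_iff] at h2 ⊢
  rcases h1 with h1 | h1 <;> rw [h1]
  · exact h2
  · exact Set.nonempty_neg.2 h2

include hs₁

/-- If the faces parallel to `N` are not centrally symmetric, then any two walls span a third one.
Otherwise consider the centrally symmetric face parallel to the span of the two walls. Its faces
parallel to `N` get reflected exactly when one of the two walls is crossed, and on the way to the
opposite face both walls are crossed. -/
lemma exists_third_wall (hns : ∀ v, nullSpan D v = N → polyDim (face S v) = k ∧
      ¬ IsSymm (face S v))
    {Y₁ Y₂ : Submodule ℝ E} (h₁ : IsWall D S N Y₁) (h₂ : IsWall D S N Y₂) (hne : Y₁ ≠ Y₂)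
    (hNs : N ≤ span ℝ {d | d ∈ D ∧ d ∈ N}) :
    ∃ Y₃, IsWall D S N Y₃ ∧ Y₃ ≠ Y₁ ∧ Y₃ ≠ Y₂ ∧ Y₃ ≤ Y₁ ⊔ Y₂ := by
  by_contra! hcon
  obtain ⟨y₁, hy₁D, hy₁N, hY₁⟩ := h₁.exists_mem
  obtain ⟨y₂, hy₂D, hy₂N, hY₂⟩ := h₂.exists_mem
  have hy₁ : y₁ ∈ Y₁ := hY₁ ▸ mem_sup_right (mem_span_singleton_self y₁)
  have hy₂ : y₂ ∈ Y₂ := hY₂ ▸ mem_sup_right (mem_span_singleton_self y₂)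
  have hy₂₁ : y₂ ∉ Y₁ := fun h => hne (by rw [h₁.eq_sup_of_mem h hy₂N, hY₂])
  have hy₁₂ : y₁ ∉ Y₂ := fun h => hne (by rw [h₂.eq_sup_of_mem h hy₁N, hY₁])
  have hM : finrank ℝ ↥(Y₁ ⊔ Y₂) = k + 2 := by
    have h3 : Y₁ ⊔ Y₂ = Y₁ ⊔ span ℝ {y₂} := by
      conv_lhs => rw [hY₂, ← sup_assoc, sup_eq_left.2 h₁.le]
    rw [h3, finrank_sup_span_singleton hy₂₁, h₁.finrank_eq, hNk]
  obtain ⟨x, hx, hxa⟩ := exists_nullSpan_nudge_eq hD (N := Y₁ ⊔ Y₂)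
    (sup_le (h₁.le_span.trans (span_mono fun d hd => ⟨hd.1, mem_sup_left hd.2⟩))
      (h₂.le_span.trans (span_mono fun d hd => ⟨hd.1, mem_sup_right hd.2⟩)))
  obtain ⟨a, ha⟩ : ∃ a, nullSpan D a = Y₁ ⊔ Y₂ := ⟨_, hxa 0 (zero_mem _)⟩
  have haM : a ∈ (Y₁ ⊔ Y₂)ᗮ := ha ▸ nullSpan_mem_orthogonal D a
  set Da := {d | d ∈ D ∧ ⟪d, a⟫ = 0} with hDa
  have hDafin : Da.Finite := hD.subset fun d hd => hd.1
  set G := face S a with hGdef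
  have hG : IsVertexSet Da G := hS.face_null a
  -- the face `G` has facets parallel to both walls
  have hGle : ∀ Y, IsWall D S N Y → Y ≤ Y₁ ⊔ Y₂ → Y ≤ vectorSpan ℝ G := by
    intro Y hY hle
    obtain ⟨b, -, hb⟩ := exists_nullSpan_nudge_eq hD hY.le_span
    have hb' := hb a (orthogonal_le hle haM)
    have hd := hY.polyDim_face hD hS hs₂ hNk hb'
    have := vectorSpan_face_eq hS.adapted (u := nudge D a b)
      (by rw [hd, hb', hY.finrank_eq, hNk])
    rw [← hb', ← this, face_nudge hD hS.adapted]
    exact vectorSpan_mono ℝ (face_subset _ _)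
  have hGd : polyDim G = k + 2 := by
    refine le_antisymm ((polyDim_le_of_adapted hS.adapted a).trans_eq (by rw [ha, hM])) ?_
    rw [← hM]
    exact Submodule.finrank_mono (sup_le (hGle Y₁ h₁ le_sup_left) (hGle Y₂ h₂ le_sup_right))
  have hGs := hs₂ a hGd
  have hface : ∀ v, nullSpan Da v = N → polyDim (face G v) = k ∧ ¬ IsSymm (face G v) := by
    intro v hv
    rw [hGdef, ← face_nudge hD hS.adapted]
    exact hns _ (by rw [nullSpan_nudge hD]; exact hv)
  obtain ⟨v₀, hv₀⟩ : ∃ v, nullSpan Da v = N := by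
    obtain ⟨b, -, hb⟩ := exists_nullSpan_nudge_eq hD hNs
    refine ⟨b, ?_⟩
    rw [← hb a (orthogonal_le (h₁.le.trans le_sup_left) haM), nullSpan_nudge hD]
  have hy₁a : y₁ ∈ Da := ⟨hy₁D, inner_eq_zero_of_mem_nullSpan (ha ▸ mem_sup_left hy₁)⟩
  have hy₂a : y₂ ∈ Da := ⟨hy₂D, inner_eq_zero_of_mem_nullSpan (ha ▸ mem_sup_right hy₂)⟩
  set s : E → SignType := fun v => SignType.sign ⟪y₁, v⟫ * SignType.sign ⟪y₂, v⟫ with hsdef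
  set ρ := shape k (face G v₀) with hρ
  have key : (shape k (face G (-v₀)) = ρ ∧ s (-v₀) = s v₀) ∨
      (shape k (face G (-v₀)) = -ρ ∧ s (-v₀) = -s v₀) := by
    refine chamber_induction hDafin (N := N) (Q := fun v =>
      (shape k (face G v) = ρ ∧ s v = s v₀) ∨ (shape k (face G v) = -ρ ∧ s v = -s v₀))
      ?_ ?_ hv₀ ((nullSpan_neg Da v₀).trans hv₀) (Or.inl ⟨rfl, rfl⟩)
    · intro v v' hv hQ
      have : s v' = s v := by simp only [hsdef, hv y₁ hy₁a, hv y₂ hy₂a]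
      rwa [this, ← hv.face_eq hG.adapted]
    · intro a' b hab ha' hQ
      have hle : nullSpan Da a' ≤ Y₁ ⊔ Y₂ := by
        rw [← ha]
        exact span_mono fun d hd => hd.1
      have hNa' : N ≤ nullSpan Da a' := hab ▸ nullSpan_nudge_le hDafin a' b
      have hfaceb : face G (nudge Da a' b) = face (face G a') b := face_nudge hDafin hG.adapted _ _
      have hfaceb' : face G (nudge Da a' (-b)) = face (face G a') (-b) :=
        face_nudge hDafin hG.adapted _ _
      have hin : ∀ y ∈ Da, y ∈ nullSpan Da a' → ∀ c,
          SignType.sign ⟪y, nudge Da a' c⟫ = SignType.sign ⟪y, c⟫ := fun y hy hy' c =>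
        sign_nudge_of_eq hDafin hy (inner_eq_zero_of_mem_nullSpan hy')
      have hout : ∀ y ∈ Da, y ∉ nullSpan Da a' → ∀ c,
          SignType.sign ⟪y, nudge Da a' c⟫ = SignType.sign ⟪y, a'⟫ := fun y hy hy' c =>
        sign_nudge_of_ne hDafin hy fun h => hy' ((mem_nullSpan_iff hy).2 h)
      by_cases hw : IsWall D S N (nullSpan Da a')
      · have hd : polyDim (face G a') = k + 1 := by
          rw [hGdef, ← face_nudge hD hS.adapted]
          exact hw.polyDim_face hD hS hs₂ hNk (nullSpan_nudge hD a a')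
        have hsym : IsSymm (face G a') := by
          rw [hGdef, ← face_nudge hD hS.adapted] at hd ⊢
          exact hs₁ _ hd
        have hsh : shape k (face G (nudge Da a' b)) = -shape k (face G (nudge Da a' (-b))) := by
          rw [hfaceb, hfaceb', hsym.shape_face_neg, neg_neg]
        have hsn : s (nudge Da a' b) = -s (nudge Da a' (-b)) := by
          simp only [hsdef]
          by_cases h1 : nullSpan Da a' = Y₁
          · rw [← h1] at hy₁ hy₂₁
            rw [hin y₁ hy₁a hy₁, hin y₁ hy₁a hy₁, hout y₂ hy₂a hy₂₁, hout y₂ hy₂a hy₂₁,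
              inner_neg_right, Left.sign_neg, neg_mul, neg_neg]
          · have h2 : nullSpan Da a' = Y₂ := by
              by_contra h2
              exact hcon _ hw h1 h2 hle
            rw [← h2] at hy₂ hy₁₂
            rw [hin y₂ hy₂a hy₂, hin y₂ hy₂a hy₂, hout y₁ hy₁a hy₁₂, hout y₁ hy₁a hy₁₂,
              inner_neg_right, Left.sign_neg, mul_neg, neg_neg]
        rw [hsh, hsn, neg_inj, neg_inj]
        rcases hQ with hQ | hQ
        · right; exact hQ
        · left; rw [hQ.1, hQ.2, neg_neg, neg_neg]; exact ⟨rfl, rfl⟩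
      · have hfr : finrank ℝ (nullSpan Da a') = k + 1 := by rw [ha', hNk]
        have hdne : polyDim (face G a') ≠ k + 1 := fun hd => hw ⟨hNa', by rw [hfr, hNk],
          nudge D a a', nullSpan_nudge hD a a', by rw [face_nudge hD hS.adapted, hfr]; exact hd⟩
        have hdle := (polyDim_le_of_adapted hG.adapted a').trans_eq hfr
        have hsh : shape k (face G (nudge Da a' b)) = shape k (face G (nudge Da a' (-b))) := by
          rw [hfaceb, hfaceb', shape_face_neg_eq b hdle hdne]
        have hn₁ : y₁ ∉ nullSpan Da a' := fun h => hw (by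
          have : nullSpan Da a' = Y₁ := by
            rw [hY₁]
            refine (Submodule.eq_of_le_of_finrank_eq
              (sup_le hNa' ((span_singleton_le_iff_mem _ _).2 h)) ?_).symm
            rw [finrank_sup_span_singleton hy₁N, hfr, hNk]
          rw [this]
          exact h₁)
        have hn₂ : y₂ ∉ nullSpan Da a' := fun h => hw (by
          have : nullSpan Da a' = Y₂ := by
            rw [hY₂]
            refine (Submodule.eq_of_le_of_finrank_eq
              (sup_le hNa' ((span_singleton_le_iff_mem _ _).2 h)) ?_).symm
            rw [finrank_sup_span_singleton hy₂N, hfr, hNk]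
          rw [this]
          exact h₂)
        have hsn : s (nudge Da a' b) = s (nudge Da a' (-b)) := by
          simp only [hsdef]
          rw [hout y₁ hy₁a hn₁, hout y₁ hy₁a hn₁, hout y₂ hy₂a hn₂, hout y₂ hy₂a hn₂]
        rwa [hsh, hsn]
  have hsneg : s (-v₀) = s v₀ := by
    simp only [hsdef, inner_neg_right, Left.sign_neg, neg_mul_neg]
  have hs0 : s v₀ ≠ 0 := by
    have h1 : ⟪y₁, v₀⟫ ≠ 0 := fun h => hy₁N (hv₀ ▸ (mem_nullSpan_iff hy₁a).2 h)
    have h2 : ⟪y₂, v₀⟫ ≠ 0 := fun h => hy₂N (hv₀ ▸ (mem_nullSpan_iff hy₂a).2 h)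
    exact mul_ne_zero (sign_ne_zero.2 h1) (sign_ne_zero.2 h2)
  rcases key with h | h
  · have h3 := hGs.shape_face_neg k v₀
    rw [h.1] at h3
    exact (hface v₀ hv₀).2 (isSymm_of_shape_eq (hface v₀ hv₀).1 h3)
  · rw [hsneg] at h
    revert hs0
    have := h.2
    revert this
    generalize s v₀ = σ
    cases σ <;> decide

/-- If the faces parallel to `N` are not centrally symmetric, all walls lie in a space of dimension
at most `dim N + 2`: modulo `N`, they are the points of a Sylvester–Gallai configuration. -/
lemma exists_subspace_of_walls (hns : ∀ v, nullSpan D v = N → polyDim (face S v) = k ∧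
      ¬ IsSymm (face S v)) (hNs : N ≤ span ℝ {d | d ∈ D ∧ d ∈ N}) :
    ∃ H : Submodule ℝ E, finrank ℝ H ≤ k + 2 ∧ N ≤ H ∧ ∀ Y, IsWall D S N Y → Y ≤ H := by
  -- the normal vectors of the walls in `Nᗮ`, normalized by the generic functional `z`
  set π : E → E := fun y => y - N.starProjection y with hπ
  have hπN : ∀ y, y - π y ∈ N := fun y => by
    simp only [hπ, sub_sub_cancel]
    exact Submodule.starProjection_apply_mem _ _
  have hπo : ∀ y, π y ∈ Nᗮ := fun y => Submodule.sub_starProjection_mem_orthogonal y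
  obtain ⟨z, hzN, hz⟩ := exists_generic hD N
  have hπz : ∀ y, ⟪π y, z⟫ = ⟪y, z⟫ := fun y => by
    have := hzN _ (hπN y)
    rw [inner_sub_left] at this
    linarith
  set c : E → ℝ := fun y => ⟪y, z⟫⁻¹ with hc
  set P : Set E := {p | ∃ y ∈ D, y ∉ N ∧ IsWall D S N (N ⊔ span ℝ {y}) ∧ p = c y • π y} with hP
  have hPfin : P.Finite := by
    refine (hD.image fun y => c y • π y).subset ?_
    rintro _ ⟨y, hy, -, -, rfl⟩
    exact ⟨y, hy, rfl⟩
  have hcz : ∀ y ∈ D, y ∉ N → c y * ⟪y, z⟫ = 1 := fun y hy hyN => inv_mul_cancel₀ (hz y hy hyN)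
  have hPN : ∀ p ∈ P, p ∈ Nᗮ ∧ ⟪p, z⟫ = 1 := by
    rintro _ ⟨y, hy, hyN, -, rfl⟩
    exact ⟨smul_mem _ _ (hπo y), by rw [real_inner_smul_left, hπz, hcz y hy hyN]⟩
  -- the wall belonging to a point
  have hspan : ∀ y ∈ D, y ∉ N → N ⊔ span ℝ {c y • π y} = N ⊔ span ℝ {y} := by
    intro y hy hyN
    have hc0 : c y ≠ 0 := left_ne_zero_of_mul_eq_one (hcz y hy hyN)
    apply le_antisymm
    · refine sup_le le_sup_left ((span_singleton_le_iff_mem _ _).2 (smul_mem _ _ ?_))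
      have h1 := sub_mem (mem_sup_right (mem_span_singleton_self y))
        (mem_sup_left (hπN y) : y - π y ∈ N ⊔ span ℝ {y})
      rwa [sub_sub_cancel] at h1
    · refine sup_le le_sup_left ((span_singleton_le_iff_mem _ _).2 ?_)
      have h1 : π y = (c y)⁻¹ • c y • π y := by rw [smul_smul, inv_mul_cancel₀ hc0, one_smul]
      have h2 : π y ∈ N ⊔ span ℝ {c y • π y} :=
        mem_sup_right (mem_span_singleton.2 ⟨_, h1.symm⟩)
      have h3 := add_mem (mem_sup_left (hπN y)) h2
      rwa [sub_add_cancel] at h3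
  have hPY : ∀ p ∈ P, IsWall D S N (N ⊔ span ℝ {p}) := by
    rintro _ ⟨y, hy, hyN, hw, rfl⟩
    rw [hspan y hy hyN]
    exact hw
  have hYP : ∀ Y, IsWall D S N Y → ∃ p ∈ P, Y = N ⊔ span ℝ {p} := by
    intro Y hY
    obtain ⟨y, hy, hyN, rfl⟩ := hY.exists_mem
    exact ⟨_, ⟨y, hy, hyN, hY, rfl⟩, (hspan y hy hyN).symm⟩
  have hNo : ∀ x ∈ N, x ∈ Nᗮ → x = 0 := fun x hx hx' => inner_self_eq_zero.1 (hx' x hx)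
  have hinj : ∀ p ∈ P, ∀ q ∈ P, N ⊔ span ℝ {p} = N ⊔ span ℝ {q} → p = q := by
    intro p hp q hq h
    have h1 : p ∈ N ⊔ span ℝ {q} := h ▸ mem_sup_right (mem_span_singleton_self p)
    obtain ⟨r, hr⟩ := mem_sup_span_singleton_iff.1 h1
    have h2 := hNo _ hr (sub_mem (hPN p hp).1 (smul_mem _ _ (hPN q hq).1))
    have h3 : ⟪p - r • q, z⟫ = 0 := by rw [h2, inner_zero_left]
    rw [inner_sub_left, real_inner_smul_left, (hPN p hp).2, (hPN q hq).2] at h3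
    rw [sub_eq_zero] at h2
    rw [h2, show r = 1 by linarith, one_smul]
  have hline := sylvester_gallai hPfin (by
    intro p hp q hq hpq
    obtain ⟨Y, hY, hYp, hYq, hle⟩ := exists_third_wall hD hS hs₁ hs₂ hNk hns (hPY p hp) (hPY q hq)
      (fun h => hpq (hinj p hp q hq h)) hNs
    obtain ⟨r, hr, rfl⟩ := hYP Y hY
    have h1 : r ∈ (N ⊔ span ℝ {p}) ⊔ span ℝ {q} := by
      have h2 : (N ⊔ span ℝ {p}) ⊔ (N ⊔ span ℝ {q}) = (N ⊔ span ℝ {p}) ⊔ span ℝ {q} := by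
        rw [← sup_assoc, sup_eq_left.2 (le_sup_left : N ≤ N ⊔ span ℝ {p})]
      rw [← h2]
      exact hle (mem_sup_right (mem_span_singleton_self r))
    obtain ⟨t, ht⟩ := mem_sup_span_singleton_iff.1 h1
    obtain ⟨s, hs⟩ := mem_sup_span_singleton_iff.1 ht
    have h2 := hNo _ hs (sub_mem (sub_mem (hPN r hr).1 (smul_mem _ _ (hPN q hq).1))
      (smul_mem _ _ (hPN p hp).1))
    have h3 : ⟪r - t • q - s • p, z⟫ = 0 := by rw [h2, inner_zero_left]
    rw [inner_sub_left, inner_sub_left, real_inner_smul_left, real_inner_smul_left,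
      (hPN p hp).2, (hPN q hq).2, (hPN r hr).2] at h3
    obtain rfl : s = 1 - t := by linarith
    have h4 : r = p + t • (q - p) := by
      rw [sub_sub, sub_eq_zero] at h2
      rw [h2]
      module
    refine ⟨t, ?_, ?_, h4 ▸ hr⟩
    · rintro rfl
      exact hYp (by rw [h4, zero_smul, add_zero])
    · rintro rfl
      exact hYq (by rw [h4, one_smul, add_sub_cancel]))
  by_cases hex : ∃ p ∈ P, ∃ q ∈ P, p ≠ q
  · obtain ⟨p, hp, q, hq, hpq⟩ := hex
    refine ⟨(N ⊔ span ℝ {p}) ⊔ span ℝ {q}, ?_, le_sup_left.trans le_sup_left, ?_⟩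
    · have h1 := Submodule.finrank_add_le_finrank_add_finrank (N ⊔ span ℝ {p}) (span ℝ {q})
      have h2 := Submodule.finrank_add_le_finrank_add_finrank N (span ℝ {p})
      have h3 := finrank_span_le_card ({p} : Set E) (R := ℝ)
      have h4 := finrank_span_le_card ({q} : Set E) (R := ℝ)
      simp only [Set.toFinset_singleton, Finset.card_singleton] at h3 h4
      omega
    · intro Y hY
      obtain ⟨r, hr, rfl⟩ := hYP Y hY
      obtain ⟨t, rfl⟩ := hline p hp q hq r hr hpq
      refine sup_le (le_sup_left.trans le_sup_left) ((span_singleton_le_iff_mem _ _).2 ?_)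
      have hp' : p ∈ (N ⊔ span ℝ {p}) ⊔ span ℝ {q} :=
        mem_sup_left (mem_sup_right (mem_span_singleton_self p))
      exact add_mem hp' (smul_mem _ _
        (sub_mem (mem_sup_right (mem_span_singleton_self q)) hp'))
  · push Not at hex
    by_cases hne : P.Nonempty
    · obtain ⟨p, hp⟩ := hne
      refine ⟨N ⊔ span ℝ {p}, ?_, le_sup_left, fun Y hY => ?_⟩
      · rw [(hPY p hp).finrank_eq]
        omega
      · obtain ⟨r, hr, rfl⟩ := hYP Y hY
        rw [hex p hp r hr]
    · refine ⟨N, by omega, le_rfl, fun Y hY => ?_⟩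
      obtain ⟨r, hr, -⟩ := hYP Y hY
      exact absurd ⟨r, hr⟩ hne

end Descent

/-- If all faces of dimensions `k + 1` and `k + 2` of a polytope of dimension at least `k + 3` are
centrally symmetric, then so are those of dimension `k`. Otherwise some linear functional that is
not constant on the polytope would not change along any wall. -/
theorem isSymm_of_faces_succ {D S : Set E} (hD : D.Finite) (hS : IsVertexSet D S) {k : ℕ}
    (hk : k + 3 ≤ polyDim S) (hs₁ : ∀ a, polyDim (face S a) = k + 1 → IsSymm (face S a))
    (hs₂ : ∀ a, polyDim (face S a) = k + 2 → IsSymm (face S a)) {u : E}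
    (hu : polyDim (face S u) = k) : IsSymm (face S u) := by
  by_contra hns
  set N := vectorSpan ℝ (face S u) with hN
  have hNs : N ≤ span ℝ {d | d ∈ D ∧ d ∈ N} := by
    rw [hN, vectorSpan_def]
    refine span_mono ?_
    rintro _ ⟨x, hx, y, hy, rfl⟩
    exact ⟨hS.adapted x hx.1 y hy.1, vsub_mem_vectorSpan ℝ hx hy⟩
  have huN : u ∈ Nᗮ := fun x hx => inner_eq_zero_of_mem_vectorSpan_face hx
  obtain ⟨x, hx, hxn⟩ := exists_nullSpan_nudge_eq hD hNs
  have hface : face S (nudge D u x) = face S u := by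
    rw [face_nudge hD hS.adapted]
    exact face_eq_self fun y hy => hx y hy
  have hall : ∀ v, nullSpan D v = N → polyDim (face S v) = k ∧ ¬ IsSymm (face S v) := by
    intro v hv
    have h1 := shape_face_pm_of_isSymm hD hS (k := k) hs₁ (u := nudge D u x) (v := v)
      (by rw [hxn u huN]; exact hu) (by rw [hxn u huN, hv])
    rw [hface] at h1
    have h2 : polyDim (face S v) = k := by
      rw [← shape_nonempty_iff] at hu ⊢
      rcases h1 with h1 | h1 <;> rw [h1]
      · exact hu
      · exact Set.nonempty_neg.2 hu
    refine ⟨h2, fun hsym => hns (isSymm_of_shape_eq hu ?_)⟩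
    have h3 := hsym.shape_eq k
    rcases h1 with h1 | h1 <;> rw [h1] at h3
    · exact h3
    · exact neg_injective h3
  obtain ⟨H, hHk, hNH, hH⟩ := exists_subspace_of_walls hD hS hs₁ hs₂ hu hall hNs
  obtain ⟨f, hfS, hfH, hf0⟩ : ∃ f ∈ vectorSpan ℝ S, f ∈ Hᗮ ∧ f ≠ 0 := by
    by_contra! hcon
    have h1 : vectorSpan ℝ S ⊓ Hᗮ = ⊥ := by
      rw [eq_bot_iff]
      intro f hf
      exact (Submodule.mem_bot ℝ).2 (hcon f hf.1 hf.2)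
    have h2 := Submodule.finrank_add_finrank_le_of_disjoint (disjoint_iff.2 h1)
    have h3 := H.finrank_add_finrank_orthogonal
    change k + 3 ≤ finrank ℝ (vectorSpan ℝ S) at hk
    omega
  have hfN : f ∈ Nᗮ := orthogonal_le hNH hfH
  -- `⟪·, f⟫` takes the same value on all faces parallel to `N`
  obtain ⟨p, hp⟩ := face_nonempty hS.finite hS.nonempty (nudge D u x)
  have hconst : ∀ v, nullSpan D v = N → ∀ y ∈ face S v, ⟪y, f⟫ = ⟪p, f⟫ := by
    intro v hv
    refine chamber_induction hD (N := N) (Q := fun v => ∀ y ∈ face S v, ⟪y, f⟫ = ⟪p, f⟫)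
      ?_ ?_ (hxn u huN) hv ?_
    · intro v v' hv hQ
      rwa [← hv.face_eq hS.adapted]
    · intro a b hab ha hQ
      have hNa : N ≤ nullSpan D a := hab ▸ nullSpan_nudge_le hD a b
      have hd := (hall _ ((nullSpan_nudge_neg hD a b).trans hab)).1
      rw [face_nudge hD hS.adapted] at hQ hd ⊢
      have hdle := polyDim_le_of_adapted hS.adapted a
      rw [ha, show finrank ℝ N = k from hu] at hdle
      by_cases hw : polyDim (face S a) = k + 1
      · have hle : nullSpan D a ≤ H :=
          hH _ ⟨hNa, ha, a, rfl, by rw [hw, ha]; exact congrArg _ hu.symm⟩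
        obtain ⟨q, hq⟩ := face_nonempty (hS.face a).finite (hS.face a).nonempty (-b)
        intro y hy
        rw [← hQ q hq, ← sub_eq_zero, ← inner_sub_left]
        exact hfH _ (hle (vectorSpan_face_le hS.adapted a (vsub_mem_vectorSpan ℝ hy.1 hq.1)))
      · rwa [face_neg_eq_of_polyDim hdle hw hd]
    · intro y hy
      rw [hface] at hy hp
      rw [← sub_eq_zero, ← inner_sub_left]
      exact hfN _ (vsub_mem_vectorSpan ℝ hy hp)
  -- in particular its maximum and its minimum agree
  have hmax : ∀ g ∈ Nᗮ, ∃ y ∈ face S g, ⟪y, f⟫ = ⟪p, f⟫ := by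
    intro g hg
    obtain ⟨y, hy⟩ := face_nonempty hS.finite hS.nonempty (nudge D g x)
    have := hconst _ (hxn g hg) y hy
    rw [face_nudge hD hS.adapted] at hy
    exact ⟨y, hy.1, this⟩
  obtain ⟨y₁, hy₁, h₁⟩ := hmax f hfN
  obtain ⟨y₂, hy₂, h₂⟩ := hmax (-f) (neg_mem hfN)
  have hall' : face S f = S := Set.Subset.antisymm (face_subset S f) fun y hy =>
    ⟨hy, fun w hw => by
      have h3 := hy₁.2 w hw
      have h4 := hy₂.2 y hy
      rw [inner_neg_right, inner_neg_right] at h4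
      linarith⟩
  rw [← hall'] at hfS
  exact hf0 (inner_self_eq_zero.1 (inner_eq_zero_of_mem_vectorSpan_face hfS))

/-! ### All faces are centrally symmetric -/

/-- If the faces of one dimension `j` with `2 ≤ j ≤ dim S - 2` are centrally symmetric, so are the
faces of all dimensions. -/
theorem isSymm_face_of_isSymm_faces {D S : Set E} (hD : D.Finite) (hS : IsVertexSet D S) {j : ℕ}
    (hj : 2 ≤ j) (hjS : j + 2 ≤ polyDim S)
    (hs : ∀ u, polyDim (face S u) = j → IsSymm (face S u)) (u : E) : IsSymm (face S u) := by
  have hup : ∀ i, j ≤ i → ∀ u, polyDim (face S u) = i → IsSymm (face S u) := by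
    intro i hi
    induction i, hi using Nat.le_induction with
    | base => exact hs
    | succ i hi ih =>
      intro u hu
      refine isSymm_of_facets hD (hS.face u) (by omega) hu fun w hw => ?_
      rw [← face_nudge hD hS.adapted] at hw ⊢
      exact ih _ hw
  have hdown : ∀ n k, k + n = j → (∀ u, polyDim (face S u) = k → IsSymm (face S u)) ∧
      ∀ u, polyDim (face S u) = k + 1 → IsSymm (face S u) := by
    intro n
    induction n with
    | zero =>
      rintro k rfl
      exact ⟨hs, hup _ (by omega)⟩
    | succ n ih =>
      intro k hk
      obtain ⟨h1, h2⟩ := ih (k + 1) (by omega)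
      exact ⟨fun u hu => isSymm_of_faces_succ hD hS (by omega) h1 h2 hu, h1⟩
  rcases le_total j (polyDim (face S u)) with h | h
  · exact hup _ h u rfl
  · obtain ⟨n, hn⟩ := Nat.exists_eq_add_of_le h
    exact (hdown n _ hn.symm).1 u rfl

/-! ### Polytopes with centrally symmetric faces are zonotopes -/

/-- The edge vectors of the polytope with vertex set `S`, in both orientations. -/
def edgeVecs (D S : Set E) : Set E :=
  {e | e ≠ 0 ∧ ∃ a p, finrank ℝ (nullSpan D a) = 1 ∧ face S a = {p, p + e}}

lemma mem_of_mem_edgeVecs {D S : Set E} (hS : IsVertexSet D S) {e : E} (he : e ∈ edgeVecs D S) :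
    e ∈ D := by
  obtain ⟨-, a, p, -, hf⟩ := he
  have h1 : p ∈ face S a := by rw [hf]; simp
  have h2 : p + e ∈ face S a := by rw [hf]; simp
  have := hS.adapted _ h2.1 _ h1.1
  rwa [add_sub_cancel_left] at this

lemma neg_mem_edgeVecs {D S : Set E} {e : E} (he : e ∈ edgeVecs D S) : -e ∈ edgeVecs D S := by
  obtain ⟨h0, a, p, ha, hf⟩ := he
  refine ⟨neg_ne_zero.2 h0, a, p + e, ha, ?_⟩
  rw [hf, add_neg_cancel_right, Set.pair_comm]

lemma exists_edge {D S : Set E} (hS : IsVertexSet D S) {a : E} (ha : polyDim (face S a) = 1) :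
    ∃ p e, e ≠ 0 ∧ face S a = {p, p + e} := by
  obtain ⟨v, hv0, hv⟩ := finrank_eq_one_iff'.1 ha
  obtain ⟨p, hp⟩ := face_nonempty (hS.face a).finite (hS.face a).nonempty (v : E)
  obtain ⟨q, hq⟩ := face_nonempty (hS.face a).finite (hS.face a).nonempty (-(v : E))
  have hpq : face S a = {p, q} := (hS.face a).eq_pair (fun x hx y hy => by
    obtain ⟨s, hs⟩ := hv ⟨x - y, vsub_mem_vectorSpan ℝ hx hy⟩
    exact ⟨s, by rw [← Submodule.coe_smul, hs]⟩) hp hq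
  refine ⟨p, q - p, fun h => ?_, by rw [hpq, add_sub_cancel]⟩
  rw [sub_eq_zero] at h
  rw [hpq, h, Set.pair_eq_singleton, polyDim_singleton] at ha
  exact zero_ne_one ha

/-- If the two-dimensional faces are centrally symmetric, parallel edges have the same length. -/
lemma exists_face_eq_of_mem_edgeVecs {D S : Set E} (hD : D.Finite) (hS : IsVertexSet D S)
    (hs : ∀ a, polyDim (face S a) = 2 → IsSymm (face S a)) {e a : E} (he : e ∈ edgeVecs D S)
    (ha : finrank ℝ (nullSpan D a) = 1) (hea : ⟪e, a⟫ = 0) : ∃ p, face S a = {p, p + e} := by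
  have heD := mem_of_mem_edgeVecs hS he
  obtain ⟨h0, a₀, p₀, ha₀, hf⟩ := he
  have h1 : p₀ ∈ face S a₀ := by rw [hf]; simp
  have h2 : p₀ + e ∈ face S a₀ := by rw [hf]; simp
  have hea₀ : ⟪e, a₀⟫ = 0 := by
    have := inner_eq_of_mem_face h2 h1
    rw [inner_add_left] at this
    linarith
  have hline : ∀ b, finrank ℝ (nullSpan D b) = 1 → ⟪e, b⟫ = 0 → span ℝ {e} = nullSpan D b := by
    intro b hb heb
    refine Submodule.eq_of_le_of_finrank_eq ((span_singleton_le_iff_mem _ _).2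
      ((mem_nullSpan_iff heD).2 heb)) ?_
    rw [finrank_span_singleton h0, hb]
  have hd₀ : polyDim (face S a₀) = 1 := by
    have h3 := polyDim_le_of_adapted hS.adapted a₀
    have h4 : polyDim (face S a₀) ≠ 0 := fun h => h0 (by
      have := polyDim_eq_zero_iff.1 h h2 h1
      rwa [add_eq_left] at this)
    omega
  have h5 := shape_face_pm_of_isSymm hD hS (k := 1) hs (u := a₀) (v := a) ha₀
    (by rw [← hline a ha hea, ← hline a₀ ha₀ hea₀])
  rw [← ((hS.face a₀).isSymm_of_polyDim_one hd₀).shape_eq, or_self] at h5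
  obtain ⟨t, ht⟩ := (shape_eq_iff hd₀).1 h5.symm
  refine ⟨t + p₀, ?_⟩
  rw [ht, hf, Set.vadd_set_insert, Set.vadd_set_singleton, vadd_eq_add, vadd_eq_add, add_assoc]

lemma finite_edgeVecs {D S : Set E} (hD : D.Finite) (hS : IsVertexSet D S) :
    (edgeVecs D S).Finite := hD.subset fun _ he => mem_of_mem_edgeVecs hS he

/-- The vertex in a generic direction `u` is the sum of half the edge vectors, oriented along `u`.
(As each edge vector occurs in both orientations, the factor is `1 / 4`.) -/
lemma exists_vertex_formula {D S : Set E} (hD : D.Finite) (hS : IsVertexSet D S)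
    (hs : ∀ a, polyDim (face S a) = 2 → IsSymm (face S a)) :
    ∃ c : E, ∀ u, nullSpan D u = ⊥ → ∀ x ∈ face S u,
      x = c + (1 / 4 : ℝ) • ∑ e ∈ (finite_edgeVecs hD hS).toFinset,
        (SignType.sign ⟪e, u⟫ : ℝ) • e := by
  classical
  set A := (finite_edgeVecs hD hS).toFinset with hA
  have hmem : ∀ e, e ∈ A ↔ e ∈ edgeVecs D S := fun e => Set.Finite.mem_toFinset _
  set σ : E → E := fun u => ∑ e ∈ A, (SignType.sign ⟪e, u⟫ : ℝ) • e with hσ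
  obtain ⟨u₀, hu₀⟩ := exists_regular hD
  obtain ⟨x₀, hx₀⟩ := face_nonempty hS.finite hS.nonempty u₀
  refine ⟨x₀ - (1 / 4 : ℝ) • σ u₀, fun u hu => ?_⟩
  refine chamber_induction hD (N := ⊥)
    (Q := fun u => ∀ x ∈ face S u, x = x₀ - (1 / 4 : ℝ) • σ u₀ + (1 / 4 : ℝ) • σ u) ?_ ?_ hu₀ hu ?_
  · intro v v' hv hQ
    have : σ v' = σ v := Finset.sum_congr rfl fun e he => by
      rw [hv e (mem_of_mem_edgeVecs hS ((hmem e).1 he))]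
    rwa [this, ← hv.face_eq hS.adapted]
  · intro a b hab ha hQ x hx
    rw [finrank_bot] at ha
    rw [face_nudge hD hS.adapted] at hQ hx
    obtain ⟨x', hx'⟩ := face_nonempty (hS.face a).finite (hS.face a).nonempty (-b)
    have hsame : ∀ e ∈ A, ⟪e, a⟫ ≠ 0 → (SignType.sign ⟪e, nudge D a b⟫ : ℝ) • e -
        (SignType.sign ⟪e, nudge D a (-b)⟫ : ℝ) • e = 0 := by
      intro e he h
      have heD := mem_of_mem_edgeVecs hS ((hmem e).1 he)
      rw [sign_nudge_of_ne hD heD h, sign_nudge_of_ne hD heD h, sub_self]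
    suffices hdiff : x - x' = (1 / 4 : ℝ) • (σ (nudge D a b) - σ (nudge D a (-b))) by
      rw [← sub_add_cancel x x', hdiff, hQ x' hx']
      module
    simp only [hσ, ← Finset.sum_sub_distrib]
    have hle := polyDim_le_of_adapted hS.adapted a
    rcases (show polyDim (face S a) = 0 ∨ polyDim (face S a) = 1 by omega) with hd | hd
    · have hsub := polyDim_eq_zero_iff.1 hd
      rw [hsub hx.1 hx'.1, sub_self, Finset.sum_eq_zero, smul_zero]
      intro e he
      refine hsame e he fun h => ?_
      obtain ⟨p, hp⟩ := exists_face_eq_of_mem_edgeVecs hD hS hs ((hmem e).1 he) ha h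
      rw [hp] at hsub
      have := hsub (Set.mem_insert_of_mem p (Set.mem_singleton _)) (Set.mem_insert p _)
      rw [add_eq_left] at this
      exact ((hmem e).1 he).1 this
    · -- the edge crossed from `x'` to `x`
      obtain ⟨p, e, he0, hpe, hpos⟩ : ∃ p e, e ≠ 0 ∧ face S a = {p, p + e} ∧ 0 ≤ ⟪e, b⟫ := by
        obtain ⟨p, e, he0, hpe⟩ := exists_edge hS hd
        rcases le_total 0 ⟪e, b⟫ with h | h
        · exact ⟨p, e, he0, hpe, h⟩
        · refine ⟨p + e, -e, neg_ne_zero.2 he0, ?_, by rw [inner_neg_left]; linarith⟩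
          rw [hpe, add_neg_cancel_right, Set.pair_comm]
      have heE : e ∈ edgeVecs D S := ⟨he0, a, p, ha, hpe⟩
      have heD := mem_of_mem_edgeVecs hS heE
      have hp : p ∈ face S a := by rw [hpe]; simp
      have hp' : p + e ∈ face S a := by rw [hpe]; simp
      have hea : ⟪e, a⟫ = 0 := by
        have := inner_eq_of_mem_face hp' hp
        rw [inner_add_left] at this
        linarith
      have heb : 0 < ⟪e, b⟫ := by
        refine lt_of_le_of_ne hpos fun h => he0 ?_
        have : e ∈ nullSpan D (nudge D a b) :=
          (mem_nullSpan_iff heD).2 ((inner_nudge_eq_zero_iff hD heD).2 ⟨hea, h.symm⟩)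
        rwa [hab, Submodule.mem_bot] at this
      have hxp : x = p + e := by
        have h1 := hx.1
        rw [hpe] at h1
        rcases h1 with rfl | h1
        · have := hx.2 _ hp'
          rw [inner_add_left] at this
          linarith
        · exact h1
      have hxp' : x' = p := by
        have h1 := hx'.1
        rw [hpe] at h1
        rcases h1 with h1 | rfl
        · exact h1
        · have := hx'.2 _ hp
          rw [inner_neg_right, inner_neg_right, inner_add_left] at this
          linarith
      have hne : e ≠ -e := fun h => by
        have h2 := add_eq_zero_iff_eq_neg.2 h
        rw [← two_smul ℝ] at h2
        exact he0 ((smul_eq_zero.1 h2).resolve_left two_ne_zero)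
      rw [← Finset.sum_subset (s₁ := {e, -e})]
      · rw [Finset.sum_pair hne, inner_neg_left, inner_neg_left, Left.sign_neg, Left.sign_neg,
          sign_nudge_of_eq hD heD hea, sign_nudge_of_eq hD heD hea, inner_neg_right, Left.sign_neg,
          sign_pos heb, hxp, hxp']
        simp only [SignType.coe_one, SignType.coe_neg, neg_neg]
        module
      · intro e' he'
        rw [Finset.mem_insert, Finset.mem_singleton] at he'
        rw [hmem]
        rcases he' with rfl | rfl
        · exact heE
        · exact neg_mem_edgeVecs heE
      · intro e' he' hne'
        refine hsame e' he' fun h => hne' ?_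
        obtain ⟨p', hp'e⟩ := exists_face_eq_of_mem_edgeVecs hD hS hs ((hmem e').1 he') ha h
        rw [hpe, Set.pair_eq_pair_iff] at hp'e
        rw [Finset.mem_insert, Finset.mem_singleton]
        rcases hp'e with ⟨rfl, h1⟩ | ⟨rfl, h1⟩
        · exact Or.inl (add_left_cancel h1).symm
        · right
          rw [add_assoc, add_eq_left] at h1
          exact (neg_eq_of_add_eq_zero_left h1).symm
  · intro x hx
    rw [subsingleton_face_of_nullSpan hS.adapted hu₀ hx hx₀, sub_add_cancel]

/-- A polytope whose two-dimensional faces are centrally symmetric is a zonotope. -/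
theorem exists_convexHull_eq {D S : Set E} (hD : D.Finite) (hS : IsVertexSet D S)
    (hs : ∀ a, polyDim (face S a) = 2 → IsSymm (face S a)) :
    ∃ (A : Finset E) (v : E), convexHull ℝ S =
      {x | ∃ t : E → ℝ, (∀ e, 0 ≤ t e ∧ t e ≤ 1) ∧ x = v + ∑ e ∈ A, t e • (1 / 2 : ℝ) • e} := by
  obtain ⟨c, hc⟩ := exists_vertex_formula hD hS hs
  set A := (finite_edgeVecs hD hS).toFinset
  refine ⟨A, c - ∑ e ∈ A, (1 / 4 : ℝ) • e, Set.Subset.antisymm (convexHull_min ?_ ?_) ?_⟩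
  · intro x hx
    obtain ⟨u, hu, hxu⟩ := hS.exists_face_eq_singleton hD hx
    refine ⟨fun e => (1 + (SignType.sign ⟪e, u⟫ : ℝ)) / 2, fun e => ?_, ?_⟩
    · dsimp only
      rcases SignType.trichotomy (SignType.sign ⟪e, u⟫) with h | h | h <;> rw [h] <;> norm_num
    · conv_lhs => rw [hc u hu x (by rw [hxu]; rfl)]
      rw [sub_add_eq_add_sub, add_sub_assoc, ← Finset.sum_sub_distrib, Finset.smul_sum]
      congr 1
      refine Finset.sum_congr rfl fun e _ => ?_
      module
  · rintro _ ⟨t, ht, rfl⟩ _ ⟨s, hs, rfl⟩ α β hα hβ hαβ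
    refine ⟨fun e => α * t e + β * s e, fun e => ⟨?_, ?_⟩, ?_⟩
    · exact add_nonneg (mul_nonneg hα (ht e).1) (mul_nonneg hβ (hs e).1)
    · calc α * t e + β * s e ≤ α * 1 + β * 1 := by
            gcongr
            exacts [(ht e).2, (hs e).2]
        _ = 1 := by rw [mul_one, mul_one, hαβ]
    · obtain rfl : β = 1 - α := by linarith
      simp only [add_smul, Finset.sum_add_distrib, mul_smul, ← Finset.smul_sum]
      module
  · rintro _ ⟨t, ht, rfl⟩
    by_contra hcon
    obtain ⟨l, r, hl, hr⟩ := geometric_hahn_banach_closed_point (convex_convexHull ℝ S)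
      (hS.finite.isClosed_convexHull ℝ) hcon
    set f := (InnerProductSpace.toDual ℝ E).symm l with hf
    have hlf : ∀ x, l x = ⟪x, f⟫ := fun x => by
      rw [real_inner_comm, hf, InnerProductSpace.toDual_symm_apply]
    obtain ⟨w, -, hw⟩ := exists_nullSpan_nudge_eq hD (N := ⊥) bot_le
    have hu := hw f (by simp)
    obtain ⟨x, hx⟩ := face_nonempty hS.finite hS.nonempty (nudge D f w)
    have h1 := hl x (subset_convexHull ℝ S hx.1)
    rw [hlf, hc _ hu x hx] at h1
    rw [hlf] at hr
    refine absurd (h1.trans hr) (not_lt.2 ?_)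
    rw [sub_add_eq_add_sub, add_sub_assoc, ← Finset.sum_sub_distrib, Finset.smul_sum,
      inner_add_left, inner_add_left, sum_inner, sum_inner]
    refine add_le_add le_rfl (Finset.sum_le_sum fun e he => ?_)
    have heD := mem_of_mem_edgeVecs hS ((Set.Finite.mem_toFinset _).1 he)
    simp only [inner_sub_left, real_inner_smul_left]
    obtain ⟨ht0, ht1⟩ := ht e
    rcases lt_trichotomy ⟪e, f⟫ 0 with h | h | h
    · rw [sign_nudge_of_ne hD heD h.ne, sign_neg h, SignType.coe_neg, SignType.coe_one]
      nlinarith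
    · rw [h]
      simp
    · rw [sign_nudge_of_ne hD heD h.ne', sign_pos h, SignType.coe_one]
      nlinarith

/-! ### From vertex sets to convex hulls -/

/-- Every polytope is the convex hull of a set of vertices, namely of its extreme points. -/
lemma exists_isVertexSet {S₀ : Set E} (hS₀ : S₀.Finite) (hne : S₀.Nonempty) :
    ∃ D S : Set E, D.Finite ∧ IsVertexSet D S ∧ convexHull ℝ S = convexHull ℝ S₀ := by
  set P := convexHull ℝ S₀ with hP
  have hPc : Convex ℝ P := convex_convexHull ℝ S₀
  set S := P.extremePoints ℝ with hS
  have hSfin : S.Finite := hS₀.subset extremePoints_convexHull_subset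
  have hhull : convexHull ℝ S = P := by
    rw [← (hSfin.isClosed_convexHull ℝ).closure_eq,
      closure_convexHull_extremePoints (hS₀.isCompact_convexHull ℝ) hPc]
  refine ⟨S - S, S, hSfin.sub hSfin, ⟨hSfin, ?_, fun x hx y hy => Set.sub_mem_sub hx hy, ?_⟩, hhull⟩
  · rw [← convexHull_nonempty_iff (𝕜 := ℝ), hhull, hP, convexHull_nonempty_iff]
    exact hne
  · intro x hx
    have h1 : x ∉ convexHull ℝ (S \ {x}) := fun h =>
      (hPc.mem_extremePoints_iff_mem_sdiff_convexHull_sdiff.1 hx).2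
        (convexHull_mono (Set.sdiff_subset_sdiff_left extremePoints_subset) h)
    obtain ⟨l, r, hl, hr⟩ := geometric_hahn_banach_closed_point (convex_convexHull ℝ _)
      ((hSfin.subset Set.sdiff_subset).isClosed_convexHull ℝ) h1
    refine ⟨(InnerProductSpace.toDual ℝ E).symm l, Set.Subset.antisymm (fun y hy => ?_) ?_⟩
    · by_contra hyx
      have h2 := hl y (subset_convexHull ℝ _ ⟨hy.1, hyx⟩)
      have h3 := hy.2 x hx
      rw [real_inner_comm, InnerProductSpace.toDual_symm_apply, real_inner_comm,
        InnerProductSpace.toDual_symm_apply] at h3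
      linarith
    · rw [Set.singleton_subset_iff]
      refine ⟨hx, fun y hy => ?_⟩
      rw [real_inner_comm, InnerProductSpace.toDual_symm_apply, real_inner_comm,
        InnerProductSpace.toDual_symm_apply]
      by_cases hyx : y = x
      · rw [hyx]
      · linarith [hl y (subset_convexHull ℝ _ ⟨hy, hyx⟩)]

lemma isExposed_face (P : Set E) (u : E) : IsExposed ℝ P (face P u) := fun _ =>
  ⟨InnerProductSpace.toDual ℝ E u, by
    have h : ∀ x, ⟪u, x⟫ = ⟪x, u⟫ := fun x => real_inner_comm x u
    simp only [InnerProductSpace.toDual_apply_apply, h]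
    rfl⟩

lemma exists_eq_face_of_isExposed {P F : Set E} (hne : F.Nonempty) (h : IsExposed ℝ P F) :
    ∃ u, F = face P u := by
  obtain ⟨l, rfl⟩ := h hne
  refine ⟨(InnerProductSpace.toDual ℝ E).symm l, ?_⟩
  ext x
  simp only [face, Set.mem_ofPred_eq, real_inner_comm ((InnerProductSpace.toDual ℝ E).symm l),
    InnerProductSpace.toDual_symm_apply]

/-- The vertices of a face of a polytope are the vertices of the polytope lying in it. -/
lemma face_convexHull {S : Set E} (hS : S.Finite) (u : E) :
    face (convexHull ℝ S) u = convexHull ℝ (face S u) := by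
  have hex := isExposed_face (convexHull ℝ S) u
  have hle : ∀ x ∈ face S u, ∀ y ∈ convexHull ℝ S, ⟪y, u⟫ ≤ ⟪x, u⟫ := by
    intro x hx
    refine convexHull_min (t := {y | ⟪y, u⟫ ≤ ⟪x, u⟫}) (fun y hy => hx.2 y hy) ?_
    intro y hy z hz α β hα hβ hαβ
    rw [Set.mem_ofPred_eq] at hy hz ⊢
    rw [inner_add_left, real_inner_smul_left, real_inner_smul_left]
    obtain rfl : β = 1 - α := by linarith
    nlinarith
  apply Set.Subset.antisymm
  · have hK := closure_convexHull_extremePoints (hex.isCompact (hS.isCompact_convexHull ℝ))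
      (hex.convex (convex_convexHull ℝ S))
    have hsub : (face (convexHull ℝ S) u).extremePoints ℝ ⊆ face S u := fun x hx =>
      ⟨extremePoints_convexHull_subset (hex.isExtreme.extremePoints_subset_extremePoints hx),
        fun y hy => (extremePoints_subset hx).2 y (subset_convexHull ℝ S hy)⟩
    rw [← hK, ← ((hS.subset (face_subset S u)).isClosed_convexHull ℝ).closure_eq]
    exact closure_mono (convexHull_mono hsub)
  · exact convexHull_min (fun x hx => ⟨subset_convexHull ℝ S hx.1, hle x hx⟩)
      (hex.convex (convex_convexHull ℝ S))

/-- A polytope is centrally symmetric if and only if its vertex set is. -/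
lemma isSymm_iff_isSymm_convexHull {D X : Set E} (hX : IsVertexSet D X) :
    IsSymm (convexHull ℝ X) ↔ IsSymm X := by
  constructor
  · rintro ⟨t, ht⟩
    have key : ∀ x ∈ X, t - x ∈ X := by
      intro x hx
      obtain ⟨u, hu⟩ := hX.exposed x hx
      have h1 : convexHull ℝ (face X (-u)) = {t - x} := by
        rw [← face_convexHull hX.finite, ht, face_vadd, face_neg, neg_neg,
          face_convexHull hX.finite, hu, convexHull_singleton, Set.neg_singleton,
          Set.vadd_set_singleton, vadd_eq_add, sub_eq_add_neg]
      obtain ⟨y, hy⟩ := face_nonempty hX.finite hX.nonempty (-u)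
      have h2 := subset_convexHull ℝ _ hy
      rw [h1] at h2
      exact h2 ▸ hy.1
    refine ⟨t, ?_⟩
    ext x
    rw [mem_vadd_iff, Set.mem_neg, neg_sub]
    exact ⟨key x, fun h => by simpa using key _ h⟩
  · rintro ⟨t, ht⟩
    refine ⟨t, ?_⟩
    conv_lhs => rw [ht, convexHull_vadd, convexHull_neg]

lemma isCentrallySymmetric_iff_isSymm {n : ℕ} {X : Set (EuclideanSpace ℝ (Fin n))} :
    IsCentrallySymmetric X ↔ IsSymm X := by
  have h : ∀ c : EuclideanSpace ℝ (Fin n), symmetricImage c X = ((2 : ℝ) • c) +ᵥ -X := by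
    intro c
    ext x
    rw [symmetricImage, mem_vadd_iff, Set.mem_neg, neg_sub]
    constructor
    · rintro ⟨y, hy, rfl⟩
      simpa using hy
    · intro hx
      exact ⟨_, hx, by simp⟩
  constructor
  · rintro ⟨c, hc⟩
    exact ⟨(2 : ℝ) • c, by rw [← h, ← hc]⟩
  · rintro ⟨t, ht⟩
    refine ⟨(1 / 2 : ℝ) • t, ?_⟩
    rw [h, smul_smul]
    norm_num
    exact ht

lemma setDim_convexHull {n : ℕ} (X : Set (EuclideanSpace ℝ (Fin n))) :
    setDim (convexHull ℝ X) = polyDim X := by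
  rw [setDim, affineSpan_convexHull, direction_affineSpan, polyDim]

lemma isZonotope_of_finset {n : ℕ} {P : Set (EuclideanSpace ℝ (Fin n))}
    (A : Finset (EuclideanSpace ℝ (Fin n)))
    (a : EuclideanSpace ℝ (Fin n) → EuclideanSpace ℝ (Fin n))
    (v : EuclideanSpace ℝ (Fin n))
    (h : P = {x | ∃ t : EuclideanSpace ℝ (Fin n) → ℝ, (∀ e, 0 ≤ t e ∧ t e ≤ 1) ∧
      x = v + ∑ e ∈ A, t e • a e}) : IsZonotope P := by
  classical
  set φ := A.equivFin with hφ
  refine ⟨A.card, fun i => a (φ.symm i), v, ?_⟩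
  rw [h]
  ext x
  simp only [Set.mem_ofPred_eq, zonotope, Set.mem_image]
  constructor
  · rintro ⟨t, ht, rfl⟩
    refine ⟨_, ⟨fun i => t (φ.symm i), fun i => ht _, rfl⟩, ?_⟩
    rw [Equiv.sum_comp φ.symm (fun e : A => t e • a e), Finset.sum_coe_sort A (fun e => t e • a e)]
  · rintro ⟨_, ⟨t, ht, rfl⟩, rfl⟩
    refine ⟨fun e => if he : e ∈ A then t (φ ⟨e, he⟩) else 0, fun e => ?_, ?_⟩
    · dsimp only
      split_ifs
      · exact ht _
      · norm_num
    · congr 1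
      rw [← Finset.sum_coe_sort A, ← Equiv.sum_comp φ.symm]
      refine Finset.sum_congr rfl fun i _ => ?_
      dsimp only
      rw [dif_pos (φ.symm i).2, Subtype.coe_eta, Equiv.apply_symm_apply]

end SymmetricFaces

open SymmetricFaces in
theorem theorem1p9 (n m j : ℕ) (P : Set (EuclideanSpace ℝ (Fin n)))
    (hP : IsConvexPolytope P) (hdim : setDim P = m)
    (hj : 2 ≤ j) (hjm : j + 2 ≤ m)
    (hsymm : ∀ F : Set (EuclideanSpace ℝ (Fin n)),
      IsFaceOfPolytope P F → setDim F = j → IsCentrallySymmetric F) :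
    (∀ i : ℕ, ∀ F : Set (EuclideanSpace ℝ (Fin n)),
      IsFaceOfPolytope P F → setDim F = i → IsCentrallySymmetric F) ∧
    IsCentrallySymmetric P ∧ IsZonotope P := by
  obtain ⟨S₀, hS₀, rfl⟩ := hP
  -- the empty set has dimension `0 < m`
  have hne : S₀.Nonempty := by
    by_contra hcon
    rw [Set.not_nonempty_iff_eq_empty] at hcon
    rw [setDim_convexHull, hcon, polyDim_eq_zero_iff.2 Set.subsingleton_empty] at hdim
    omega
  obtain ⟨D, S, hD, hS, hhull⟩ := exists_isVertexSet hS₀ hne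
  rw [← hhull] at hdim hsymm ⊢
  rw [setDim_convexHull] at hdim
  have hs : ∀ u, IsSymm (face S u) := by
    refine isSymm_face_of_isSymm_faces hD hS hj (by omega) fun u hu => ?_
    rw [← isSymm_iff_isSymm_convexHull (hS.face u), ← isCentrallySymmetric_iff_isSymm,
      ← face_convexHull hS.finite]
    refine hsymm _ ⟨?_, isExposed_face _ u⟩ ?_
    · rw [face_convexHull hS.finite, convexHull_nonempty_iff]
      exact (hS.face u).nonempty
    · rw [face_convexHull hS.finite, setDim_convexHull, hu]
  have hall : ∀ u, IsCentrallySymmetric (face (convexHull ℝ S) u) := fun u => by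
    rw [isCentrallySymmetric_iff_isSymm, face_convexHull hS.finite,
      isSymm_iff_isSymm_convexHull (hS.face u)]
    exact hs u
  refine ⟨fun i F hF _ => ?_, ?_, ?_⟩
  · obtain ⟨u, rfl⟩ := exists_eq_face_of_isExposed hF.1 hF.2
    exact hall u
  · have h0 : face (convexHull ℝ S) 0 = convexHull ℝ S := face_eq_self fun x _ => inner_zero_right x
    rw [← h0]
    exact hall 0
  · obtain ⟨A, v, hA⟩ := exists_convexHull_eq hD hS fun a _ => hs a
    exact isZonotope_of_finset A _ v hA
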